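/- Let $E$ be a smooth, Hausdorff, paracompact manifold of dimension $n$ and let $m<n$. Let $\tau_mE:T_mE\to E$ be the manifold of first order $m$-velocities $j_0\gamma$ of maps $\gamma:\mathbb R^m\supset O\to E$ (so $T_mE\cong\mathrm{Hom}(\mathbb R^m,TE)$), let $\mathring T_mE\subset T_mE$ be the open submanifold of regular velocities (those with $\gamma$ an immersion at $0$), let $L_m\cong GL(m,\mathbb R)$ be the first order jet group acting on velocities by $j_0\gamma\cdot j_0\phi=j_0(\gamma\circ\phi)$, and let $\rho:\mathring T_mE\to J^mE=\mathring T_mE/L_m$ be the quotient onto the set of $m$-dimensional contact elements. Let $P_m=L_m\rtimes T_mL_m$ be the principal jet group, with product $(j_0\phi_1,j_0\sigma_1)(j_0\phi_2,j_0\sigma_2)=(j_0\phi_1\, j_0\phi_2,(j_0\sigma_1\cdot j_0\phi_2)\,j_0\sigma_2)$ and global coordinates $A^i_j(j_0\phi)$, $A^i_j(j_0\sigma)$, $B^i_{jk}(j_0\sigma)$. It acts on the right on the manifold $T_mT_mE$ of double velocities by $j_0\tilde\gamma\cdot(j_0\phi,j_0\sigma)=j_0\bigl(t\mapsto\tilde\gamma(\phi(t))\cdot\sigma(t)\bigr)$.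 It has the semiholonomic subgroup $\hat{\bar L}$, given by $A(j_0\phi)=A(j_0\sigma)$; the holonomic subgroup $\bar L\subset\hat{\bar L}$, given in addition by $B^i_{jk}=B^i_{kj}$; and the curvature subgroup $\tilde{\bar L}\subset\hat{\bar L}$, given in addition by $B^i_{jk}+B^i_{kj}=0$. Let $V_m\tau_m^\circ E\subset T_mT_mE$ be the set of double velocities at points of $\mathring T_mE$ which are vertical over $E$; it is a vector bundle over $\mathring T_mE$ whose fibre at a velocity over $x\in E$ is identified, by vertical lifts, with the space of bilinear maps $\mathbb R^m\times\mathbb R^m\to T_xE$. Let $V_m\tau_m^\circ E^{\mathrm{sym}}$ and $V_m\tau_m^\circ E^{\mathrm{alt}}$ be the subbundles corresponding to symmetric and skew-symmetric bilinear maps. Then $J^mE$ has a structure of a smooth Hausdorff paracompact manifold for which $\rho$ is a submersion, and each of the quotients $$V_m\tau_m^\circ E/\hat{\bar L},\qquad V_m\tau_m^\circ E^{\mathrm{sym}}/\bar L,\qquad V_m\tau_m^\circ E^{\mathrm{alt}}/\tilde{\bar L}$$ has a structure of a smooth Hausdorff paracompact manifold for which the quotient map is a submersion. With these (necessarily unique)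 structures, each of the three quotients is, through the map induced by $V_m\tau_m^\circ E\to\mathring T_mE$, the total space of a smooth vector bundle over $J^mE$, whose vector space structure on fibres is the projection of that on the fibres of $V_m\tau_m^\circ E\to\mathring T_mE$. The model fibres are respectively the spaces of all, of symmetric, and of skew-symmetric $m\times m$ arrays with entries in $\mathbb R^{n-m}$. -/

import Mathlib

open Bundle Set
open scoped Manifold ContDiff Topology

noncomputable section

namespace DoubleContact

/-- The Euclidean space `ℝᵏ`. -/
abbrev Eu (k : ℕ) : Type := EuclideanSpace ℝ (Fin k)

/-! ### Velocities -/

section Velocity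

variable {F H : Type*} [NormedAddCommGroup F] [NormedSpace ℝ F] [TopologicalSpace H]
variable {F' H' : Type*} [NormedAddCommGroup F'] [NormedSpace ℝ F'] [TopologicalSpace H']

/-- The manifold `T_m M` of first order `m`-velocities of `M`. The velocity `j₀γ` of a map `γ` from
a neighbourhood of `0` in `ℝᵐ` to `M` is the pair `(γ 0, Dγ(0))`, where `Dγ(0) : ℝᵐ → T_{γ(0)} M` is
linear; thus `T_m M = TM ⊗ ℝᵐ*` is the vector bundle `Hom(ℝᵐ, TM)` over `M`, with its standard
smooth structure as a bundle of linear maps. -/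
abbrev Velocity (m : ℕ) (I : ModelWithCorners ℝ F H) (M : Type*) [TopologicalSpace M]
    [ChartedSpace H M] : Type _ :=
  TotalSpace (Eu m →L[ℝ] F) (fun x : M => Trivial M (Eu m) x →L[ℝ] TangentSpace I x)

/-- The model with corners of the manifold `T_m M`. -/
abbrev velModel (m : ℕ) (I : ModelWithCorners ℝ F H) :
    ModelWithCorners ℝ (F × (Eu m →L[ℝ] F)) (ModelProd H (Eu m →L[ℝ] F)) :=
  I.prod 𝓘(ℝ, Eu m →L[ℝ] F)

instance Velocity.topologicalSpace (m : ℕ) (I : ModelWithCorners ℝ F H) (M : Type*)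
    [TopologicalSpace M] [ChartedSpace H M] [IsManifold I ∞ M] :
    TopologicalSpace (Velocity m I M) := inferInstance

instance Velocity.chartedSpace (m : ℕ) (I : ModelWithCorners ℝ F H) (M : Type*)
    [TopologicalSpace M] [ChartedSpace H M] [IsManifold I ∞ M] :
    ChartedSpace (ModelProd H (Eu m →L[ℝ] F)) (Velocity m I M) := inferInstance

instance Velocity.isManifold (m : ℕ) (I : ModelWithCorners ℝ F H) (M : Type*)
    [TopologicalSpace M] [ChartedSpace H M] [IsManifold I ∞ M] :
    IsManifold (velModel m I) ∞ (Velocity m I M) := inferInstance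

/-- The prolongation `T_m f : T_m M → T_m N`, `j₀γ ↦ j₀(f ∘ γ)`. -/
def prolong (m : ℕ) (I : ModelWithCorners ℝ F H) (I' : ModelWithCorners ℝ F' H')
    {M : Type*} [TopologicalSpace M] [ChartedSpace H M]
    {N : Type*} [TopologicalSpace N] [ChartedSpace H' N] (f : M → N) (p : Velocity m I M) :
    Velocity m I' N :=
  ⟨f p.1, (mfderiv I I' f p.1).comp p.2⟩

/-- The velocity `j₀(t ↦ (γ(t), δ(t)))` in `M × N` of a pair of maps with velocities `j₀γ` and
`j₀δ`. -/
def velPair {m : ℕ} {I : ModelWithCorners ℝ F H} {I' : ModelWithCorners ℝ F' H'}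
    {M : Type*} [TopologicalSpace M] [ChartedSpace H M]
    {N : Type*} [TopologicalSpace N] [ChartedSpace H' N]
    (p : Velocity m I M) (q : Velocity m I' N) : Velocity m (I.prod I') (M × N) :=
  ⟨(p.1, q.1), ContinuousLinearMap.prod p.2 q.2⟩

/-- The jet group `L_m = GL(m, ℝ)` (1-jets at `0` of local diffeomorphisms of `ℝᵐ` fixing `0`). -/
abbrev JetGroup (m : ℕ) : Type := (Eu m →L[ℝ] Eu m)ˣ

/-- The right action of the jet group on velocities, `j₀γ · j₀φ = j₀(γ ∘ φ)`. -/
def velAct {m : ℕ} {I : ModelWithCorners ℝ F H} {M : Type*} [TopologicalSpace M]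
    [ChartedSpace H M] (p : Velocity m I M) (a : JetGroup m) : Velocity m I M :=
  ⟨p.1, p.2.comp (a : Eu m →L[ℝ] Eu m)⟩

end Velocity

/-! ### The principal jet group -/

/-- The principal jet group `P_m = L_m ⋊ T_m L_m`. An element is a pair `(j₀φ, j₀σ)`; since `L_m` is
open in `End(ℝᵐ)`, the velocity `j₀σ` is given by `σ(0)` and the derivative
`Dσ(0) : ℝᵐ → End(ℝᵐ)`. In coordinates, `phi` is `A(j₀φ)`, `sig` is `A(j₀σ)` and the `i`-th component
of `dsig eₖ eⱼ` is `Bⁱⱼₖ(j₀σ)`. -/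
@[ext]
structure PrincipalJetGroup (m : ℕ) where
  /-- the jet `j₀φ` -/
  phi : JetGroup m
  /-- the value `σ(0)` -/
  sig : JetGroup m
  /-- the derivative `Dσ(0)` -/
  dsig : Eu m →L[ℝ] Eu m →L[ℝ] Eu m

namespace PrincipalJetGroup

variable {m : ℕ}

/-- The velocity `j₀σ` in `T_m L_m`. -/
def velSig (g : PrincipalJetGroup m) : Velocity m 𝓘(ℝ, Eu m →L[ℝ] Eu m) (JetGroup m) :=
  ⟨g.sig, g.dsig⟩

/-- The product `(j₀φ₁, j₀σ₁)(j₀φ₂, j₀σ₂) = (j₀φ₁ j₀φ₂, (j₀σ₁ · j₀φ₂) j₀σ₂)` of `P_m`: the last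
component is the derivative at `0` of `t ↦ σ₁(φ₂(t)) σ₂(t)`. -/
instance : Mul (PrincipalJetGroup m) where
  mul g h :=
    { phi := g.phi * h.phi
      sig := g.sig * h.sig
      dsig := g.dsig.bilinearComp (h.phi : Eu m →L[ℝ] Eu m) (h.sig : Eu m →L[ℝ] Eu m) +
        (ContinuousLinearMap.compL ℝ (Eu m) (Eu m) (Eu m) (g.sig : Eu m →L[ℝ] Eu m)).comp h.dsig }

instance : One (PrincipalJetGroup m) where
  one := ⟨1, 1, 0⟩

instance : Inv (PrincipalJetGroup m) where
  inv g :=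
    { phi := g.phi⁻¹
      sig := g.sig⁻¹
      dsig := -((ContinuousLinearMap.compL ℝ (Eu m) (Eu m) (Eu m)
          ((g.sig⁻¹ : JetGroup m) : Eu m →L[ℝ] Eu m)).comp
        (g.dsig.bilinearComp ((g.phi⁻¹ : JetGroup m) : Eu m →L[ℝ] Eu m)
          ((g.sig⁻¹ : JetGroup m) : Eu m →L[ℝ] Eu m))) }

@[simp] lemma mul_phi (g h : PrincipalJetGroup m) : (g * h).phi = g.phi * h.phi := rfl
@[simp] lemma mul_sig (g h : PrincipalJetGroup m) : (g * h).sig = g.sig * h.sig := rfl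
@[simp] lemma mul_dsig (g h : PrincipalJetGroup m) (v w : Eu m) :
    (g * h).dsig v w =
      g.dsig ((h.phi : Eu m →L[ℝ] Eu m) v) ((h.sig : Eu m →L[ℝ] Eu m) w) +
        (g.sig : Eu m →L[ℝ] Eu m) (h.dsig v w) := rfl
@[simp] lemma one_phi : (1 : PrincipalJetGroup m).phi = 1 := rfl
@[simp] lemma one_sig : (1 : PrincipalJetGroup m).sig = 1 := rfl
@[simp] lemma one_dsig : (1 : PrincipalJetGroup m).dsig = 0 := rfl
@[simp] lemma inv_phi (g : PrincipalJetGroup m) : g⁻¹.phi = g.phi⁻¹ := rfl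
@[simp] lemma inv_sig (g : PrincipalJetGroup m) : g⁻¹.sig = g.sig⁻¹ := rfl
@[simp] lemma inv_dsig (g : PrincipalJetGroup m) (v w : Eu m) :
    g⁻¹.dsig v w = -((g.sig⁻¹ : JetGroup m) : Eu m →L[ℝ] Eu m)
      (g.dsig (((g.phi⁻¹ : JetGroup m) : Eu m →L[ℝ] Eu m) v)
        (((g.sig⁻¹ : JetGroup m) : Eu m →L[ℝ] Eu m) w)) := rfl

lemma inv_apply_self (a : JetGroup m) (v : Eu m) :
    ((a⁻¹ : JetGroup m) : Eu m →L[ℝ] Eu m) ((a : Eu m →L[ℝ] Eu m) v) = v := by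
  change (((a⁻¹ : JetGroup m) : Eu m →L[ℝ] Eu m) * (a : Eu m →L[ℝ] Eu m)) v = v
  rw [Units.inv_mul]; rfl

instance : Group (PrincipalJetGroup m) :=
  Group.ofLeftAxioms
    (by
      intro a b c
      ext1
      · simp [mul_assoc]
      · simp [mul_assoc]
      · refine ContinuousLinearMap.ext fun v => ContinuousLinearMap.ext fun w => ?_
        simp [add_assoc])
    (by
      intro a
      ext1
      · simp
      · simp
      · refine ContinuousLinearMap.ext fun v => ContinuousLinearMap.ext fun w => ?_
        simp)
    (by
      intro a
      ext1
      · simp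
      · simp
      · refine ContinuousLinearMap.ext fun v => ContinuousLinearMap.ext fun w => ?_
        simp [inv_apply_self])

/-- The exchange map `e` of `P_m`. In terms of maps `χ(s, t)` with `D₁χ(0,0) = A(j₀σ)`,
`D₂χ(0,0) = A(j₀φ)` and `D₁D₂χ(0,0) = B(j₀σ)`, it sends `χ(s, t)` to `χ(t, s)`. -/
def exchange (g : PrincipalJetGroup m) : PrincipalJetGroup m := ⟨g.sig, g.phi, g.dsig.flip⟩

variable (m)

/-- The semiholonomic subgroup of `P_m`: the elements `(j₀φ, j₀σ)` with `j₀φ = σ(0)`. -/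
def semiholonomic : Subgroup (PrincipalJetGroup m) where
  carrier := {g | g.phi = g.sig}
  mul_mem' {g h} hg hh := by
    simp only [mem_ofPred_eq, mul_phi, mul_sig] at *
    rw [hg, hh]
  one_mem' := rfl
  inv_mem' {g} hg := by
    simp only [mem_ofPred_eq, inv_phi, inv_sig] at *
    rw [hg]

/-- The holonomic subgroup of `P_m`: the fixed points of the exchange map. -/
def holonomic : Subgroup (PrincipalJetGroup m) where
  carrier := {g | exchange g = g}
  mul_mem' {g h} hg hh := by
    simp only [mem_ofPred_eq, exchange, PrincipalJetGroup.ext_iff, ContinuousLinearMap.ext_iff,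
      ContinuousLinearMap.flip_apply, mul_phi, mul_sig, mul_dsig] at *
    obtain ⟨h1, -, h2⟩ := hg
    obtain ⟨h3, -, h4⟩ := hh
    refine ⟨by rw [h1, h3], by rw [h1, h3], fun v w => ?_⟩
    rw [h2, h4, h3]
  one_mem' := by
    simp only [mem_ofPred_eq, exchange, PrincipalJetGroup.ext_iff]
    exact ⟨rfl, rfl, rfl⟩
  inv_mem' {g} hg := by
    simp only [mem_ofPred_eq, exchange, PrincipalJetGroup.ext_iff, ContinuousLinearMap.ext_iff,
      ContinuousLinearMap.flip_apply, inv_phi, inv_sig, inv_dsig] at *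
    obtain ⟨h1, -, h2⟩ := hg
    refine ⟨by rw [h1], by rw [h1], fun v w => ?_⟩
    rw [h2, h1]

/-- The curvature subgroup of `P_m`: the semiholonomic elements with `Bⁱⱼₖ + Bⁱₖⱼ = 0`. -/
def curvature : Subgroup (PrincipalJetGroup m) where
  carrier := {g | g.phi = g.sig ∧ ∀ v w, g.dsig v w + g.dsig w v = 0}
  mul_mem' {g h} hg hh := by
    obtain ⟨h1, h2⟩ := hg
    obtain ⟨h3, h4⟩ := hh
    refine ⟨by simp [h1, h3], fun v w => ?_⟩
    simp only [mul_dsig, h3]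
    rw [add_add_add_comm, h2, ← map_add, h4, map_zero, add_zero]
  one_mem' := ⟨rfl, fun v w => by simp⟩
  inv_mem' {g} hg := by
    obtain ⟨h1, h2⟩ := hg
    refine ⟨by simp [h1], fun v w => ?_⟩
    simp only [inv_dsig, h1]
    rw [← neg_add, ← map_add, h2, map_zero, neg_zero]

end PrincipalJetGroup

/-! ### Double velocities, contact elements, and the quotients -/

section Manifolds

variable (n m : ℕ) (E : Type*) [TopologicalSpace E] [ChartedSpace (Eu n) E]
  [IsManifold (𝓡 n) ∞ E]

/-- The manifold `T_m E` of `m`-velocities in `E`. -/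
abbrev Tm : Type _ := Velocity m (𝓡 n) E

/-- The model with corners of `T_m E`. -/
abbrev TmModel := velModel m (𝓡 n)

/-- The manifold `T_m T_m E` of double velocities in `E`. -/
abbrev TmTm : Type _ := Velocity m (TmModel n m) (Tm n m E)

/-- The model with corners of `T_m T_m E`. -/
abbrev TmTmModel := velModel m (TmModel n m)

variable {n m E}

/-- A velocity `j₀γ` is regular if `γ` is an immersion near `0`. -/
def Regular (p : Tm n m E) : Prop := Function.Injective p.2

/-- The action of `P_m` on double velocities,
`j₀γ̃ · (j₀φ, j₀σ) = (j₀γ̃ · j₀φ) · j₀σ = j₀(t ↦ γ̃(φ(t)) · σ(t))`: first `L_m` acts by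
reparametrization on velocities in `T_m E`, and then `T_m L_m` acts by the prolongation of the
action `T_m E × L_m → T_m E`. -/
def doubleAct (x : TmTm n m E) (g : PrincipalJetGroup m) : TmTm n m E :=
  prolong m ((TmModel n m).prod 𝓘(ℝ, Eu m →L[ℝ] Eu m)) (TmModel n m)
    (fun z : Tm n m E × JetGroup m => velAct z.1 z.2) (velPair (velAct x g.phi) g.velSig)

/-- The vertical lift `Hom(ℝᵐ, T_x E) → T_p (T_m E)` at `p ∈ T_m E` over `x ∈ E`: the derivative at
`p` of the inclusion of the fibre over `x`. -/
def vertLift (p : Tm n m E) :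
    (Eu m →L[ℝ] TangentSpace (𝓡 n) p.1) →L[ℝ] TangentSpace (TmModel n m) p :=
  mfderiv 𝓘(ℝ, Eu m →L[ℝ] Eu n) (TmModel n m)
    (fun C : Eu m →L[ℝ] Eu n => (⟨p.1, C⟩ : Tm n m E)) p.2

/-- The double velocities `A : ℝᵐ → T_p (T_m E)` at `p` which are vertical over `E`, that is,
which are mapped to zero by the derivative of `T_m E → E`. -/
def vertFibre (p : Tm n m E) : Submodule ℝ (Eu m →L[ℝ] TangentSpace (TmModel n m) p) where
  carrier := {A | ∀ v, mfderiv (TmModel n m) (𝓡 n) (fun q : Tm n m E => q.1) p (A v) = 0}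
  add_mem' {A B} hA hB v := by
    rw [add_apply, ContinuousLinearMap.map_add, hA v, hB v, add_zero]
  zero_mem' v := by rw [zero_apply, ContinuousLinearMap.map_zero]
  smul_mem' c A hA v := by
    rw [smul_apply, ContinuousLinearMap.map_smul, hA v, smul_zero]

/-- The symmetric vertical double velocities at `p`: under the identification of the vertical
double velocities at `p` with the bilinear maps `B : ℝᵐ × ℝᵐ → T_x E` by vertical lifts, these
correspond to the symmetric bilinear maps. -/
def vertFibreSym (p : Tm n m E) : Submodule ℝ (Eu m →L[ℝ] TangentSpace (TmModel n m) p) where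
  carrier := {A | ∃ B : Eu m →L[ℝ] Eu m →L[ℝ] TangentSpace (𝓡 n) p.1,
    (∀ v w, B v w = B w v) ∧ ∀ v, A v = vertLift p (B v)}
  add_mem' := by
    rintro A A' ⟨B, h1, h2⟩ ⟨B', h1', h2'⟩
    exact ⟨B + B', fun v w => by simp [h1 v w, h1' v w], fun v => by
      rw [add_apply, add_apply, ContinuousLinearMap.map_add,
        h2, h2']⟩
  zero_mem' := ⟨0, fun v w => by simp, fun v => by
    rw [zero_apply, zero_apply,
      ContinuousLinearMap.map_zero]⟩
  smul_mem' := by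
    rintro c A ⟨B, h1, h2⟩
    exact ⟨c • B, fun v w => by simp [h1 v w], fun v => by
      rw [smul_apply, smul_apply,
        ContinuousLinearMap.map_smul, h2]⟩

/-- The skew-symmetric vertical double velocities at `p`, corresponding to the skew-symmetric
bilinear maps `ℝᵐ × ℝᵐ → T_x E`. -/
def vertFibreAlt (p : Tm n m E) : Submodule ℝ (Eu m →L[ℝ] TangentSpace (TmModel n m) p) where
  carrier := {A | ∃ B : Eu m →L[ℝ] Eu m →L[ℝ] TangentSpace (𝓡 n) p.1,
    (∀ v w, B v w = -B w v) ∧ ∀ v, A v = vertLift p (B v)}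
  add_mem' := by
    rintro A A' ⟨B, h1, h2⟩ ⟨B', h1', h2'⟩
    exact ⟨B + B', fun v w => by simp [h1 v w, h1' v w, add_comm], fun v => by
      rw [add_apply, add_apply, ContinuousLinearMap.map_add,
        h2, h2']⟩
  zero_mem' := ⟨0, fun v w => by simp, fun v => by
    rw [zero_apply, zero_apply,
      ContinuousLinearMap.map_zero]⟩
  smul_mem' := by
    rintro c A ⟨B, h1, h2⟩
    exact ⟨c • B, fun v w => by simp [h1 v w], fun v => by
      rw [smul_apply, smul_apply,
        ContinuousLinearMap.map_smul, h2]⟩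

variable (n m E)

/-- The open submanifold `F_m E` of regular velocities. -/
abbrev Fm : Type _ := {p : Tm n m E // Regular p}

/-- The set `J^m E = F_m E / L_m` of `m`-dimensional contact elements of `E`. -/
def Jm : Type _ := Quot (fun p q : Fm n m E => ∃ a : JetGroup m, velAct p.1 a = q.1)

instance : TopologicalSpace (Jm n m E) :=
  inferInstanceAs (TopologicalSpace (Quot _))

variable {n m E}

/-- The projection `ρ : F_m E → J^m E`. -/
def rho (p : Fm n m E) : Jm n m E := Quot.mk _ p

/-- The part over `F_m E` of the family `W` of spaces of double velocities, as a subset of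
`T_m T_m E`. For the families `vertFibre`, `vertFibreSym`, `vertFibreAlt` these are
`V_m τ°_m E`, `V_m τ°_m E^sym` and `V_m τ°_m E^alt`. -/
def overRegular (W : ∀ p : Tm n m E, Submodule ℝ (Eu m →L[ℝ] TangentSpace (TmModel n m) p)) :
    Set (TmTm n m E) :=
  {x | Regular x.1 ∧ x.2 ∈ W x.1}

/-- The quotient of a subset of `T_m T_m E` by the action of a subgroup of `P_m`. -/
def OrbitSpace (S : Set (TmTm n m E)) (G : Subgroup (PrincipalJetGroup m)) : Type _ :=
  Quot (fun x y : S => ∃ g ∈ G, doubleAct x.1 g = y.1)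

instance (S : Set (TmTm n m E)) (G : Subgroup (PrincipalJetGroup m)) :
    TopologicalSpace (OrbitSpace S G) :=
  instTopologicalSpaceQuot

/-- The quotient map. -/
def OrbitSpace.mk {S : Set (TmTm n m E)} (G : Subgroup (PrincipalJetGroup m)) (x : S) :
    OrbitSpace S G := Quot.mk _ x

/-- The projection to `J^m E` of a quotient of a space of double velocities over `F_m E`. -/
def OrbitSpace.proj {W : ∀ p : Tm n m E, Submodule ℝ (Eu m →L[ℝ] TangentSpace (TmModel n m) p)}
    {G : Subgroup (PrincipalJetGroup m)} : OrbitSpace (overRegular W) G → Jm n m E :=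
  Quot.lift (fun x => rho ⟨x.1.1, x.2.1⟩) (by
    rintro ⟨x, hx⟩ ⟨y, hy⟩ ⟨g, -, h⟩
    refine Quot.sound ⟨g.sig, ?_⟩
    subst h
    rfl)

end Manifolds

/-! ### Model spaces -/

section Models

variable (n m : ℕ)

/-- The model space of `J^m E`, with coordinates `uᵃ` and `uᵅᵢ` where `a ≤ n`, `i ≤ m` and `α` takes
`n - m` values. -/
abbrev JmModel : Type := Eu n × (Fin m → Eu (n - m))

/-- The arrays `vᵅᵢⱼ` with `i, j ≤ m`, where `α` takes `n - m` values. -/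
abbrev Arr : Type := Fin m → Fin m → Eu (n - m)

/-- The symmetric arrays `vᵅᵢⱼ = vᵅⱼᵢ`. -/
def ArrSym : Submodule ℝ (Arr n m) where
  carrier := {B | ∀ i j, B i j = B j i}
  add_mem' {A B} hA hB i j := by
    rw [Pi.add_apply, Pi.add_apply, Pi.add_apply, Pi.add_apply, hA i j, hB i j]
  zero_mem' i j := rfl
  smul_mem' c A hA i j := by
    rw [Pi.smul_apply, Pi.smul_apply, Pi.smul_apply, Pi.smul_apply, hA i j]

/-- The skew-symmetric arrays `vᵅᵢⱼ = -vᵅⱼᵢ`. -/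
def ArrAlt : Submodule ℝ (Arr n m) where
  carrier := {B | ∀ i j, B i j = -B j i}
  add_mem' {A B} hA hB i j := by
    rw [Pi.add_apply, Pi.add_apply, Pi.add_apply, Pi.add_apply, hA i j, hB i j, neg_add]
  zero_mem' i j := by simp
  smul_mem' c A hA i j := by
    rw [Pi.smul_apply, Pi.smul_apply, Pi.smul_apply, Pi.smul_apply, hA i j, smul_neg]

end Models

/-! ### Smooth quotients and vector bundles -/

section Submersion

variable {F H : Type*} [NormedAddCommGroup F] [NormedSpace ℝ F] [TopologicalSpace H]
  (I : ModelWithCorners ℝ F H)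
  {F' H' : Type*} [NormedAddCommGroup F'] [NormedSpace ℝ F'] [TopologicalSpace H']
  (I' : ModelWithCorners ℝ F' H')
  {M : Type*} [TopologicalSpace M] [ChartedSpace H M]
  {N : Type*} [TopologicalSpace N] [ChartedSpace H' N]

/-- A map `f` from a submanifold `S` of `M` onto a manifold `N` which is a smooth submersion: it is
onto, it extends to a smooth map in an ambient neighbourhood of each point of `S`, and it has smooth
local sections through each point of `S`. (There is at most one smooth structure on the set `N` for
which this holds.) -/
structure IsQuotientSubmersion {S : Set M} (f : S → N) : Prop where
  surjective : Function.Surjective f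
  smooth : ∀ x : S, ∃ W : Set M, IsOpen W ∧ (x : M) ∈ W ∧
    ∃ g : M → N, ContMDiffOn I I' ∞ g W ∧ ∀ y : S, (y : M) ∈ W → g y = f y
  sections : ∀ x : S, ∃ U : Set N, IsOpen U ∧ f x ∈ U ∧
    ∃ s : N → S, ContMDiffOn I' I ∞ (fun y => (s y : M)) U ∧ s (f x) = x ∧ ∀ y ∈ U, f (s y) = y

end Submersion

section Bundles

/-- The fibre of a map. -/
abbrev Fibre {Q J : Type*} (pr : Q → J) (b : J) : Type _ := {q : Q // pr q = b}

/-- The manifold `Q` is, through the map `pr : Q → J` and for the given vector space structures on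
the fibres of `pr`, the total space of a smooth vector bundle over the manifold `J` with model fibre
`K`: the fibres of `pr` form a smooth vector bundle whose total space is diffeomorphic to `Q` by the
canonical bijection. -/
def IsVectorBundleTotalSpace {B : Type*} [NormedAddCommGroup B] [NormedSpace ℝ B]
    {HB : Type*} [TopologicalSpace HB] (IB : ModelWithCorners ℝ B HB)
    (K : Type*) [NormedAddCommGroup K] [NormedSpace ℝ K]
    {J : Type*} [TopologicalSpace J] [ChartedSpace HB J]
    {Q : Type*} [TopologicalSpace Q] [ChartedSpace (ModelProd HB K) Q] (pr : Q → J)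
    [∀ b, AddCommGroup (Fibre pr b)] [∀ b, Module ℝ (Fibre pr b)] : Prop :=
  ∃ (_ : TopologicalSpace (TotalSpace K (Fibre pr))) (_ : FiberBundle K (Fibre pr))
    (_ : VectorBundle ℝ K (Fibre pr)),
    ContMDiffVectorBundle ∞ K (Fibre pr) IB ∧
    ContMDiff (IB.prod 𝓘(ℝ, K)) (IB.prod 𝓘(ℝ, K)) ∞
      (fun z : TotalSpace K (Fibre pr) => (z.2 : Q)) ∧
    ContMDiff (IB.prod 𝓘(ℝ, K)) (IB.prod 𝓘(ℝ, K)) ∞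
      (fun q : Q => (⟨pr q, ⟨q, rfl⟩⟩ : TotalSpace K (Fibre pr)))

variable {n m : ℕ} {E : Type*} [TopologicalSpace E] [ChartedSpace (Eu n) E]
  [IsManifold (𝓡 n) ∞ E]

/-- The class, in the fibre over `ρ(p)`, of an element of `W p`, for a regular velocity `p`. -/
def fibreMk (W : ∀ p : Tm n m E, Submodule ℝ (Eu m →L[ℝ] TangentSpace (TmModel n m) p))
    (G : Subgroup (PrincipalJetGroup m)) (p : Fm n m E) (A : W p.1) :
    Fibre (OrbitSpace.proj (W := W) (G := G)) (rho p) :=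
  ⟨OrbitSpace.mk (S := overRegular W) G ⟨⟨p.1, A.1⟩, ⟨p.2, A.2⟩⟩, rfl⟩

/-- The quotient by `G` of the part over `F_m E` of `W` is a (Hausdorff, paracompact, smooth)
manifold, with the smooth structure for which the quotient map is a submersion, and it is the total
space of a smooth vector bundle over `J^m E` with model fibre `K`, the vector space structure of
the fibres being the projection of that of the spaces `W p`. -/
def IsVectorBundleQuotient
    (W : ∀ p : Tm n m E, Submodule ℝ (Eu m →L[ℝ] TangentSpace (TmModel n m) p))
    (G : Subgroup (PrincipalJetGroup m)) (K : Type*) [NormedAddCommGroup K] [NormedSpace ℝ K]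
    [ChartedSpace (JmModel n m) (Jm n m E)] : Prop :=
  ∃ _ : ChartedSpace (ModelProd (JmModel n m) K) (OrbitSpace (overRegular W) G),
    IsManifold (𝓘(ℝ, JmModel n m).prod 𝓘(ℝ, K)) ∞ (OrbitSpace (overRegular W) G) ∧
    T2Space (OrbitSpace (overRegular W) G) ∧
    ParacompactSpace (OrbitSpace (overRegular W) G) ∧
    IsQuotientSubmersion (TmTmModel n m) (𝓘(ℝ, JmModel n m).prod 𝓘(ℝ, K))
      (OrbitSpace.mk (S := overRegular W) G) ∧
    ∃ (_ : ∀ b, AddCommGroup (Fibre (OrbitSpace.proj (W := W) (G := G)) b))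
      (_ : ∀ b, Module ℝ (Fibre (OrbitSpace.proj (W := W) (G := G)) b)),
      (∀ p : Fm n m E, IsLinearMap ℝ (fibreMk W G p)) ∧
      IsVectorBundleTotalSpace 𝓘(ℝ, JmModel n m) K (OrbitSpace.proj (W := W) (G := G))

end Bundles

end DoubleContact

open DoubleContact

/-!
In a chart of `E`, a velocity over `x ∈ E` is a linear map `C : ℝᵐ → ℝⁿ`, which is injective if the
velocity is regular, and a double velocity vertical over `E` is a bilinear map
`B : ℝᵐ × ℝᵐ → ℝⁿ` placed at `C`. An element of `P_m` with `A(j₀φ) = A(j₀σ) = a` and `B(j₀σ) = D`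
acts by (`doubleAct_vert`)
`(C, B) ↦ (C ∘ a, B(a ·, a ·) + C ∘ D)`.
Hence the orbit of `C` is the image of `C`, and the orbit of `(C, B)` is the image of `C` together
with the class of `B(C⁻¹ ·, C⁻¹ ·)` modulo this image: a bilinear map on an `m`-dimensional subspace
`R` of `T_xE` with values in `T_xE / R`. In the three quotients, `B` and `D` range over the same
class of bilinear maps (all, symmetric or skew-symmetric ones). They are treated together: the
classes are the cases `(0, 0)`, `(1, 1)`, `(1, -1)` of `symClass a b`, and `BilinearType` records
what is used of them.

*Charts.* Split `ℝⁿ = ℝᵐ × ℝⁿ⁻ᵐ`. The subspaces `R` which are graphs of linear maps `ℝᵐ → ℝⁿ⁻ᵐ` are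
parametrized by these maps (`slope`), and then `R ≅ ℝᵐ`, `ℝⁿ / R ≅ ℝⁿ⁻ᵐ` turn the class of `B` into
a bilinear map `ℝᵐ × ℝᵐ → ℝⁿ⁻ᵐ` (`quad`). The base point, `slope` and `quad` are smooth functions,
invariant under the action (`slope_comp`, `quad_act`), which separate orbits; indeed each `(C, B)`
can be moved by the group to the normal form of its invariants (`exists_normalForm_eq`), and
normal forms depend smoothly on the invariants. The tangential part `D` of the normal form is
arbitrary, and a suitable `D` and splitting give a smooth local section through any given point
(`normalForm_fstL`). Such data, called a `SubmersionChart`, form an atlas of the quotient for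
which the quotient map is a submersion (`quotient_isManifold`, `quotient_isQuotientSubmersion`).

*Vector bundles.* The charts of the quotient of double velocities lie over the charts of `J^m E`,
and `quad` is linear in `B`, so that its values define a vector space structure on the fibres
which does not depend on the chart because the classes of the elements over one velocity already
fill the fibre (`fibreMk_surjective`). Charts of this form make a vector bundle
(`isVectorBundleTotalSpace_of_charts`).

*Topology.* Contact elements over different points of `E` are separated by open sets of `E`, and
those over the same point by the orthogonal projection onto the contact element, which is a
continuous function (`continuousOn_rangeProj`); points of the other quotients over the same contact
element are separated by a chart (`t2Space_of_separating_on_fibres`). Paracompactness is inherited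
along `J^m E → E` and along the bundle projections, as the preimages of small compact sets are
σ-compact (`paracompactSpace_of_isSigmaCompact_preimage`).
-/

namespace DoubleContact

/-! ### Charts of velocity manifolds -/

section VelocityCharts
variable {F H : Type*} [NormedAddCommGroup F] [NormedSpace ℝ F] [TopologicalSpace H]
  {I : ModelWithCorners ℝ F H} {M : Type*} [TopologicalSpace M] [ChartedSpace H M]
  [IsManifold I ∞ M] {m : ℕ}

lemma velocity_extChartAt_source (y₀ : Velocity m I M) :
    (extChartAt (velModel m I) y₀).source = {y | y.1 ∈ (chartAt H y₀.1).source} := by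
  rw [FiberBundle.extChartAt]
  ext y
  simp only [PartialEquiv.trans_source, mem_inter_iff, mem_preimage, PartialEquiv.prod_source,
    PartialEquiv.refl_source, mem_prod, mem_univ, and_true, extChartAt_source, mem_ofPred_eq]
  exact ⟨fun h => h.2, fun h => ⟨⟨mem_univ _, h⟩, h⟩⟩

/-- In the chart of `T_m M` at `y₀`, a velocity is transported to the tangent coordinates of the
preferred chart at the base point of `y₀`; its own second component refers to the preferred chart
at its own base point. -/
lemma velocity_extChartAt_apply (y₀ y : Velocity m I M) (hy : y.1 ∈ (chartAt H y₀.1).source) :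
    extChartAt (velModel m I) y₀ y =
      (extChartAt I y₀.1 y.1, (tangentCoordChange I y.1 y₀.1 y.1).comp y.2) := by
  rw [FiberBundle.extChartAt]
  refine Prod.ext rfl ?_
  change ContinuousLinearMap.inCoordinates _ _ _ _ _ _ _ _ _ = _
  rw [ContinuousLinearMap.inCoordinates]
  rw [TangentBundle.continuousLinearMapAt_trivializationAt_eq_core hy]
  ext v
  simp
  rfl

lemma velocity_extChartAt_apply_self (y₀ y : Velocity m I M) (hy : y.1 = y₀.1) :
    extChartAt (velModel m I) y₀ y = (extChartAt I y.1 y.1, y.2) := by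
  have h : tangentCoordChange I y.1 y₀.1 y.1 = ContinuousLinearMap.id ℝ F := by
    ext v
    rw [← hy]
    exact tangentCoordChange_self (mem_extChartAt_source _)
  rw [velocity_extChartAt_apply _ _ (by rw [hy]; exact mem_chart_source _ _), h, hy]
  rfl

end VelocityCharts

/-! ### Vertical double velocities and the action of the principal jet group -/

section Action
variable {n m : ℕ} {E : Type*} [TopologicalSpace E] [ChartedSpace (Eu n) E]
  [IsManifold (𝓡 n) ∞ E]

/-- The inclusion of a fibre of `T_m E` is `C ↦ (const, C)` in the chart at `p`, because the
tangent coordinates at the base point of `p` are those of the preferred chart there. -/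
lemma hasMFDerivAt_fibreIncl (p : Tm n m E) (C : Eu m →L[ℝ] Eu n) :
    HasMFDerivAt 𝓘(ℝ, Eu m →L[ℝ] Eu n) (TmModel n m)
      (fun C : Eu m →L[ℝ] Eu n => (⟨p.1, C⟩ : Tm n m E)) C
      (ContinuousLinearMap.inr ℝ (Eu n) (Eu m →L[ℝ] Eu n)) := by
  constructor
  · exact (FiberBundle.continuous_totalSpaceMk _ _ p.1).continuousAt
  · have : writtenInExtChartAt 𝓘(ℝ, Eu m →L[ℝ] Eu n) (TmModel n m) C
      (fun C : Eu m →L[ℝ] Eu n => (⟨p.1, C⟩ : Tm n m E)) =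
      fun C => (extChartAt (𝓡 n) p.1 p.1, C) := by
      ext1 C
      exact velocity_extChartAt_apply_self _ ⟨p.1, C⟩ rfl
    rw [this]
    exact ((hasFDerivAt_const _ _).prodMk (hasFDerivAt_id _)).hasFDerivWithinAt

lemma vertLift_apply (p : Tm n m E) (B : Eu m →L[ℝ] Eu n) :
    vertLift p B = ((0, B) : Eu n × (Eu m →L[ℝ] Eu n)) := by
  rw [vertLift, (hasMFDerivAt_fibreIncl p p.2).mfderiv]
  rfl

lemma hasMFDerivAt_proj (p : Tm n m E) :
    HasMFDerivAt (TmModel n m) (𝓡 n) (fun q : Tm n m E => q.1) p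
      (ContinuousLinearMap.fst ℝ (Eu n) (Eu m →L[ℝ] Eu n)) := by
  constructor
  · exact (FiberBundle.continuous_proj _ _).continuousAt
  · have h2 : HasFDerivWithinAt (Prod.fst : Eu n × (Eu m →L[ℝ] Eu n) → Eu n)
      (ContinuousLinearMap.fst ℝ (Eu n) (Eu m →L[ℝ] Eu n)) (range (TmModel n m))
      (extChartAt (TmModel n m) p p) := hasFDerivAt_fst.hasFDerivWithinAt
    refine h2.congr_of_eventuallyEq ?_ ?_
    · filter_upwards [extChartAt_target_mem_nhdsWithin (I := TmModel n m) p] with z hz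
      have h1 := (extChartAt (TmModel n m) p).right_inv hz
      have h3 := (extChartAt (TmModel n m) p).map_target hz
      rw [velocity_extChartAt_source] at h3
      rw [velocity_extChartAt_apply _ _ h3] at h1
      exact congrArg Prod.fst h1
    · change extChartAt (𝓡 n) p.1
        ((extChartAt (TmModel n m) p).symm (extChartAt (TmModel n m) p p)).1 = _
      rw [extChartAt_to_inv, velocity_extChartAt_apply_self _ _ rfl]

/-- The vertical double velocity at the velocity `⟨e, C⟩` which corresponds to the bilinear map `B`:
the value at `v` is the vertical lift of `B v`. The components `C` and `B` are expressed in the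
preferred chart at `e`, as is built into the tangent spaces of `E`. -/
def vert (e : E) (C : Eu m →L[ℝ] Eu n) (B : Eu m →L[ℝ] Eu m →L[ℝ] Eu n) : TmTm n m E :=
  ⟨⟨e, C⟩, (ContinuousLinearMap.inr ℝ (Eu n) (Eu m →L[ℝ] Eu n)).comp B⟩

/-- The coordinate changes of `T(T_m E)` preserve vertical vectors and act on their components by
the coordinate change of `E`. This holds because a coordinate change of `T_m E` is linear in `C`
over each point of `E`. -/
lemma tangentCoordChange_vert (p₀ : Tm n m E) (e : E) (he : e ∈ (chartAt (Eu n) p₀.1).source)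
    (C B : Eu m →L[ℝ] Eu n) :
    tangentCoordChange (TmModel n m) (⟨e, C⟩ : Tm n m E) p₀ ⟨e, C⟩
        ((0, B) : Eu n × (Eu m →L[ℝ] Eu n)) =
      (0, (tangentCoordChange (𝓡 n) e p₀.1 e).comp B) := by
  have h1 := hasFDerivWithinAt_tangentCoordChange (I := TmModel n m) (x := (⟨e, C⟩ : Tm n m E))
    (y := p₀) (z := (⟨e, C⟩ : Tm n m E))
    ⟨mem_extChartAt_source _, by rw [velocity_extChartAt_source]; exact he⟩
  have hr : range (TmModel n m) = univ := ModelWithCorners.range_eq_univ _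
  rw [hr, hasFDerivWithinAt_univ, velocity_extChartAt_apply_self _ _ rfl] at h1
  have h2 : HasFDerivAt (fun C : Eu m →L[ℝ] Eu n => (extChartAt (𝓡 n) e e, C))
      (ContinuousLinearMap.inr ℝ (Eu n) (Eu m →L[ℝ] Eu n)) C :=
    ((hasFDerivAt_const _ _).prodMk (hasFDerivAt_id _))
  have h3 := HasFDerivAt.comp (f := fun C : Eu m →L[ℝ] Eu n => (extChartAt (𝓡 n) e e, C)) C h1 h2
  have h4 : HasFDerivAt (fun C : Eu m →L[ℝ] Eu n =>
      (extChartAt (𝓡 n) p₀.1 e, (tangentCoordChange (𝓡 n) e p₀.1 e).comp C))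
      (ContinuousLinearMap.prod 0 (ContinuousLinearMap.compL ℝ (Eu m) (Eu n) (Eu n)
        (tangentCoordChange (𝓡 n) e p₀.1 e))) C :=
    (hasFDerivAt_const _ _).prodMk (ContinuousLinearMap.compL ℝ (Eu m) (Eu n) (Eu n)
      (tangentCoordChange (𝓡 n) e p₀.1 e)).hasFDerivAt
  have h5 : (fun C : Eu m →L[ℝ] Eu n =>
      (extChartAt (𝓡 n) p₀.1 e, (tangentCoordChange (𝓡 n) e p₀.1 e).comp C)) =
      (extChartAt (TmModel n m) p₀ ∘ (extChartAt (TmModel n m) (⟨e, C⟩ : Tm n m E)).symm) ∘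
        (fun C : Eu m →L[ℝ] Eu n => (extChartAt (𝓡 n) e e, C)) := by
    ext1 C'
    have : (extChartAt (TmModel n m) (⟨e, C⟩ : Tm n m E)).symm (extChartAt (𝓡 n) e e, C') =
        ⟨e, C'⟩ := by
      have h := (extChartAt (TmModel n m) (⟨e, C⟩ : Tm n m E)).left_inv (x := ⟨e, C'⟩) (by
        rw [velocity_extChartAt_source]; exact mem_chart_source _ e)
      rwa [velocity_extChartAt_apply_self (⟨e, C⟩ : Tm n m E) ⟨e, C'⟩ rfl] at h
    simp only [Function.comp_apply, this]
    exact (velocity_extChartAt_apply p₀ ⟨e, C'⟩ he).symm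
  -- `h3` and `h4` compute the derivative of the same function, the inclusion of the fibre over `e`
  -- read in the chart at `p₀`, by the chain rule and by linearity in `C`.
  rw [h5] at h4
  exact DFunLike.congr_fun (h3.unique h4) B

lemma extChartAt_vert (y₀ : TmTm n m E) (e : E) (he : e ∈ (chartAt (Eu n) y₀.1.1).source)
    (C : Eu m →L[ℝ] Eu n) (B : Eu m →L[ℝ] Eu m →L[ℝ] Eu n) :
    extChartAt (TmTmModel n m) y₀ (vert e C B) =
     ((extChartAt (𝓡 n) y₀.1.1 e, (tangentCoordChange (𝓡 n) e y₀.1.1 e).comp C),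
      (ContinuousLinearMap.inr ℝ (Eu n) (Eu m →L[ℝ] Eu n)).comp
       ((ContinuousLinearMap.compL ℝ (Eu m) (Eu n) (Eu n)
        (tangentCoordChange (𝓡 n) e y₀.1.1 e)).comp B)) := by
  have h0 : (vert e C B).1 ∈ (chartAt (ModelProd (Eu n) (Eu m →L[ℝ] Eu n)) y₀.1).source := by
    rw [← extChartAt_source (TmModel n m), velocity_extChartAt_source]; exact he
  rw [velocity_extChartAt_apply _ _ h0, velocity_extChartAt_apply _ _ (by exact he)]
  refine Prod.ext rfl ?_
  refine ContinuousLinearMap.ext fun v => ?_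
  exact tangentCoordChange_vert y₀.1 e he C (B v)

/-- The derivative of `((u, C), a) ↦ (u, C ∘ a)`. -/
def velActDeriv (C : Eu m →L[ℝ] Eu n) (a : Eu m →L[ℝ] Eu m) :
    (Eu n × (Eu m →L[ℝ] Eu n)) × (Eu m →L[ℝ] Eu m) →L[ℝ] Eu n × (Eu m →L[ℝ] Eu n) :=
  ContinuousLinearMap.prod
    ((ContinuousLinearMap.fst ℝ (Eu n) (Eu m →L[ℝ] Eu n)).comp
      (ContinuousLinearMap.fst ℝ (Eu n × (Eu m →L[ℝ] Eu n)) (Eu m →L[ℝ] Eu m)))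
    ((((ContinuousLinearMap.compL ℝ (Eu m) (Eu m) (Eu n)).flip a).comp
      (ContinuousLinearMap.snd ℝ (Eu n) (Eu m →L[ℝ] Eu n))).comp
      (ContinuousLinearMap.fst ℝ (Eu n × (Eu m →L[ℝ] Eu n)) (Eu m →L[ℝ] Eu m)) +
      (ContinuousLinearMap.compL ℝ (Eu m) (Eu m) (Eu n) C).comp
      (ContinuousLinearMap.snd ℝ (Eu n × (Eu m →L[ℝ] Eu n)) (Eu m →L[ℝ] Eu m)))

lemma hasFDerivAt_comp_pair (u : Eu n) (C : Eu m →L[ℝ] Eu n) (a : Eu m →L[ℝ] Eu m) :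
    HasFDerivAt (fun w : (Eu n × (Eu m →L[ℝ] Eu n)) × (Eu m →L[ℝ] Eu m) =>
      (w.1.1, w.1.2.comp w.2)) (velActDeriv C a) ((u, C), a) := by
  have h1 : HasFDerivAt (fun w : (Eu n × (Eu m →L[ℝ] Eu n)) × (Eu m →L[ℝ] Eu m) => w.1.2)
      ((ContinuousLinearMap.snd ℝ (Eu n) (Eu m →L[ℝ] Eu n)).comp
        (ContinuousLinearMap.fst ℝ (Eu n × (Eu m →L[ℝ] Eu n)) (Eu m →L[ℝ] Eu m))) ((u, C), a) :=
    ((ContinuousLinearMap.snd ℝ (Eu n) (Eu m →L[ℝ] Eu n)).comp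
        (ContinuousLinearMap.fst ℝ (Eu n × (Eu m →L[ℝ] Eu n)) (Eu m →L[ℝ] Eu m))).hasFDerivAt
  have h2 : HasFDerivAt (fun w : (Eu n × (Eu m →L[ℝ] Eu n)) × (Eu m →L[ℝ] Eu m) => w.1.1)
      ((ContinuousLinearMap.fst ℝ (Eu n) (Eu m →L[ℝ] Eu n)).comp
        (ContinuousLinearMap.fst ℝ (Eu n × (Eu m →L[ℝ] Eu n)) (Eu m →L[ℝ] Eu m))) ((u, C), a) :=
    ((ContinuousLinearMap.fst ℝ (Eu n) (Eu m →L[ℝ] Eu n)).comp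
        (ContinuousLinearMap.fst ℝ (Eu n × (Eu m →L[ℝ] Eu n)) (Eu m →L[ℝ] Eu m))).hasFDerivAt
  refine h2.prodMk ?_
  convert! h1.clm_comp hasFDerivAt_snd using 1
  rw [add_comm]
  rfl

/-- The action of `L_m` on `T_m E` is `((u, C), a) ↦ (u, C ∘ a)` in any chart of `E`, whence its
derivative. -/
lemma hasMFDerivAt_velAct (p : Tm n m E) (a : JetGroup m) :
    HasMFDerivAt ((TmModel n m).prod 𝓘(ℝ, Eu m →L[ℝ] Eu m)) (TmModel n m)
      (fun z : Tm n m E × JetGroup m => velAct z.1 z.2) (p, a)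
      (velActDeriv p.2 a) := by
  have key : ∀ z : Tm n m E × JetGroup m, z.1.1 ∈ (chartAt (Eu n) p.1).source →
    extChartAt (TmModel n m) (velAct p a) (velAct z.1 z.2) =
      ((extChartAt (TmModel n m) p z.1).1,
        (extChartAt (TmModel n m) p z.1).2.comp (z.2 : Eu m →L[ℝ] Eu m)) := by
    intro z hz
    rw [velocity_extChartAt_apply _ _ hz, velocity_extChartAt_apply _ _ (by exact hz)]
    rfl
  have hnear : ∀ᶠ z : Tm n m E × JetGroup m in 𝓝 (p, a), z.1.1 ∈ (chartAt (Eu n) p.1).source := by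
    refine ContinuousAt.eventually_mem ?_
      ((chartAt (Eu n) p.1).open_source.mem_nhds (mem_chart_source _ _))
    exact ((FiberBundle.continuous_proj _ _).comp continuous_fst).continuousAt
  constructor
  · rw [FiberBundle.continuousAt_totalSpace]
    refine ⟨((FiberBundle.continuous_proj _ _).comp continuous_fst).continuousAt, ?_⟩
    have h1 : ContinuousAt (fun z : Tm n m E × JetGroup m =>
        (extChartAt (TmModel n m) p z.1).2.comp (z.2 : Eu m →L[ℝ] Eu m)) (p, a) :=
      ((continuous_snd.continuousAt.comp
        ((continuousAt_extChartAt p).comp (x := (p, a)) continuous_fst.continuousAt))).clm_comp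
        (Units.continuous_val.comp continuous_snd).continuousAt
    refine h1.congr ?_
    filter_upwards [hnear] with z hz
    exact (congrArg Prod.snd (key z hz)).symm
  · have hr : range ((TmModel n m).prod 𝓘(ℝ, Eu m →L[ℝ] Eu m)) = univ :=
      ModelWithCorners.range_eq_univ _
    have hpt : extChartAt ((TmModel n m).prod 𝓘(ℝ, Eu m →L[ℝ] Eu m)) (p, a) (p, a) =
        ((extChartAt (𝓡 n) p.1 p.1, p.2), (a : Eu m →L[ℝ] Eu m)) := by
      rw [extChartAt_prod]
      exact Prod.ext (velocity_extChartAt_apply_self _ _ rfl) rfl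
    have h0 := hasFDerivAt_comp_pair (extChartAt (𝓡 n) p.1 p.1) p.2 a
    refine HasFDerivAt.hasFDerivWithinAt ((hpt.symm ▸ h0).congr_of_eventuallyEq ?_)
    have ht := extChartAt_target_mem_nhdsWithin
      (I := (TmModel n m).prod 𝓘(ℝ, Eu m →L[ℝ] Eu m)) (p, a)
    rw [hr, nhdsWithin_univ] at ht
    filter_upwards [ht] with w hw
    have h1 := (extChartAt ((TmModel n m).prod 𝓘(ℝ, Eu m →L[ℝ] Eu m)) (p, a)).right_inv hw
    have h3 := (extChartAt ((TmModel n m).prod 𝓘(ℝ, Eu m →L[ℝ] Eu m)) (p, a)).map_target hw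
    rw [extChartAt_prod] at h1 h3
    have h4 := h3.1
    rw [velocity_extChartAt_source] at h4
    have h5 := key _ h4
    refine h5.trans ?_
    exact congrArg (fun w : (Eu n × (Eu m →L[ℝ] Eu n)) × (Eu m →L[ℝ] Eu m) =>
        (w.1.1, w.1.2.comp w.2)) h1

/-- The action of `P_m` on vertical double velocities, in terms of bilinear maps:
`(C, B) ↦ (C ∘ σ, B(φ ·, σ ·) + C ∘ dσ)`. -/
lemma doubleAct_vert (e : E) (C : Eu m →L[ℝ] Eu n) (B : Eu m →L[ℝ] Eu m →L[ℝ] Eu n)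
    (g : PrincipalJetGroup m) :
    doubleAct (vert e C B) g = vert e (C.comp (g.sig : Eu m →L[ℝ] Eu m))
      (B.bilinearComp (g.phi : Eu m →L[ℝ] Eu m) (g.sig : Eu m →L[ℝ] Eu m) +
        (ContinuousLinearMap.compL ℝ (Eu m) (Eu m) (Eu n) C).comp g.dsig) := by
  rw [doubleAct, prolong, vert]
  have := (hasMFDerivAt_velAct (⟨e, C⟩ : Tm n m E) g.sig).mfderiv
  dsimp only [velPair, velAct, PrincipalJetGroup.velSig, vert] at this ⊢
  rw [this]
  congr 1

lemma vertFibre_iff (e : E) (C : Eu m →L[ℝ] Eu n) (A) :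
    A ∈ vertFibre (⟨e, C⟩ : Tm n m E) ↔ ∃ B : Eu m →L[ℝ] Eu m →L[ℝ] Eu n,
      (⟨⟨e, C⟩, A⟩ : TmTm n m E) = vert e C B := by
  change (∀ v, mfderiv (TmModel n m) (𝓡 n) (fun q : Tm n m E => q.1) ⟨e, C⟩ (A v) = 0) ↔ _
  rw [(hasMFDerivAt_proj _).mfderiv]
  constructor
  · intro h
    refine ⟨(ContinuousLinearMap.snd ℝ (Eu n) (Eu m →L[ℝ] Eu n)).comp A, ?_⟩
    rw [vert]
    congr 1
    exact ContinuousLinearMap.ext fun v => Prod.ext (h v) rfl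
  · rintro ⟨B, h⟩ v
    cases h
    rfl

end Action

/-! ### Quotient manifolds from submersion charts -/

section Quotient
variable {F H : Type*} [NormedAddCommGroup F] [NormedSpace ℝ F] [TopologicalSpace H]
  (I : ModelWithCorners ℝ F H) {M : Type*} [TopologicalSpace M] [ChartedSpace H M]
  {Q : Type*} [TopologicalSpace Q] {S : Set M} (q : S → Q)
  (V : Type*) [NormedAddCommGroup V] [NormedSpace ℝ V]

/-- A local coordinate system on the quotient `Q` of a subset `S` of a manifold `M`: a map `toFun`,
smooth on an open set `dom` of `M` whose trace on `S` is saturated, which is a complete invariant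
of the points of `S` there, together with a smooth section `sec` over its open image `tgt`. -/
structure SubmersionChart where
  /-- the domain, of which only the trace on `S` matters -/
  dom : Set M
  isOpen_dom : IsOpen dom
  /-- the coordinate functions -/
  toFun : M → V
  contMDiffOn_toFun : ContMDiffOn I 𝓘(ℝ, V) ∞ toFun dom
  /-- the set of values -/
  tgt : Set V
  isOpen_tgt : IsOpen tgt
  /-- the section; its values outside `tgt` are irrelevant -/
  sec : V → S
  contMDiffOn_sec : ContMDiffOn 𝓘(ℝ, V) I ∞ (fun y => (sec y : M)) tgt
  sec_mem : ∀ y ∈ tgt, (sec y : M) ∈ dom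
  toFun_sec : ∀ y ∈ tgt, toFun (sec y) = y
  toFun_mem : ∀ x : S, (x : M) ∈ dom → toFun x ∈ tgt
  saturated : ∀ x y : S, q x = q y → (x : M) ∈ dom → (y : M) ∈ dom ∧ toFun x = toFun y
  mk_sec : ∀ x : S, (x : M) ∈ dom → q (sec (toFun x)) = q x

variable {I q V}

namespace SubmersionChart

variable (c : SubmersionChart I q V) (hq : Topology.IsQuotientMap q)

lemma rep_mem_dom_iff (x : S) :
    (Function.surjInv hq.surjective (q x)).1 ∈ c.dom ↔ (x : M) ∈ c.dom :=
  ⟨fun h => (c.saturated _ _ (Function.surjInv_eq hq.surjective (q x)) h).1,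
    fun h => (c.saturated _ _ (Function.surjInv_eq hq.surjective (q x)).symm h).1⟩

lemma toFun_rep {x : S} (hx : (x : M) ∈ c.dom) :
    c.toFun (Function.surjInv hq.surjective (q x)).1 = c.toFun x :=
  (c.saturated _ _ (Function.surjInv_eq hq.surjective (q x)).symm hx).2.symm

lemma isOpen_chart_source : IsOpen {b | (Function.surjInv hq.surjective b).1 ∈ c.dom} := by
  rw [← hq.isOpen_preimage]
  convert c.isOpen_dom.preimage continuous_subtype_val
  ext x
  exact c.rep_mem_dom_iff hq x

/-- The chart of the quotient defined by a submersion chart. -/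
def chart : OpenPartialHomeomorph Q V where
  toFun b := c.toFun (Function.surjInv hq.surjective b).1
  invFun y := q (c.sec y)
  source := {b | (Function.surjInv hq.surjective b).1 ∈ c.dom}
  target := c.tgt
  map_source' b hb := c.toFun_mem _ hb
  map_target' y hy := (c.rep_mem_dom_iff hq _).2 (c.sec_mem y hy)
  left_inv' b hb := by
    rw [c.mk_sec _ hb, Function.surjInv_eq hq.surjective]
  right_inv' y hy := by
    rw [c.toFun_rep hq (c.sec_mem y hy), c.toFun_sec y hy]
  open_source := c.isOpen_chart_source hq
  open_target := c.isOpen_tgt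
  continuousOn_toFun := by
    rw [hq.continuousOn_isOpen_iff (c.isOpen_chart_source hq)]
    refine (c.contMDiffOn_toFun.continuousOn.comp continuous_subtype_val.continuousOn
      fun x h => (c.rep_mem_dom_iff hq x).1 h).congr fun x h => ?_
    exact c.toFun_rep hq ((c.rep_mem_dom_iff hq x).1 h)
  continuousOn_invFun := by
    refine hq.continuous.comp_continuousOn ?_
    rw [continuousOn_iff_continuous_domRestrict]
    exact Continuous.subtype_mk
      (continuousOn_iff_continuous_domRestrict.1 c.contMDiffOn_sec.continuousOn) _

lemma mem_chart_source {x : S} : q x ∈ (c.chart hq).source ↔ (x : M) ∈ c.dom :=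
  c.rep_mem_dom_iff hq x

lemma chart_apply {x : S} (hx : (x : M) ∈ c.dom) : c.chart hq (q x) = c.toFun x :=
  c.toFun_rep hq hx

end SubmersionChart

variable {ι : Type*} (c : ι → SubmersionChart I q V) (hq : Topology.IsQuotientMap q)
  (hc : ∀ x : S, ∃ i, (x : M) ∈ (c i).dom)

/-- The charted space structure on a quotient given by a covering family of submersion charts. -/
@[reducible] def quotientChartedSpace : ChartedSpace V Q where
  atlas := range fun i => (c i).chart hq
  chartAt b := (c (hc (Function.surjInv hq.surjective b)).choose).chart hq
  mem_chart_source b := (hc (Function.surjInv hq.surjective b)).choose_spec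
  chart_mem_atlas _ := mem_range_self _

lemma quotient_isManifold :
    letI := quotientChartedSpace c hq hc
    IsManifold 𝓘(ℝ, V) ∞ Q := by
  let _ := quotientChartedSpace c hq hc
  refine isManifold_of_contDiffOn _ _ _ ?_
  rintro _ _ ⟨i, rfl⟩ ⟨j, rfl⟩
  simp only [modelWithCornersSelf_coe, modelWithCornersSelf_coe_symm, Function.comp_id,
    Function.id_comp, range_id, inter_univ, preimage_id]
  rw [← contMDiffOn_iff_contDiffOn]
  have hmem : ∀ y ∈ (((c i).chart hq).symm ≫ₕ (c j).chart hq).source,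
      y ∈ (c i).tgt ∧ ((c i).sec y : M) ∈ (c j).dom := fun y hy => by
    rw [OpenPartialHomeomorph.trans_source] at hy
    exact ⟨hy.1, ((c j).mem_chart_source hq).1 hy.2⟩
  refine ((c j).contMDiffOn_toFun.comp ((c i).contMDiffOn_sec.mono fun y hy => (hmem y hy).1)
    fun y hy => (hmem y hy).2).congr fun y hy => ?_
  exact (c j).chart_apply hq (hmem y hy).2

lemma chart_mem_maximalAtlas (i : ι) :
    letI := quotientChartedSpace c hq hc
    (c i).chart hq ∈ IsManifold.maximalAtlas 𝓘(ℝ, V) ∞ Q := by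
  let _ := quotientChartedSpace c hq hc
  have := quotient_isManifold c hq hc
  exact IsManifold.subset_maximalAtlas (mem_range_self i)

/-- The quotient map is a submersion if each point of `S`, and not only each orbit, is on the
section of some chart. -/
lemma quotient_isQuotientSubmersion
    (hsec : ∀ x : S, ∃ i, (x : M) ∈ (c i).dom ∧ (c i).sec ((c i).toFun x) = x) :
    letI := quotientChartedSpace c hq hc
    IsQuotientSubmersion I 𝓘(ℝ, V) q := by
  let _ := quotientChartedSpace c hq hc
  have := quotient_isManifold c hq hc
  refine ⟨hq.surjective, fun x => ?_, fun x => ?_⟩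
  · obtain ⟨i, hi⟩ := hc x
    refine ⟨(c i).dom ∩ {x | (c i).toFun x ∈ (c i).tgt}, ?_, ?_, ?_⟩
    · exact (c i).contMDiffOn_toFun.continuousOn.isOpen_inter_preimage (c i).isOpen_dom
        (c i).isOpen_tgt
    · exact ⟨hi, (c i).toFun_mem x hi⟩
    · refine ⟨fun x => q ((c i).sec ((c i).toFun x)), ?_, fun y hy => (c i).mk_sec y hy.1⟩
      exact (contMDiffOn_symm_of_mem_maximalAtlas (chart_mem_maximalAtlas c hq hc i)).comp
        ((c i).contMDiffOn_toFun.mono fun x hx => hx.1) fun x hx => hx.2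
  · obtain ⟨i, hi, hs⟩ := hsec x
    refine ⟨((c i).chart hq).source, ((c i).chart hq).open_source,
      ((c i).mem_chart_source hq).2 hi, fun b => (c i).sec ((c i).chart hq b), ?_, ?_, ?_⟩
    · exact (c i).contMDiffOn_sec.comp
        (contMDiffOn_of_mem_maximalAtlas (chart_mem_maximalAtlas c hq hc i))
        fun b hb => ((c i).chart hq).map_source hb
    · change (c i).sec ((c i).chart hq (q x)) = x
      rw [(c i).chart_apply hq hi, hs]
    · intro b hb
      exact ((c i).chart hq).left_inv hb

end Quotient

/-! ### Vector bundles from bundle charts -/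

section Smooth
variable {F H : Type*} [NormedAddCommGroup F] [NormedSpace ℝ F] [TopologicalSpace H]
  {I : ModelWithCorners ℝ F H} {M : Type*} [TopologicalSpace M] [ChartedSpace H M]
  {K W : Type*} [NormedAddCommGroup K] [NormedSpace ℝ K] [FiniteDimensional ℝ K]
  [NormedAddCommGroup W] [NormedSpace ℝ W]

/-- A map into `K →L[ℝ] W` is smooth if it is smooth at each vector of `K`, for `K` of finite
dimension. Mathlib's version for normed spaces is `contDiffOn_clm_apply`. -/
lemma contMDiffOn_clm_of_apply {f : M → K →L[ℝ] W} {s : Set M}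
    (h : ∀ k, ContMDiffOn I 𝓘(ℝ, W) ∞ (fun x => f x k) s) :
    ContMDiffOn I 𝓘(ℝ, K →L[ℝ] W) ∞ f s := by
  let e₁ : K ≃L[ℝ] (Fin (Module.finrank ℝ K) → ℝ) :=
    ContinuousLinearEquiv.ofFinrankEq (Module.finrank_fin_fun ℝ).symm
  let e₂ := (e₁.arrowCongr (1 : W ≃L[ℝ] W)).trans
    (ContinuousLinearEquiv.piRing (Fin (Module.finrank ℝ K)))
  have h1 : ContMDiffOn I 𝓘(ℝ, Fin (Module.finrank ℝ K) → W) ∞ (fun x => e₂ (f x)) s :=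
    contMDiffOn_pi_space.2 fun i => h _
  refine (e₂.symm.contDiff.contMDiff.comp_contMDiffOn h1).congr fun x _ => ?_
  exact (e₂.symm_apply_apply (f x)).symm

end Smooth

section Bundle
variable {V K : Type*} [NormedAddCommGroup V] [NormedSpace ℝ V]
  [NormedAddCommGroup K] [NormedSpace ℝ K]
  {J Q : Type*} [TopologicalSpace J] [ChartedSpace V J]
  [TopologicalSpace Q] [ChartedSpace (ModelProd V K) Q]
  {pr : Q → J} [∀ b, AddCommGroup (Fibre pr b)] [∀ b, Module ℝ (Fibre pr b)]

variable (V K pr) in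
/-- A pair of charts of `J` and of `Q` in which the map `pr : Q → J` is the projection
`V × K → V`, the second component being linear on the fibres of `pr`. -/
structure BundleChart where
  /-- the chart of the base -/
  base : OpenPartialHomeomorph J V
  contMDiffOn_base : ContMDiffOn 𝓘(ℝ, V) 𝓘(ℝ, V) ∞ base base.source
  contMDiffOn_base_symm : ContMDiffOn 𝓘(ℝ, V) 𝓘(ℝ, V) ∞ base.symm base.target
  /-- the chart of the total space -/
  total : OpenPartialHomeomorph Q (V × K)
  contMDiffOn_total :
    ContMDiffOn (𝓘(ℝ, V).prod 𝓘(ℝ, K)) 𝓘(ℝ, V × K) ∞ total total.source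
  contMDiffOn_total_symm :
    ContMDiffOn 𝓘(ℝ, V × K) (𝓘(ℝ, V).prod 𝓘(ℝ, K)) ∞ total.symm total.target
  mem_source : ∀ q, q ∈ total.source ↔ pr q ∈ base.source
  mem_target : ∀ u k, u ∈ base.target → (u, k) ∈ total.target
  fst_total : ∀ q ∈ total.source, (total q).1 = base (pr q)
  linear : ∀ b ∈ base.source, IsLinearMap ℝ fun x : Fibre pr b => (total x.1).2

namespace BundleChart

variable (c : BundleChart V K pr)

lemma pr_symm {b : J} (hb : b ∈ c.base.source) (k : K) :
    pr (c.total.symm (c.base b, k)) = b := by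
  have h1 := c.mem_target (c.base b) k (c.base.map_source hb)
  have h2 := c.total.map_target h1
  have h3 := c.fst_total _ h2
  rw [c.total.right_inv h1] at h3
  exact (c.base.injOn hb ((c.mem_source _).1 h2) h3).symm

/-- The linear isomorphism of a fibre onto the model fibre. -/
def fibreEquiv {b : J} (hb : b ∈ c.base.source) : Fibre pr b ≃ₗ[ℝ] K where
  toFun x := (c.total x.1).2
  map_add' := (c.linear b hb).map_add
  map_smul' := (c.linear b hb).map_smul
  invFun k := ⟨c.total.symm (c.base b, k), c.pr_symm hb k⟩
  left_inv x := by
    apply Subtype.ext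
    have hx : x.1 ∈ c.total.source := (c.mem_source _).2 (by rw [x.2]; exact hb)
    have h : (c.base b, (c.total x.1).2) = c.total x.1 :=
      Prod.ext (by rw [c.fst_total _ hx, x.2]) rfl
    dsimp only
    rw [h, c.total.left_inv hx]
  right_inv k := by
    dsimp only
    rw [c.total.right_inv (c.mem_target _ _ (c.base.map_source hb))]

lemma continuous_fibreEquiv {b : J} (hb : b ∈ c.base.source) : Continuous (c.fibreEquiv hb) := by
  refine continuous_snd.comp (c.total.continuousOn.comp_continuous continuous_subtype_val ?_)
  intro x
  exact (c.mem_source _).2 (by rw [x.2]; exact hb)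

lemma continuous_fibreEquiv_symm {b : J} (hb : b ∈ c.base.source) :
    Continuous (c.fibreEquiv hb).symm := by
  refine Continuous.subtype_mk (c.total.symm.continuousOn.comp_continuous
    (f := fun k : K => ((c.base b, k) : V × K)) ?_ ?_) _
  · exact Continuous.prodMk continuous_const continuous_id
  · exact fun k => c.mem_target _ _ (c.base.map_source hb)

open Classical in
/-- The pretrivialization of the family of fibres given by a bundle chart. The inverse is only
relevant over the domain of the chart. -/
def pretrivialization : Pretrivialization K (π K (Fibre pr)) where
  toFun z := (z.1, (c.total z.2.1).2)
  invFun y := ⟨y.1, if h : y.1 ∈ c.base.source then (c.fibreEquiv h).symm y.2 else 0⟩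
  source := π K (Fibre pr) ⁻¹' c.base.source
  target := c.base.source ×ˢ univ
  map_source' z hz := ⟨hz, mem_univ _⟩
  map_target' y hy := hy.1
  left_inv' z hz := by
    have hz' : z.1 ∈ c.base.source := hz
    dsimp only
    rw [dif_pos hz']
    exact congrArg (TotalSpace.mk z.1) ((c.fibreEquiv hz').symm_apply_apply z.2)
  right_inv' y hy := by
    dsimp only
    rw [dif_pos hy.1]
    exact Prod.ext rfl ((c.fibreEquiv hy.1).apply_symm_apply y.2)
  open_target := c.base.open_source.prod isOpen_univ
  baseSet := c.base.source
  open_baseSet := c.base.open_source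
  source_eq := rfl
  target_eq := rfl
  proj_toFun z _ := rfl

lemma pretrivialization_symm {b : J} (hb : b ∈ c.base.source) (k : K) :
    c.pretrivialization.symm b k = (c.fibreEquiv hb).symm k := by
  have h := c.pretrivialization.mk_symm (b := b) hb k
  have h2 : c.pretrivialization.toPartialEquiv.symm (b, k) =
      ⟨b, (c.fibreEquiv hb).symm k⟩ := by
    exact congrArg (TotalSpace.mk b) (dif_pos hb)
  rw [h2] at h
  exact eq_of_heq (TotalSpace.mk.inj h).2

variable [FiniteDimensional ℝ K]

open Classical in
/-- The coordinate change between two bundle charts, extended by zero. -/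
def coordChange (c c' : BundleChart V K pr) (b : J) : K →L[ℝ] K :=
  if h : b ∈ c.base.source ∩ c'.base.source then
    LinearMap.toContinuousLinearMap
      (((c.fibreEquiv h.1).symm.trans (c'.fibreEquiv h.2) : K ≃ₗ[ℝ] K) : K →ₗ[ℝ] K)
  else 0

lemma coordChange_apply (c c' : BundleChart V K pr) {b : J}
    (h : b ∈ c.base.source ∩ c'.base.source) (k : K) :
    coordChange c c' b k = (c'.total (c.total.symm (c.base b, k))).2 := by
  rw [coordChange, dif_pos h]
  rfl

lemma contMDiffOn_coordChange (c c' : BundleChart V K pr) :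
    ContMDiffOn 𝓘(ℝ, V) 𝓘(ℝ, K →L[ℝ] K) ∞ (coordChange c c')
      (c.base.source ∩ c'.base.source) := by
  refine contMDiffOn_clm_of_apply fun k => ?_
  have h1 : ContMDiffOn 𝓘(ℝ, V) 𝓘(ℝ, V × K) ∞
      (fun b => ((c.base b, k) : V × K)) (c.base.source ∩ c'.base.source) :=
    (c.contMDiffOn_base.mono inter_subset_left).prodMk_space contMDiffOn_const
  have h2 := c.contMDiffOn_total_symm.comp h1
    fun b hb => c.mem_target _ _ (c.base.map_source hb.1)
  have h3 := c'.contMDiffOn_total.comp h2 fun b hb =>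
    (c'.mem_source _).2 (by
      have := c.pr_symm hb.1 k
      change pr (c.total.symm (c.base b, k)) ∈ _
      rw [this]
      exact hb.2)
  refine (contDiff_snd.contMDiff.comp_contMDiffOn h3).congr fun b hb => ?_
  exact coordChange_apply c c' hb k

end BundleChart

variable [FiniteDimensional ℝ K] {ι : Type*} (c : ι → BundleChart V K pr)
  (hc : ∀ b, ∃ i, b ∈ (c i).base.source)

/-- The vector prebundle defined by a covering family of bundle charts. -/
def vectorPrebundle : VectorPrebundle ℝ K (Fibre pr) where
  pretrivializationAtlas := range fun i => (c i).pretrivialization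
  pretrivialization_linear' := by
    rintro _ ⟨i, rfl⟩
    exact ⟨fun b hb => (c i).linear b hb⟩
  pretrivializationAt b := (c (hc b).choose).pretrivialization
  mem_base_pretrivializationAt b := (hc b).choose_spec
  pretrivialization_mem_atlas b := mem_range_self _
  exists_coordChange := by
    rintro _ ⟨i, rfl⟩ _ ⟨j, rfl⟩
    refine ⟨(c i).coordChange (c j), ((c i).contMDiffOn_coordChange (c j)).continuousOn, ?_⟩
    intro b hb k
    rw [(c i).coordChange_apply _ hb, (c i).pretrivialization_symm hb.1]
    rfl
  totalSpaceMk_isInducing b := by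
    have hb := (hc b).choose_spec
    have h1 : Topology.IsInducing ((c (hc b).choose).fibreEquiv hb) :=
      (Function.LeftInverse.isEmbedding (fun x => LinearEquiv.symm_apply_apply _ x)
        ((c (hc b).choose).continuous_fibreEquiv_symm hb)
        ((c (hc b).choose).continuous_fibreEquiv hb)).isInducing
    have h2 : Topology.IsInducing (fun k : K => (b, k)) := (isEmbedding_prodMkRight b).isInducing
    exact h2.comp h1

lemma vectorPrebundle_isContMDiff : (vectorPrebundle c hc).IsContMDiff 𝓘(ℝ, V) ∞ where
  exists_contMDiffCoordChange := by
    rintro _ ⟨i, rfl⟩ _ ⟨j, rfl⟩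
    refine ⟨(c i).coordChange (c j), (c i).contMDiffOn_coordChange (c j), ?_⟩
    intro b hb k
    rw [(c i).coordChange_apply _ hb, (c i).pretrivialization_symm hb.1]
    rfl

/-- A map which is the projection `V × K → V` in suitable charts around each point of the base,
linearly on the fibres, is the projection of a vector bundle. -/
theorem isVectorBundleTotalSpace_of_charts (hc : ∀ b, ∃ i, b ∈ (c i).base.source) :
    IsVectorBundleTotalSpace 𝓘(ℝ, V) K pr := by
  let a := vectorPrebundle c hc
  have ha : a.IsContMDiff 𝓘(ℝ, V) ∞ := vectorPrebundle_isContMDiff c hc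
  let _ := a.totalSpaceTopology
  let _ := a.toFiberBundle
  have _ := a.toVectorBundle
  let t : ι → Trivialization K (π K (Fibre pr)) := fun i =>
    a.trivializationOfMemPretrivializationAtlas (mem_range_self i)
  have ht : ∀ i, MemTrivializationAtlas (t i) := fun i => ⟨⟨_, mem_range_self i, rfl⟩⟩
  have hb : ContMDiffVectorBundle ∞ K (Fibre pr) 𝓘(ℝ, V) := a.contMDiffVectorBundle 𝓘(ℝ, V)
  refine ⟨inferInstance, inferInstance, inferInstance, hb, ?_, ?_⟩
  -- In a bundle chart and the trivialization which it defines, the canonical bijection of `Q` with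
  -- the total space of the family of fibres is the identity of `V × K`, in both directions.
  · intro z
    obtain ⟨i, hi⟩ := hc z.1
    have hz : z ∈ (t i).source := hi
    have ht' : ContMDiffOn (𝓘(ℝ, V).prod 𝓘(ℝ, K)) (𝓘(ℝ, V).prod 𝓘(ℝ, K)) ∞ (t i)
        (t i).source := (t i).contMDiffOn
    have h1 : ContMDiffOn (𝓘(ℝ, V).prod 𝓘(ℝ, K)) 𝓘(ℝ, V × K) ∞
        (fun z : TotalSpace K (Fibre pr) => (((c i).base z.1, (t i z).2) : V × K))
        (t i).source :=
      ((c i).contMDiffOn_base.comp (contMDiffOn_proj _)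
        fun z hz => hz).prodMk_space (contMDiff_snd.comp_contMDiffOn ht')
    have h2 := (c i).contMDiffOn_total_symm.comp h1
      fun z (hz : z.1 ∈ (c i).base.source) => (c i).mem_target _ _ ((c i).base.map_source hz)
    refine (h2.congr fun z hz => ?_).contMDiffAt ((t i).open_source.mem_nhds hz)
    exact (congrArg Subtype.val (((c i).fibreEquiv hz).symm_apply_apply z.2)).symm
  · intro q
    obtain ⟨i, hi⟩ := hc (pr q)
    have hq : q ∈ (c i).total.source := ((c i).mem_source q).2 hi
    have hκ := (c i).contMDiffOn_total
    refine ((t i).contMDiffAt_iff (f := fun q : Q => (⟨pr q, ⟨q, rfl⟩⟩ : TotalSpace K (Fibre pr)))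
      hi).2 ⟨?_, ?_⟩
    · have h0 : ContMDiffOn (𝓘(ℝ, V).prod 𝓘(ℝ, K)) 𝓘(ℝ, V) ∞
          (fun q => ((c i).total q).1) (c i).total.source :=
        contDiff_fst.contMDiff.comp_contMDiffOn hκ
      have h1 := (c i).contMDiffOn_base_symm.comp h0 fun q hq => by
          change ((c i).total q).1 ∈ (c i).base.target
          rw [(c i).fst_total q hq]
          exact (c i).base.map_source (((c i).mem_source q).1 hq)
      refine (h1.congr fun q hq => ?_).contMDiffAt ((c i).total.open_source.mem_nhds hq)
      change pr q = (c i).base.symm ((c i).total q).1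
      rw [(c i).fst_total q hq, (c i).base.left_inv (((c i).mem_source q).1 hq)]
    · exact (contDiff_snd.contMDiff.comp_contMDiffOn hκ).contMDiffAt
        ((c i).total.open_source.mem_nhds hq)

end Bundle

/-! ### Separation and paracompactness over a base space -/

section Topology
variable {X B : Type*} [TopologicalSpace X] [TopologicalSpace B] {p : X → B}

/-- A space over a Hausdorff space is Hausdorff if any two points of a fibre are separated by a
continuous function on a common open neighbourhood. -/
theorem t2Space_of_separating_on_fibres [T2Space B] {Z : Type*} [TopologicalSpace Z] [T2Space Z]
    (hp : Continuous p)
    (h : ∀ x y, p x = p y → x ≠ y → ∃ (O : Set X) (f : X → Z), IsOpen O ∧ x ∈ O ∧ y ∈ O ∧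
      ContinuousOn f O ∧ f x ≠ f y) : T2Space X := by
  refine ⟨fun x y hxy => ?_⟩
  by_cases hxy' : p x = p y
  · obtain ⟨O, f, hO, hx, hy, hf, hne⟩ := h x y hxy' hxy
    obtain ⟨U, W, hU, hW, hxU, hyW, hd⟩ := t2_separation hne
    exact ⟨O ∩ f ⁻¹' U, O ∩ f ⁻¹' W, hf.isOpen_inter_preimage hO hU,
      hf.isOpen_inter_preimage hO hW, ⟨hx, hxU⟩, ⟨hy, hyW⟩,
      (hd.preimage f).mono inter_subset_right inter_subset_right⟩
  · obtain ⟨U, W, hU, hW, hxU, hyW, hd⟩ := t2_separation hxy'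
    exact ⟨p ⁻¹' U, p ⁻¹' W, hU.preimage hp, hW.preimage hp, hxU, hyW, hd.preimage p⟩

/-- A Hausdorff locally compact space over a paracompact space `B` is paracompact if the preimages
of small compact subsets of `B` are σ-compact. The space itself need not be σ-compact: open
refinements over the sets of a locally finite cover of `B` are put together. -/
theorem paracompactSpace_of_isSigmaCompact_preimage [T2Space X] [WeaklyLocallyCompactSpace X]
    [T2Space B] [LocallyCompactSpace B] [ParacompactSpace B] (hp : Continuous p)
    (h : ∀ b, ∃ U ∈ 𝓝 b, ∀ K ⊆ U, IsCompact K → IsSigmaCompact (p ⁻¹' K)) :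
    ParacompactSpace X := by
  choose U hU hUK using h
  choose N hN hNU hNc using fun b => local_compact_nhds (hU b)
  obtain ⟨W, hWo, hWc, hWf, hWN⟩ := precise_refinement (fun b => interior (N b))
    (fun b => isOpen_interior) (by
      rw [eq_univ_iff_forall]
      exact fun b => mem_iUnion.2 ⟨b, mem_interior_iff_mem_nhds.2 (hN b)⟩)
  have hWN' : ∀ b, W b ⊆ N b := fun b => (hWN b).trans interior_subset
  have hcl : ∀ b, IsClosed (p ⁻¹' N b) := fun b => (hNc b).isClosed.preimage hp
  have hpara : ∀ b, ParacompactSpace (p ⁻¹' N b) := fun b => by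
    have := isSigmaCompact_iff_sigmaCompactSpace.1 (hUK b (N b) (hNU b) (hNc b))
    have := (hcl b).weaklyLocallyCompactSpace
    infer_instance
  refine ⟨fun α s hso hsc => ?_⟩
  -- Over the compact set `N b`, refine the given cover by the traces of open sets `O b a` of `X`.
  have key : ∀ b, ∃ O : α → Set X, (∀ a, IsOpen (O a)) ∧
      (p ⁻¹' N b ⊆ ⋃ a, O a) ∧ LocallyFinite (fun a => (Subtype.val ⁻¹' O a : Set (p ⁻¹' N b))) ∧
      ∀ a, O a ∩ p ⁻¹' N b ⊆ s a := by
    intro b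
    obtain ⟨v, hvo, hvc, hvf, hvs⟩ := precise_refinement
      (fun a => (Subtype.val ⁻¹' s a : Set (p ⁻¹' N b)))
      (fun a => (hso a).preimage continuous_subtype_val)
      (by rw [← preimage_iUnion, hsc, preimage_univ])
    choose O hO hOv using fun a => isOpen_induced_iff.1 (hvo a)
    refine ⟨O, hO, fun x hx => ?_, by simpa only [hOv] using hvf, fun a x hx => ?_⟩
    · have : (⟨x, hx⟩ : p ⁻¹' N b) ∈ ⋃ a, v a := by rw [hvc]; exact mem_univ _
      obtain ⟨a, ha⟩ := mem_iUnion.1 this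
      rw [← hOv] at ha
      exact mem_iUnion.2 ⟨a, ha⟩
    · have : (⟨x, hx.2⟩ : p ⁻¹' N b) ∈ v a := by rw [← hOv]; exact hx.1
      exact hvs a this
  choose O hO hOc hOf hOs using key
  -- `O b a` need not be locally finite outside `p ⁻¹' N b`, so it is cut down to the smaller
  -- open set `p ⁻¹' W b`.
  refine ⟨α, fun a => ⋃ b, O b a ∩ p ⁻¹' W b, ?_, ?_, ?_, ?_⟩
  · exact fun a => isOpen_iUnion fun b => (hO b a).inter ((hWo b).preimage hp)
  · rw [eq_univ_iff_forall]
    intro x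
    have : p x ∈ ⋃ b, W b := by rw [hWc]; exact mem_univ _
    obtain ⟨b, hb⟩ := mem_iUnion.1 this
    obtain ⟨a, ha⟩ := mem_iUnion.1 (hOc b (hWN' b hb))
    exact mem_iUnion.2 ⟨a, mem_iUnion.2 ⟨b, ha, hb⟩⟩
  · intro x
    obtain ⟨T, hT, hTf⟩ := hWf (p x)
    -- Near `x`, only finitely many sets `p ⁻¹' W b` matter, and for each of them only finitely
    -- many `a`.
    have hloc : ∀ b, ∃ u ∈ 𝓝 x, {a | ((O b a ∩ p ⁻¹' W b) ∩ u).Nonempty}.Finite := by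
      intro b
      by_cases hx : x ∈ p ⁻¹' N b
      · obtain ⟨t, ht, htf⟩ := hOf b ⟨x, hx⟩
        obtain ⟨u, hu, hut⟩ := mem_nhds_subtype _ _ _ |>.1 ht
        refine ⟨u, hu, htf.subset ?_⟩
        rintro a ⟨y, ⟨hyO, hyW⟩, hyu⟩
        exact ⟨⟨y, hWN' b hyW⟩, hyO, hut hyu⟩
      · refine ⟨(p ⁻¹' N b)ᶜ, (hcl b).isOpen_compl.mem_nhds hx, ?_⟩
        convert finite_empty
        rw [eq_empty_iff_forall_notMem]
        rintro a ⟨y, ⟨-, hyW⟩, hyN⟩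
        exact hyN (hWN' b hyW)
    choose u hu huf using hloc
    refine ⟨p ⁻¹' T ∩ ⋂ b ∈ {b | (W b ∩ T).Nonempty}, u b, Filter.inter_mem
      (hp.continuousAt hT) ((Filter.biInter_mem hTf).2 fun b _ => hu b), ?_⟩
    refine (hTf.biUnion fun b _ => huf b).subset ?_
    rintro a ⟨y, hy, hyT, hyu⟩
    obtain ⟨b, hyO, hyW⟩ := mem_iUnion.1 hy
    have hb : (W b ∩ T).Nonempty := ⟨p y, hyW, hyT⟩
    exact mem_iUnion₂.2 ⟨b, hb, y, ⟨hyO, hyW⟩, mem_iInter₂.1 hyu b hb⟩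
  · refine fun a => ⟨a, iUnion_subset fun b => ?_⟩
    exact fun x hx => hOs b a ⟨hx.1, hWN' b hx.2⟩

end Topology

/-! ### Graphs and bilinear maps modulo their image -/

section Graphs
variable {X Y Z : Type*} [NormedAddCommGroup X] [NormedSpace ℝ X] [NormedAddCommGroup Y]
  [NormedSpace ℝ Y] [NormedAddCommGroup Z] [NormedSpace ℝ Z]

/-- The bilinear maps `B : X × X → Z` with `a • B v w = b • B w v`. All bilinear maps, the
symmetric ones and the skew-symmetric ones are the cases `(a, b) = (0, 0)`, `(1, 1)`, `(1, -1)`. -/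
def symClass (a b : ℝ) (X Z : Type*) [NormedAddCommGroup X] [NormedSpace ℝ X]
    [NormedAddCommGroup Z] [NormedSpace ℝ Z] : Submodule ℝ (X →L[ℝ] X →L[ℝ] Z) where
  carrier := {B | ∀ v w, a • B v w = b • B w v}
  add_mem' {A B} hA hB v w := by
    simp only [add_apply, smul_add, hA v w, hB v w]
  zero_mem' v w := by simp
  smul_mem' c A hA v w := by
    simp only [smul_apply, smul_comm _ c, hA v w]

lemma symClass_compL {a b : ℝ} {B : X →L[ℝ] X →L[ℝ] Z}
    (hB : B ∈ symClass a b X Z) (P : Z →L[ℝ] Y) :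
    (ContinuousLinearMap.compL ℝ X Z Y P).comp B ∈ symClass a b X Y := by
  intro v w
  change a • P (B v w) = b • P (B w v)
  rw [← map_smul, hB v w, map_smul]

lemma symClass_bilinearComp {a b : ℝ} {B : X →L[ℝ] X →L[ℝ] Z}
    (hB : B ∈ symClass a b X Z) (f : X →L[ℝ] X) :
    B.bilinearComp f f ∈ symClass a b X Z := fun v w => hB (f v) (f w)

variable (L : Y ≃L[ℝ] X × Z)

/-- The first component of a splitting `Y = X × Z`. -/
def fstL : Y →L[ℝ] X := (ContinuousLinearMap.fst ℝ X Z).comp (L : Y →L[ℝ] _)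

/-- The second component of a splitting `Y = X × Z`. -/
def sndL : Y →L[ℝ] Z := (ContinuousLinearMap.snd ℝ X Z).comp (L : Y →L[ℝ] _)

@[simp] lemma fstL_symm (v : X) (w : Z) : fstL L (L.symm (v, w)) = v := by
  simp [fstL]

@[simp] lemma sndL_symm (v : X) (w : Z) : sndL L (L.symm (v, w)) = w := by
  simp [sndL]

lemma ext_split {x y : Y} (h1 : fstL L x = fstL L y) (h2 : sndL L x = sndL L y) : x = y :=
  L.injective (Prod.ext h1 h2)

/-- The linear map `X → Y` whose image is the graph of `N`, in a splitting `Y = X × Z`. -/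
def graphMap (N : X →L[ℝ] Z) : X →L[ℝ] Y :=
  (L.symm : (X × Z) →L[ℝ] Y).comp ((ContinuousLinearMap.id ℝ X).prod N)

/-- For `C : X → Y` whose image is a graph in a splitting `Y = X × Z`, the linear map of
which it is the graph. If `fstL L ∘ C` is not invertible, then `Ring.inverse` and hence
`slope L C` are zero. -/
def slope (C : X →L[ℝ] Y) : X →L[ℝ] Z :=
  ((sndL L).comp C).comp (Ring.inverse ((fstL L).comp C))

@[simp] lemma fstL_graphMap (N : X →L[ℝ] Z) (v : X) : fstL L (graphMap L N v) = v :=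
  fstL_symm L _ _

@[simp] lemma sndL_graphMap (N : X →L[ℝ] Z) (v : X) : sndL L (graphMap L N v) = N v :=
  sndL_symm L _ _

lemma fstL_comp_graphMap (N : X →L[ℝ] Z) : (fstL L).comp (graphMap L N) = 1 :=
  ContinuousLinearMap.ext fun v => fstL_graphMap L N v

lemma injective_graphMap (N : X →L[ℝ] Z) : Function.Injective (graphMap L N) :=
  Function.LeftInverse.injective (fstL_graphMap L N)

@[simp] lemma slope_graphMap (N : X →L[ℝ] Z) : slope L (graphMap L N) = N := by
  rw [slope, fstL_comp_graphMap, Ring.inverse_one]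
  exact ContinuousLinearMap.ext fun v => sndL_graphMap L N v

lemma inverse_apply_self {a : X →L[ℝ] X} (ha : IsUnit a) (v : X) :
    Ring.inverse a (a v) = v :=
  DFunLike.congr_fun (Ring.inverse_mul_cancel a ha) v

lemma apply_inverse_self {a : X →L[ℝ] X} (ha : IsUnit a) (v : X) :
    a (Ring.inverse a v) = v :=
  DFunLike.congr_fun (Ring.mul_inverse_cancel a ha) v

variable {L}

lemma slope_apply_fstL {C : X →L[ℝ] Y} (hC : IsUnit ((fstL L).comp C)) (v : X) :
    slope L C (fstL L (C v)) = sndL L (C v) := by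
  change sndL L (C (Ring.inverse ((fstL L).comp C) (((fstL L).comp C) v))) = _
  rw [inverse_apply_self hC]

lemma graphMap_slope_apply {C : X →L[ℝ] Y} (hC : IsUnit ((fstL L).comp C)) (v : X) :
    graphMap L (slope L C) v = C (Ring.inverse ((fstL L).comp C) v) := by
  refine ext_split L ?_ ?_
  · rw [fstL_graphMap]
    exact (apply_inverse_self hC v).symm
  · rw [sndL_graphMap]
    rfl

lemma isUnit_fstL_comp (C : X →L[ℝ] Y) (a : (X →L[ℝ] X)ˣ) :
    IsUnit ((fstL L).comp (C.comp (a : X →L[ℝ] X))) ↔ IsUnit ((fstL L).comp C) :=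
  a.isUnit_mul_units ((fstL L).comp C)

/-- The slope only depends on the image of `C`. -/
lemma slope_comp (C : X →L[ℝ] Y) (a : (X →L[ℝ] X)ˣ)
    (hC : IsUnit ((fstL L).comp C)) :
    slope L (C.comp (a : X →L[ℝ] X)) = slope L C := by
  refine ContinuousLinearMap.ext fun v => ?_
  have h := slope_apply_fstL ((isUnit_fstL_comp C a).2 hC)
    (Ring.inverse ((fstL L).comp (C.comp (a : X →L[ℝ] X))) v)
  have h2 : fstL L ((C.comp (a : X →L[ℝ] X))
      (Ring.inverse ((fstL L).comp (C.comp (a : X →L[ℝ] X))) v)) = v :=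
    apply_inverse_self ((isUnit_fstL_comp C a).2 hC) v
  have h3 := slope_apply_fstL hC
    (a.1 (Ring.inverse ((fstL L).comp (C.comp (a : X →L[ℝ] X))) v))
  rw [h2] at h
  rw [h]
  refine h3.symm.trans ?_
  exact congrArg (slope L C) h2

variable (L) in
/-- The class of the bilinear map `B(C⁻¹·, C⁻¹·)` on the image of `C : X → Y` modulo this image,
in the coordinates given by a splitting of `Y` in which the image of `C` is a graph. -/
def quad (C : X →L[ℝ] Y) (B : X →L[ℝ] X →L[ℝ] Y) : X →L[ℝ] X →L[ℝ] Z :=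
  (ContinuousLinearMap.compL ℝ X Y Z (sndL L - (slope L C).comp (fstL L))).comp
    (B.bilinearComp (Ring.inverse ((fstL L).comp C)) (Ring.inverse ((fstL L).comp C)))

lemma quad_apply (C : X →L[ℝ] Y) (B : X →L[ℝ] X →L[ℝ] Y) (v w : X) :
    quad L C B v w =
      sndL L (B (Ring.inverse ((fstL L).comp C) v) (Ring.inverse ((fstL L).comp C) w)) -
      slope L C (fstL L (B (Ring.inverse ((fstL L).comp C) v)
        (Ring.inverse ((fstL L).comp C) w))) := rfl

lemma quad_mem {a b : ℝ} (C : X →L[ℝ] Y) {B : X →L[ℝ] X →L[ℝ] Y}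
    (hB : B ∈ symClass a b X Y) : quad L C B ∈ symClass a b X Z :=
  symClass_compL (symClass_bilinearComp hB _) _

/-- The class of a bilinear map is invariant under the action of the semiholonomic elements of the
principal jet group: the reparametrization `a` cancels with the inverse of `C ∘ a`, and the values
of `C ∘ D` are in the image of `C`, which is the kernel of `sndL L - slope L C ∘ fstL L`. -/
lemma quad_act {C : X →L[ℝ] Y} (hC : IsUnit ((fstL L).comp C))
    (B : X →L[ℝ] X →L[ℝ] Y) (a : (X →L[ℝ] X)ˣ) (D : X →L[ℝ] X →L[ℝ] X) :
    quad L (C.comp (a : X →L[ℝ] X))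
      (B.bilinearComp (a : X →L[ℝ] X) (a : X →L[ℝ] X) +
        (ContinuousLinearMap.compL ℝ X X Y C).comp D) = quad L C B := by
  have hinv : ∀ v, a.1 (Ring.inverse ((fstL L).comp (C.comp (a : X →L[ℝ] X))) v) =
      Ring.inverse ((fstL L).comp C) v := by
    intro v
    have h := apply_inverse_self ((isUnit_fstL_comp C a).2 hC) v
    have h2 := inverse_apply_self hC
      (a.1 (Ring.inverse ((fstL L).comp (C.comp (a : X →L[ℝ] X))) v))
    rw [← h2]
    exact congrArg (fun x => (Ring.inverse ((fstL L).comp C) : X →L[ℝ] X) x) h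
  refine ContinuousLinearMap.ext fun v => ContinuousLinearMap.ext fun w => ?_
  rw [quad_apply, quad_apply, slope_comp C a hC]
  simp only [add_apply, map_add, ContinuousLinearMap.bilinearComp_apply, hinv]
  have h3 : ∀ z, sndL L (C z) = slope L C (fstL L (C z)) := fun z => (slope_apply_fstL hC z).symm
  simp only [ContinuousLinearMap.coe_comp, Function.comp_apply, ContinuousLinearMap.compL_apply, h3]
  abel

variable (L) in
/-- The bilinear map with values `(0, v)` modulo the graph of `N`, which represents the class `v`
over `graphMap L N` (see `quad_normalForm`), modified by the bilinear map `D` with values in the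
graph. -/
def normalForm (D : X →L[ℝ] X →L[ℝ] X) (N : X →L[ℝ] Z)
    (v : X →L[ℝ] X →L[ℝ] Z) : X →L[ℝ] X →L[ℝ] Y :=
  (ContinuousLinearMap.compL ℝ X Z Y
    ((L.symm : (X × Z) →L[ℝ] Y).comp (ContinuousLinearMap.inr ℝ X Z))).comp v +
  (ContinuousLinearMap.compL ℝ X X Y (graphMap L N)).comp D

lemma normalForm_apply (D : X →L[ℝ] X →L[ℝ] X) (N : X →L[ℝ] Z)
    (v : X →L[ℝ] X →L[ℝ] Z) (x y : X) :
    normalForm L D N v x y = L.symm (0, v x y) + graphMap L N (D x y) := rfl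

lemma normalForm_mem {a b : ℝ} {D : X →L[ℝ] X →L[ℝ] X} (hD : D ∈ symClass a b X X)
    (N : X →L[ℝ] Z) {v : X →L[ℝ] X →L[ℝ] Z} (hv : v ∈ symClass a b X Z) :
    normalForm L D N v ∈ symClass a b X Y :=
  Submodule.add_mem _ (symClass_compL hv _) (symClass_compL hD _)

lemma quad_normalForm (D : X →L[ℝ] X →L[ℝ] X) (N : X →L[ℝ] Z)
    (v : X →L[ℝ] X →L[ℝ] Z) : quad L (graphMap L N) (normalForm L D N v) = v := by
  refine ContinuousLinearMap.ext fun x => ContinuousLinearMap.ext fun y => ?_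
  rw [quad_apply, fstL_comp_graphMap, Ring.inverse_one, slope_graphMap, normalForm_apply]
  simp

/-- Each pair `(C, B)` is moved to the normal form of its invariants `slope` and `quad`, with any
prescribed tangential part `D`, by an element `(c, c, D')` of the principal jet group whose
component `D'` is in the symmetry class of `B` and `D`. -/
lemma exists_normalForm_eq {a b : ℝ} {C : X →L[ℝ] Y} (hC : IsUnit ((fstL L).comp C))
    {B : X →L[ℝ] X →L[ℝ] Y} (hB : B ∈ symClass a b X Y)
    {D : X →L[ℝ] X →L[ℝ] X} (hD : D ∈ symClass a b X X) :
    ∃ (c : (X →L[ℝ] X)ˣ) (D' : X →L[ℝ] X →L[ℝ] X), D' ∈ symClass a b X X ∧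
      graphMap L (slope L C) = C.comp (c : X →L[ℝ] X) ∧
      normalForm L D (slope L C) (quad L C B) =
        B.bilinearComp (c : X →L[ℝ] X) (c : X →L[ℝ] X) +
        (ContinuousLinearMap.compL ℝ X X Y C).comp D' := by
  -- `c = i` turns `C` into a graph. The first component of `B(i ·, i ·)` is then replaced by `D`.
  let i := Ring.inverse ((fstL L).comp C)
  refine ⟨⟨i, (fstL L).comp C, Ring.inverse_mul_cancel _ hC, Ring.mul_inverse_cancel _ hC⟩,
    (ContinuousLinearMap.compL ℝ X X X i).comp
      (D - (ContinuousLinearMap.compL ℝ X Y X (fstL L)).comp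
        (B.bilinearComp i i)), ?_, ?_, ?_⟩
  · exact symClass_compL (Submodule.sub_mem (symClass a b X X) hD
      (symClass_compL (symClass_bilinearComp hB i) (fstL L))) i
  · exact ContinuousLinearMap.ext fun v => graphMap_slope_apply hC v
  · refine ContinuousLinearMap.ext fun x => ContinuousLinearMap.ext fun y => ?_
    rw [normalForm_apply, quad_apply, graphMap_slope_apply hC]
    change _ = B (i x) (i y) + C (i (D x y - fstL L (B (i x) (i y))))
    rw [map_sub, map_sub, ← graphMap_slope_apply hC (fstL L (B (i x) (i y))),
      ← graphMap_slope_apply hC (D x y)]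
    refine ext_split L ?_ ?_
    · simp [i]
    · simp only [i, map_add, map_sub, sndL_symm, sndL_graphMap]
      abel

/-- In a splitting in which `C` is the inclusion of the first factor, the pair `(C, B)` is in normal
form, with tangential part `D` the first component of `B`. Hence each pair lies on the section of
some chart. -/
lemma normalForm_fstL {C : X →L[ℝ] Y} (h1 : (fstL L).comp C = 1) (h2 : (sndL L).comp C = 0)
    (B : X →L[ℝ] X →L[ℝ] Y) :
    normalForm L ((ContinuousLinearMap.compL ℝ X Y X (fstL L)).comp B)
      (slope L C) (quad L C B) = B := by
  have hs : slope L C = 0 := by rw [slope, h2, ContinuousLinearMap.zero_comp]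
  refine ContinuousLinearMap.ext fun x => ContinuousLinearMap.ext fun y => ?_
  rw [normalForm_apply, quad_apply, h1, Ring.inverse_one, hs]
  refine ext_split L ?_ ?_ <;> simp

/-- Every injective linear map `X → Y` is the inclusion of the first factor in a suitable
splitting of `Y`. -/
lemma exists_splitting [FiniteDimensional ℝ X] [FiniteDimensional ℝ Y] [FiniteDimensional ℝ Z]
    (hk : Module.finrank ℝ Y = Module.finrank ℝ X + Module.finrank ℝ Z) {C : X →L[ℝ] Y}
    (hC : Function.Injective C) :
    ∃ L : Y ≃L[ℝ] X × Z, (fstL L).comp C = 1 ∧ (sndL L).comp C = 0 := by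
  obtain ⟨W, hW⟩ := Submodule.exists_isCompl (LinearMap.range C.toLinearMap)
  let e1 : X ≃ₗ[ℝ] LinearMap.range C.toLinearMap := LinearEquiv.ofInjective C.toLinearMap hC
  have hd : Module.finrank ℝ Z = Module.finrank ℝ W := by
    have h1 := Submodule.finrank_add_eq_of_isCompl hW
    have h2 := e1.finrank_eq
    omega
  let e2 : Z ≃ₗ[ℝ] W := LinearEquiv.ofFinrankEq _ _ hd
  let e : (X × Z) ≃ₗ[ℝ] Y :=
    (e1.prodCongr e2).trans (Submodule.prodEquivOfIsCompl _ _ hW)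
  have he : ∀ v, e.symm.toContinuousLinearEquiv (C v) = (v, 0) := by
    intro v
    change e.symm (C v) = (v, 0)
    rw [LinearEquiv.symm_apply_eq]
    simp only [e, LinearEquiv.trans_apply, LinearEquiv.prodCongr_apply, map_zero,
      Submodule.coe_prodEquivOfIsCompl', ZeroMemClass.coe_zero, add_zero]
    rfl
  refine ⟨e.symm.toContinuousLinearEquiv, ?_, ?_⟩
  · exact ContinuousLinearMap.ext fun v => congrArg Prod.fst (he v)
  · exact ContinuousLinearMap.ext fun v => congrArg Prod.snd (he v)

section
variable {P : Type*} [NormedAddCommGroup P] [NormedSpace ℝ P] {s : Set P}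

lemma contDiffOn_bilinear [FiniteDimensional ℝ X] {B : P → X →L[ℝ] X →L[ℝ] Y}
    (hB : ∀ v w, ContDiffOn ℝ ∞ (fun p => B p v w) s) : ContDiffOn ℝ ∞ B s :=
  contDiffOn_clm_apply.2 fun v => contDiffOn_clm_apply.2 fun w => hB v w

lemma contDiffOn_bilinear_apply {B : P → X →L[ℝ] X →L[ℝ] Y} {f g : P → X}
    (hB : ContDiffOn ℝ ∞ B s) (hf : ContDiffOn ℝ ∞ f s) (hg : ContDiffOn ℝ ∞ g s) :
    ContDiffOn ℝ ∞ (fun p => B p (f p) (g p)) s :=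
  (hB.clm_apply hf).clm_apply hg

end

variable [FiniteDimensional ℝ X]

lemma isOpen_isUnit_fstL : IsOpen {C : X →L[ℝ] Y | IsUnit ((fstL L).comp C)} := by
  have h : Continuous fun C : X →L[ℝ] Y => (fstL L).comp C :=
    continuous_const.clm_comp continuous_id
  have := FiniteDimensional.complete ℝ X
  exact (Units.isOpen (R := X →L[ℝ] X)).preimage h

lemma contDiffOn_inverse_fstL :
    ContDiffOn ℝ ∞ (fun C : X →L[ℝ] Y => Ring.inverse ((fstL L).comp C))
      {C | IsUnit ((fstL L).comp C)} := by
  have := FiniteDimensional.complete ℝ X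
  rintro C ⟨u, hu⟩
  have h1 : ContDiffAt ℝ ∞ (fun C : X →L[ℝ] Y => (fstL L).comp C) C :=
    contDiffAt_const.clm_comp contDiffAt_id
  have h2 := contDiffAt_ringInverse ℝ (n := ∞) u
  rw [hu] at h2
  exact (h2.comp C h1).contDiffWithinAt

lemma contDiffOn_slope :
    ContDiffOn ℝ ∞ (slope L : (X →L[ℝ] Y) → _) {C | IsUnit ((fstL L).comp C)} :=
  (contDiffOn_const.clm_comp contDiffOn_id).clm_comp contDiffOn_inverse_fstL

lemma contDiffOn_quad :
    ContDiffOn ℝ ∞ (fun x : (X →L[ℝ] Y) × (X →L[ℝ] X →L[ℝ] Y) => quad L x.1 x.2)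
      {x | IsUnit ((fstL L).comp x.1)} := by
  have hf : MapsTo Prod.fst {x : (X →L[ℝ] Y) × (X →L[ℝ] X →L[ℝ] Y) |
      IsUnit ((fstL L).comp x.1)} {C | IsUnit ((fstL L).comp C)} := fun x hx => hx
  have h1 := (contDiffOn_inverse_fstL (L := L)).comp contDiffOn_fst hf
  have h2 := (contDiffOn_slope (L := L)).comp contDiffOn_fst hf
  refine contDiffOn_bilinear fun v w => ?_
  have h3 := contDiffOn_bilinear_apply contDiffOn_snd (h1.clm_apply (contDiffOn_const (c := v)))
    (h1.clm_apply (contDiffOn_const (c := w)))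
  exact (contDiffOn_const.clm_apply h3).sub
    (h2.clm_apply (contDiffOn_const.clm_apply h3))

end Graphs

/-! ### Smoothness of the normal form -/

section GraphSmooth
variable {X Y Z : Type*} [NormedAddCommGroup X] [NormedSpace ℝ X] [NormedAddCommGroup Y]
  [NormedSpace ℝ Y] [NormedAddCommGroup Z] [NormedSpace ℝ Z] {L : Y ≃L[ℝ] X × Z}

lemma contDiff_graphMap : ContDiff ℝ ∞ (graphMap L : (X →L[ℝ] Z) → X →L[ℝ] Y) := by
  have h : ContDiff ℝ ∞ fun N : X →L[ℝ] Z => (ContinuousLinearMap.id ℝ X).prod N := by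
    have h1 : ∀ N : X →L[ℝ] Z, (ContinuousLinearMap.id ℝ X).prod N =
        (ContinuousLinearMap.inl ℝ X Z) +
          (ContinuousLinearMap.inr ℝ X Z).comp N := fun N =>
      ContinuousLinearMap.ext fun v => by simp
    simp only [h1]
    exact contDiff_const.add (contDiff_const.clm_comp contDiff_id)
  exact contDiff_const.clm_comp h

lemma contDiff_normalForm [FiniteDimensional ℝ X] (D : X →L[ℝ] X →L[ℝ] X) :
    ContDiff ℝ ∞ fun x : (X →L[ℝ] Z) × (X →L[ℝ] X →L[ℝ] Z) => normalForm L D x.1 x.2 := by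
  rw [← contDiffOn_univ]
  refine contDiffOn_bilinear fun v w => ?_
  have h1 : ContDiff ℝ ∞ fun x : (X →L[ℝ] Z) × (X →L[ℝ] X →L[ℝ] Z) => graphMap L x.1 :=
    contDiff_graphMap.comp contDiff_fst
  exact (((L.symm : (X × Z) →L[ℝ] Y).comp (ContinuousLinearMap.inr ℝ X Z)).contDiff.comp_contDiffOn
    (contDiffOn_bilinear_apply contDiffOn_snd contDiffOn_const contDiffOn_const)).add
    (h1.contDiffOn.clm_apply contDiffOn_const)

end GraphSmooth

section GraphCoord
variable {X Y Z K : Type*} [NormedAddCommGroup X] [NormedSpace ℝ X] [NormedAddCommGroup Y]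
  [NormedSpace ℝ Y] [NormedAddCommGroup Z] [NormedSpace ℝ Z] [NormedAddCommGroup K]
  [NormedSpace ℝ K] [FiniteDimensional ℝ X] {L : Y ≃L[ℝ] X × Z}

/-- Smoothness of `quad` followed by a smooth map `P`, for components `C` and `B` which are
smooth functions on a manifold. -/
lemma contMDiffOn_proj_quad {F H : Type*} [NormedAddCommGroup F] [NormedSpace ℝ F]
    [TopologicalSpace H] {I : ModelWithCorners ℝ F H} {M : Type*} [TopologicalSpace M]
    [ChartedSpace H M] {U : Type*} [NormedAddCommGroup U] [NormedSpace ℝ U]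
    {f : M → U × (X →L[ℝ] Y)} {g : M → X →L[ℝ] X →L[ℝ] Y} {s : Set M}
    (hf : ContMDiffOn I 𝓘(ℝ, U × (X →L[ℝ] Y)) ∞ f s)
    (hg : ContMDiffOn I 𝓘(ℝ, X →L[ℝ] X →L[ℝ] Y) ∞ g s)
    (hs : ∀ x ∈ s, IsUnit ((fstL L).comp (f x).2)) {P : (X →L[ℝ] X →L[ℝ] Z) → K}
    (hP : ContDiff ℝ ∞ P) :
    ContMDiffOn I 𝓘(ℝ, K) ∞ (fun x => P (quad L (f x).2 (g x))) s := by
  have h1 : ContMDiffOn I 𝓘(ℝ, X →L[ℝ] Y) ∞ (fun x => (f x).2) s :=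
    contDiff_snd.contMDiff.comp_contMDiffOn hf
  have h2 := h1.prodMk_space hg
  have h3 := (contDiffOn_quad (L := L)).contMDiffOn
  have h4 := h3.comp h2 fun x hx => hs x hx
  have h5 : ContMDiffOn I 𝓘(ℝ, X →L[ℝ] X →L[ℝ] Z) ∞ (fun x => quad L (f x).2 (g x)) s := h4
  exact hP.contMDiff.comp_contMDiffOn h5

/-- The normal form as a function of the coordinates of the quotient, with values in the model
space of the double velocities. The lemma is stated for general spaces to keep the types small. -/
lemma contDiff_normalForm_coord {U V : Type*} [NormedAddCommGroup U] [NormedSpace ℝ U]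
    [NormedAddCommGroup V] [NormedSpace ℝ V] (D : X →L[ℝ] X →L[ℝ] X)
    (e : V ≃L[ℝ] (X →L[ℝ] Z)) {j : K → X →L[ℝ] X →L[ℝ] Z} (hj' : ContDiff ℝ ∞ j) :
    ContDiff ℝ ∞ (fun y : (U × V) × K =>
      (((y.1.1, graphMap L (e y.1.2)),
        (ContinuousLinearMap.inr ℝ U (X →L[ℝ] Y)).comp (normalForm L D (e y.1.2) (j y.2))) :
        (U × (X →L[ℝ] Y)) × (X →L[ℝ] U × (X →L[ℝ] Y)))) := by
  have he : ContDiff ℝ ∞ fun y : (U × V) × K => e y.1.2 :=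
    e.contDiff.comp (contDiff_snd.comp contDiff_fst)
  have hj : ContDiff ℝ ∞ fun y : (U × V) × K => j y.2 := hj'.comp contDiff_snd
  have hej := he.prodMk hj
  have hn' := (contDiff_normalForm (L := L) D).comp hej
  have hn : ContDiff ℝ ∞ fun y : (U × V) × K => normalForm L D (e y.1.2) (j y.2) := hn'
  have hi : ContDiff ℝ ∞ fun y : (U × V) × K =>
      (ContinuousLinearMap.inr ℝ U (X →L[ℝ] Y)).comp (normalForm L D (e y.1.2) (j y.2)) :=
    contDiff_const.clm_comp hn
  have hg : ContDiff ℝ ∞ fun y : (U × V) × K => graphMap L (e y.1.2) := contDiff_graphMap.comp he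
  have hu : ContDiff ℝ ∞ fun y : (U × V) × K => y.1.1 := contDiff_fst.comp contDiff_fst
  exact (hu.prodMk hg).prodMk hi

end GraphCoord

/-! ### Linearity of the class of a bilinear map -/

section QuadLinear
variable {X Y Z : Type*} [NormedAddCommGroup X] [NormedSpace ℝ X] [NormedAddCommGroup Y]
  [NormedSpace ℝ Y] [NormedAddCommGroup Z] [NormedSpace ℝ Z] (L : Y ≃L[ℝ] X × Z)

lemma quad_add (C : X →L[ℝ] Y) (B B' : X →L[ℝ] X →L[ℝ] Y) :
    quad L C (B + B') = quad L C B + quad L C B' := by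
  refine ContinuousLinearMap.ext fun v => ContinuousLinearMap.ext fun w => ?_
  simp only [quad_apply, add_apply, map_add]
  abel

lemma quad_smul (C : X →L[ℝ] Y) (r : ℝ) (B : X →L[ℝ] X →L[ℝ] Y) :
    quad L C (r • B) = r • quad L C B := by
  refine ContinuousLinearMap.ext fun v => ContinuousLinearMap.ext fun w => ?_
  simp only [quad_apply, smul_apply, map_smul, smul_sub]

variable {K : Type*} [AddCommGroup K] [Module ℝ K] (P : (X →L[ℝ] X →L[ℝ] Z) →ₗ[ℝ] K)

lemma map_quad_add (C : X →L[ℝ] Y) (B B' : X →L[ℝ] X →L[ℝ] Y) :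
    P (quad L C (B + B')) = P (quad L C B) + P (quad L C B') := by
  rw [quad_add, map_add]

lemma map_quad_smul (C : X →L[ℝ] Y) (r : ℝ) (B : X →L[ℝ] X →L[ℝ] Y) :
    P (quad L C (r • B)) = r • P (quad L C B) := by
  rw [quad_smul, map_smul]

end QuadLinear

/-! ### Coordinates of velocities and of vertical double velocities -/

section Coordinates
variable {n m : ℕ} {E : Type*} [TopologicalSpace E] [ChartedSpace (Eu n) E]
  [IsManifold (𝓡 n) ∞ E]

lemma tangentCoordChange_left_inv {e₀ e : E} (he : e ∈ (chartAt (Eu n) e₀).source) (v : Eu n) :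
    tangentCoordChange (𝓡 n) e₀ e e (tangentCoordChange (𝓡 n) e e₀ e v) = v := by
  rw [tangentCoordChange_comp ⟨⟨mem_extChartAt_source _, by rwa [extChartAt_source]⟩,
    mem_extChartAt_source _⟩, tangentCoordChange_self (mem_extChartAt_source _)]

lemma tangentCoordChange_right_inv {e₀ e : E} (he : e ∈ (chartAt (Eu n) e₀).source) (v : Eu n) :
    tangentCoordChange (𝓡 n) e e₀ e (tangentCoordChange (𝓡 n) e₀ e e v) = v := by
  have he' : e ∈ (extChartAt (𝓡 n) e₀).source := by rwa [extChartAt_source]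
  rw [tangentCoordChange_comp ⟨⟨he', mem_extChartAt_source _⟩, he'⟩, tangentCoordChange_self he']

/-- The coordinate change between the tangent coordinates at `e` given by the preferred charts at
`e` and at `e₀`. -/
def chartEquiv {e₀ e : E} (he : e ∈ (chartAt (Eu n) e₀).source) : Eu n ≃L[ℝ] Eu n :=
  ContinuousLinearEquiv.equivOfInverse (tangentCoordChange (𝓡 n) e e₀ e)
    (tangentCoordChange (𝓡 n) e₀ e e) (tangentCoordChange_left_inv he)
    (tangentCoordChange_right_inv he)

lemma extChartAt_symm_mem_source {e₀ : E} {u : Eu n} (hu : u ∈ (extChartAt (𝓡 n) e₀).target) :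
    (extChartAt (𝓡 n) e₀).symm u ∈ (chartAt (Eu n) e₀).source := by
  have := (extChartAt (𝓡 n) e₀).map_target hu
  rwa [extChartAt_source] at this

/-- The velocity at `e` with derivative `C` in the preferred chart at `e`. -/
def vel (e : E) (C : Eu m →L[ℝ] Eu n) : Tm n m E := ⟨e, C⟩

/-- The velocity with coordinates `(u, C)` in the preferred chart at `e₀`. -/
def velOf {e₀ : E} {u : Eu n} (hu : u ∈ (extChartAt (𝓡 n) e₀).target) (C : Eu m →L[ℝ] Eu n) :
    Tm n m E :=
  vel ((extChartAt (𝓡 n) e₀).symm u)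
    (((chartEquiv (extChartAt_symm_mem_source hu)).symm : Eu n →L[ℝ] Eu n).comp C)

/-- The vertical double velocity with coordinates `(u, C, B)` in the preferred chart at `e₀`. -/
def vertOf {e₀ : E} {u : Eu n} (hu : u ∈ (extChartAt (𝓡 n) e₀).target) (C : Eu m →L[ℝ] Eu n)
    (B : Eu m →L[ℝ] Eu m →L[ℝ] Eu n) : TmTm n m E :=
  vert ((extChartAt (𝓡 n) e₀).symm u)
    (((chartEquiv (extChartAt_symm_mem_source hu)).symm : Eu n →L[ℝ] Eu n).comp C)
    ((ContinuousLinearMap.compL ℝ (Eu m) (Eu n) (Eu n)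
      ((chartEquiv (extChartAt_symm_mem_source hu)).symm : Eu n →L[ℝ] Eu n)).comp B)

lemma extChartAt_vel (y₀ : Tm n m E) {e : E} (he : e ∈ (chartAt (Eu n) y₀.1).source)
    (C : Eu m →L[ℝ] Eu n) :
    extChartAt (TmModel n m) y₀ (vel e C) =
      (extChartAt (𝓡 n) y₀.1 e, (chartEquiv he : Eu n →L[ℝ] Eu n).comp C) :=
  velocity_extChartAt_apply y₀ (vel e C) he

lemma extChartAt_velOf (y₀ : Tm n m E) {u : Eu n} (hu : u ∈ (extChartAt (𝓡 n) y₀.1).target)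
    (C : Eu m →L[ℝ] Eu n) : extChartAt (TmModel n m) y₀ (velOf hu C) = (u, C) := by
  rw [velOf, extChartAt_vel y₀ (extChartAt_symm_mem_source hu),
    (extChartAt (𝓡 n) y₀.1).right_inv hu]
  exact Prod.ext rfl (ContinuousLinearMap.ext fun v =>
    (chartEquiv (extChartAt_symm_mem_source hu)).apply_symm_apply (C v))

lemma velOf_mem_source (y₀ : Tm n m E) {u : Eu n} (hu : u ∈ (extChartAt (𝓡 n) y₀.1).target)
    (C : Eu m →L[ℝ] Eu n) : velOf hu C ∈ (extChartAt (TmModel n m) y₀).source := by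
  rw [velocity_extChartAt_source]
  exact extChartAt_symm_mem_source hu

/-- The lemma `extChartAt_vert` in terms of the invertible map `chartEquiv`. -/
lemma extChartAt_vert' (y₀ : TmTm n m E) {e : E} (he : e ∈ (chartAt (Eu n) y₀.1.1).source)
    (C : Eu m →L[ℝ] Eu n) (B : Eu m →L[ℝ] Eu m →L[ℝ] Eu n) :
    extChartAt (TmTmModel n m) y₀ (vert e C B) =
      ((extChartAt (𝓡 n) y₀.1.1 e, (chartEquiv he : Eu n →L[ℝ] Eu n).comp C),
        (ContinuousLinearMap.inr ℝ (Eu n) (Eu m →L[ℝ] Eu n)).comp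
          ((ContinuousLinearMap.compL ℝ (Eu m) (Eu n) (Eu n)
            (chartEquiv he : Eu n →L[ℝ] Eu n)).comp B)) :=
  extChartAt_vert y₀ e he C B

lemma extChartAt_vertOf (y₀ : TmTm n m E) {u : Eu n}
    (hu : u ∈ (extChartAt (𝓡 n) y₀.1.1).target) (C : Eu m →L[ℝ] Eu n)
    (B : Eu m →L[ℝ] Eu m →L[ℝ] Eu n) :
    extChartAt (TmTmModel n m) y₀ (vertOf hu C B) =
      ((u, C), (ContinuousLinearMap.inr ℝ (Eu n) (Eu m →L[ℝ] Eu n)).comp B) := by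
  rw [vertOf, extChartAt_vert' y₀ (extChartAt_symm_mem_source hu),
    (extChartAt (𝓡 n) y₀.1.1).right_inv hu]
  refine Prod.ext (Prod.ext rfl ?_) ?_
  · exact ContinuousLinearMap.ext fun v =>
      (chartEquiv (extChartAt_symm_mem_source hu)).apply_symm_apply (C v)
  · refine ContinuousLinearMap.ext fun v => Prod.ext rfl (ContinuousLinearMap.ext fun w => ?_)
    exact (chartEquiv (extChartAt_symm_mem_source hu)).apply_symm_apply (B v w)

lemma tmTm_extChartAt_source (y₀ : TmTm n m E) :
    (extChartAt (TmTmModel n m) y₀).source = {y | y.1.1 ∈ (chartAt (Eu n) y₀.1.1).source} := by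
  rw [velocity_extChartAt_source]
  ext y
  have h : (extChartAt (TmModel n m) y₀.1).source = _ := velocity_extChartAt_source y₀.1
  rw [extChartAt_source] at h
  exact Set.ext_iff.1 h y.1

lemma vertOf_mem_source (y₀ : TmTm n m E) {u : Eu n}
    (hu : u ∈ (extChartAt (𝓡 n) y₀.1.1).target) (C : Eu m →L[ℝ] Eu n)
    (B : Eu m →L[ℝ] Eu m →L[ℝ] Eu n) :
    vertOf hu C B ∈ (extChartAt (TmTmModel n m) y₀).source := by
  rw [tmTm_extChartAt_source]
  exact extChartAt_symm_mem_source hu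

lemma velOf_eq (y₀ : Tm n m E) {u : Eu n} (hu : u ∈ (extChartAt (𝓡 n) y₀.1).target)
    (C : Eu m →L[ℝ] Eu n) : velOf hu C = (extChartAt (TmModel n m) y₀).symm (u, C) := by
  rw [← extChartAt_velOf y₀ hu C, (extChartAt (TmModel n m) y₀).left_inv (velOf_mem_source y₀ hu C)]

lemma mem_tm_target (y₀ : Tm n m E) {u : Eu n} (hu : u ∈ (extChartAt (𝓡 n) y₀.1).target)
    (C : Eu m →L[ℝ] Eu n) : (u, C) ∈ (extChartAt (TmModel n m) y₀).target := by
  rw [← extChartAt_velOf y₀ hu C]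
  exact (extChartAt (TmModel n m) y₀).map_source (velOf_mem_source y₀ hu C)

lemma vertOf_eq (y₀ : TmTm n m E) {u : Eu n} (hu : u ∈ (extChartAt (𝓡 n) y₀.1.1).target)
    (C : Eu m →L[ℝ] Eu n) (B : Eu m →L[ℝ] Eu m →L[ℝ] Eu n) :
    vertOf hu C B = (extChartAt (TmTmModel n m) y₀).symm
      ((u, C), (ContinuousLinearMap.inr ℝ (Eu n) (Eu m →L[ℝ] Eu n)).comp B) := by
  rw [← extChartAt_vertOf y₀ hu C B,
    (extChartAt (TmTmModel n m) y₀).left_inv (vertOf_mem_source y₀ hu C B)]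

lemma mem_tmTm_target (y₀ : TmTm n m E) {u : Eu n} (hu : u ∈ (extChartAt (𝓡 n) y₀.1.1).target)
    (C : Eu m →L[ℝ] Eu n) (B : Eu m →L[ℝ] Eu m →L[ℝ] Eu n) :
    ((u, C), (ContinuousLinearMap.inr ℝ (Eu n) (Eu m →L[ℝ] Eu n)).comp B) ∈
      (extChartAt (TmTmModel n m) y₀).target := by
  rw [← extChartAt_vertOf y₀ hu C B]
  exact (extChartAt (TmTmModel n m) y₀).map_source (vertOf_mem_source y₀ hu C B)

end Coordinates

section Velocities
variable {n m : ℕ} {E : Type*} [TopologicalSpace E] [ChartedSpace (Eu n) E]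
  [IsManifold (𝓡 n) ∞ E]

/-- Linear maps from `ℝᵐ` as families of `m` vectors, the images of the basis vectors. -/
def arrayEquiv (m : ℕ) (F : Type*) [NormedAddCommGroup F] [NormedSpace ℝ F]
    [FiniteDimensional ℝ F] : (Eu m →L[ℝ] F) ≃L[ℝ] (Fin m → F) :=
  (LinearMap.toContinuousLinearMap.symm.trans
    ((EuclideanSpace.basisFun (Fin m) ℝ).toBasis.constr ℝ).symm).toContinuousLinearEquiv

lemma isQuotientMap_rho : Topology.IsQuotientMap (rho : Fm n m E → Jm n m E) :=
  isQuotientMap_quot_mk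

lemma rho_eq_of_act {p q : Fm n m E} (a : JetGroup m) (h : velAct p.1 a = q.1) : rho p = rho q :=
  Quot.sound ⟨a, h⟩

/-- If a relation `R` preserves the domain `d` and the values of a function `f`, then so does the
equivalence relation generated by `R`. -/
lemma invariant_of_quot_mk_eq {X Z : Type*} {R : X → X → Prop} (d : X → Prop) (f : X → Z)
    (h : ∀ x y, R x y → (d x ↔ d y) ∧ (d x → f x = f y)) {x y : X}
    (hxy : Quot.mk R x = Quot.mk R y) (hx : d x) : d y ∧ f x = f y := by
  have key : (d x ↔ d y) ∧ (d x → f x = f y) := by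
    have hr := Quot.eqvGen_exact hxy
    clear hxy hx
    induction hr with
    | rel x y hr => exact h x y hr
    | refl x => exact ⟨Iff.rfl, fun _ => rfl⟩
    | symm x y _ ih =>
      exact ⟨ih.1.symm, fun hy => (ih.2 (ih.1.2 hy)).symm⟩
    | trans x y z _ _ ih ih' =>
      exact ⟨ih.1.trans ih'.1, fun hx => (ih.2 hx).trans (ih'.2 (ih.1.1 hx))⟩
  exact ⟨key.1.1 hx, key.2 hx⟩

lemma regular_velOf {e₀ : E} {u : Eu n} (hu : u ∈ (extChartAt (𝓡 n) e₀).target)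
    {C : Eu m →L[ℝ] Eu n} (hC : Function.Injective C) : Regular (velOf hu C) :=
  (chartEquiv (extChartAt_symm_mem_source hu)).symm.injective.comp hC

/-- The coordinates of a velocity in the chart of `T_m E` given by the preferred chart at `e₀`. -/
def tmCoord (e₀ : E) : Tm n m E → Eu n × (Eu m →L[ℝ] Eu n) := extChartAt (TmModel n m) (vel e₀ 0)

lemma tmCoord_vel {e₀ e : E} (he : e ∈ (chartAt (Eu n) e₀).source) (C : Eu m →L[ℝ] Eu n) :
    tmCoord e₀ (vel e C) =
      (extChartAt (𝓡 n) e₀ e, (chartEquiv he : Eu n →L[ℝ] Eu n).comp C) :=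
  extChartAt_vel (vel e₀ 0) he C

lemma tmCoord_velOf {e₀ : E} {u : Eu n} (hu : u ∈ (extChartAt (𝓡 n) e₀).target)
    (C : Eu m →L[ℝ] Eu n) : tmCoord e₀ (velOf hu C) = (u, C) :=
  extChartAt_velOf (vel e₀ 0) hu C

lemma contMDiffOn_tmCoord (e₀ : E) :
    ContMDiffOn (TmModel n m) 𝓘(ℝ, Eu n × (Eu m →L[ℝ] Eu n)) ∞
      (tmCoord e₀ : Tm n m E → Eu n × (Eu m →L[ℝ] Eu n))
      {p : Tm n m E | p.1 ∈ (chartAt (Eu n) e₀).source} := by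
  have h := contMDiffOn_extChartAt (I := TmModel n m) (n := ∞) (x := (vel e₀ 0 : Tm n m E))
  have h2 := velocity_extChartAt_source (I := 𝓡 n) (vel e₀ 0 : Tm n m E)
  rw [extChartAt_source] at h2
  rwa [h2] at h

lemma isOpen_over_chart_source (e₀ : E) :
    IsOpen {p : Tm n m E | p.1 ∈ (chartAt (Eu n) e₀).source} :=
  (chartAt (Eu n) e₀).open_source.preimage (FiberBundle.continuous_proj _ _)

/-- Velocities in the form `vel e C`, which hides the dependence of the type of `C` on `e`. -/
lemma exists_eq_vel (p : Tm n m E) : ∃ (e : E) (C : Eu m →L[ℝ] Eu n), p = vel e C :=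
  ⟨p.1, p.2, rfl⟩

lemma tmCoord_velAct {e₀ : E} {p : Tm n m E} (he : p.1 ∈ (chartAt (Eu n) e₀).source)
    (a : JetGroup m) :
    tmCoord e₀ (velAct p a) =
      ((tmCoord e₀ p).1, (tmCoord e₀ p).2.comp (a : Eu m →L[ℝ] Eu m)) := by
  obtain ⟨e, C, rfl⟩ := exists_eq_vel p
  have he' : e ∈ (chartAt (Eu n) e₀).source := he
  change tmCoord e₀ (vel e (C.comp (a : Eu m →L[ℝ] Eu m))) = ((tmCoord e₀ (vel e C)).1,
    (tmCoord e₀ (vel e C)).2.comp (a : Eu m →L[ℝ] Eu m))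
  rw [tmCoord_vel he', tmCoord_vel he']
  rfl

lemma velOf_tmCoord {e₀ : E} {p : Tm n m E} (he : p.1 ∈ (chartAt (Eu n) e₀).source)
    (h : (tmCoord e₀ p).1 ∈ (extChartAt (𝓡 n) e₀).target) : velOf h (tmCoord e₀ p).2 = p := by
  refine (velOf_eq (vel e₀ 0) h _).trans ?_
  exact (extChartAt (TmModel n m) (vel e₀ 0)).left_inv (by
    rw [velocity_extChartAt_source]; exact he)

lemma tmCoord_fst_mem {e₀ : E} {p : Tm n m E} (he : p.1 ∈ (chartAt (Eu n) e₀).source) :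
    (tmCoord e₀ p).1 ∈ (extChartAt (𝓡 n) e₀).target := by
  obtain ⟨e, C, rfl⟩ := exists_eq_vel p
  have he' : e ∈ (chartAt (Eu n) e₀).source := he
  rw [tmCoord_vel he']
  exact (extChartAt (𝓡 n) e₀).map_source (by rwa [extChartAt_source])

lemma tmCoord_fst {e₀ : E} {p : Tm n m E} (he : p.1 ∈ (chartAt (Eu n) e₀).source) :
    (tmCoord e₀ p).1 = extChartAt (𝓡 n) e₀ p.1 := by
  obtain ⟨e, C, rfl⟩ := exists_eq_vel p
  have he' : e ∈ (chartAt (Eu n) e₀).source := he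
  rw [tmCoord_vel he']
  rfl

lemma tmCoord_injOn {e₀ : E} {p q : Tm n m E} (hp : p.1 ∈ (chartAt (Eu n) e₀).source)
    (hq : q.1 ∈ (chartAt (Eu n) e₀).source) (h : tmCoord e₀ p = tmCoord e₀ q) : p = q :=
  (extChartAt (TmModel n m) (vel e₀ 0 : Tm n m E)).injOn
    (by rw [velocity_extChartAt_source]; exact hp) (by rw [velocity_extChartAt_source]; exact hq) h

lemma injective_tmCoord {e₀ : E} {p : Tm n m E} (he : p.1 ∈ (chartAt (Eu n) e₀).source)
    (hp : Regular p) : Function.Injective (tmCoord e₀ p).2 := by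
  obtain ⟨e, C, rfl⟩ := exists_eq_vel p
  have he' : e ∈ (chartAt (Eu n) e₀).source := he
  rw [tmCoord_vel he']
  exact (chartEquiv he').injective.comp hp

lemma contDiff_graphMap_arrayEquiv (L : Eu n ≃L[ℝ] Eu m × Eu (n - m)) :
    ContDiff ℝ ∞ fun N : Fin m → Eu (n - m) =>
      graphMap L ((arrayEquiv m (Eu (n - m))).symm N) := by
  have h : ContDiff ℝ ∞ fun N : Fin m → Eu (n - m) => (arrayEquiv m (Eu (n - m))).symm N :=
    (arrayEquiv m (Eu (n - m))).symm.contDiff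
  exact contDiff_graphMap.comp h

end Velocities

/-! ### Charts of the space of contact elements -/

section JmChart
variable {n m : ℕ} {E : Type*} [TopologicalSpace E] [ChartedSpace (Eu n) E]
  [IsManifold (𝓡 n) ∞ E]

open Classical in
/-- The submersion chart of `J^m E` given by the preferred chart of `E` at `p₀` and a splitting of
`ℝⁿ`: a contact element whose tangent space is a graph is described by its base point and the
linear map of which its tangent space is the graph. Outside `tgt`, the section is given the
irrelevant value `p₀`. -/
def jmChart (p₀ : Fm n m E) (L : Eu n ≃L[ℝ] Eu m × Eu (n - m)) :
    SubmersionChart (TmModel n m) (S := {p : Tm n m E | Regular p})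
      (rho : Fm n m E → Jm n m E) (JmModel n m) where
  dom := {p | p.1 ∈ (chartAt (Eu n) p₀.1.1).source ∧
    IsUnit ((fstL L).comp (tmCoord p₀.1.1 p).2)}
  isOpen_dom := by
    have h := (contMDiffOn_tmCoord (m := m) p₀.1.1).continuousOn.isOpen_inter_preimage
      (isOpen_over_chart_source p₀.1.1) ((isOpen_isUnit_fstL (L := L)).preimage continuous_snd)
    exact h
  toFun p := ((tmCoord p₀.1.1 p).1, arrayEquiv m _ (slope L (tmCoord p₀.1.1 p).2))
  contMDiffOn_toFun := by
    have h1 := (contMDiffOn_tmCoord (m := m) p₀.1.1).mono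
      (fun p (hp : p.1 ∈ (chartAt (Eu n) p₀.1.1).source ∧
        IsUnit ((fstL L).comp (tmCoord p₀.1.1 p).2)) => hp.1)
    have h2 : ContDiffOn ℝ ∞ (fun x : Eu n × (Eu m →L[ℝ] Eu n) =>
        ((x.1, arrayEquiv m _ (slope L x.2)) : JmModel n m))
        {x | IsUnit ((fstL L).comp x.2)} :=
      contDiffOn_fst.prodMk ((arrayEquiv m _).contDiff.comp_contDiffOn
        ((contDiffOn_slope (L := L)).comp contDiffOn_snd fun x hx => hx))
    exact h2.contMDiffOn.comp h1 fun p hp => hp.2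
  tgt := {y | y.1 ∈ (extChartAt (𝓡 n) p₀.1.1).target}
  isOpen_tgt := (isOpen_extChartAt_target _).preimage continuous_fst
  sec y := if h : y.1 ∈ (extChartAt (𝓡 n) p₀.1.1).target then
    ⟨velOf h (graphMap L ((arrayEquiv m _).symm y.2)),
      regular_velOf h (injective_graphMap L _)⟩ else p₀
  contMDiffOn_sec := by
    have h1 : ContDiff ℝ ∞ (fun y : JmModel n m =>
        ((y.1, graphMap L ((arrayEquiv m _).symm y.2)) : Eu n × (Eu m →L[ℝ] Eu n))) :=
      contDiff_fst.prodMk ((contDiff_graphMap_arrayEquiv L).comp contDiff_snd)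
    refine ((contMDiffOn_extChartAt_symm (I := TmModel n m) (n := ∞)
      (vel (m := m) p₀.1.1 0)).comp h1.contMDiff.contMDiffOn
        fun y (hy : y.1 ∈ (extChartAt (𝓡 n) p₀.1.1).target) =>
          mem_tm_target (vel p₀.1.1 0) hy _).congr fun y hy => ?_
    have hy' : y.1 ∈ (extChartAt (𝓡 n) p₀.1.1).target := hy
    simp only [dif_pos hy']
    exact velOf_eq (vel p₀.1.1 0) hy _
  sec_mem y hy := by
    have hy' : y.1 ∈ (extChartAt (𝓡 n) p₀.1.1).target := hy
    rw [dif_pos hy']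
    refine ⟨extChartAt_symm_mem_source hy, ?_⟩
    rw [tmCoord_velOf, fstL_comp_graphMap]
    exact isUnit_one
  toFun_sec y hy := by
    have hy' : y.1 ∈ (extChartAt (𝓡 n) p₀.1.1).target := hy
    rw [dif_pos hy', tmCoord_velOf, slope_graphMap, ContinuousLinearEquiv.apply_symm_apply]
  toFun_mem p hp := tmCoord_fst_mem hp.1
  saturated p q := by
    refine invariant_of_quot_mk_eq
      (fun p : Fm n m E => p.1.1 ∈ (chartAt (Eu n) p₀.1.1).source ∧
        IsUnit ((fstL L).comp (tmCoord p₀.1.1 p.1).2))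
      (fun p : Fm n m E => (((tmCoord p₀.1.1 p.1).1,
        arrayEquiv m _ (slope L (tmCoord p₀.1.1 p.1).2)) : JmModel n m)) ?_
    rintro ⟨p, hp⟩ ⟨_, hq⟩ ⟨a, rfl⟩
    by_cases he : p.1 ∈ (chartAt (Eu n) p₀.1.1).source
    · have hq : (velAct p a).1 ∈ (chartAt (Eu n) p₀.1.1).source := he
      simp only [he, hq, true_and, tmCoord_velAct he, isUnit_fstL_comp]
      exact fun hC => by rw [slope_comp _ a hC]
    · have hq : (velAct p a).1 ∉ (chartAt (Eu n) p₀.1.1).source := he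
      simp only [he, hq, false_and, false_imp_iff, and_self]
  mk_sec p hp := by
    have hu := tmCoord_fst_mem hp.1
    rw [dif_pos hu]
    -- Only the assertion about the component `C` is needed, so `B = D = 0` will do.
    obtain ⟨c, -, -, h, -⟩ := exists_normalForm_eq (a := 0) (b := 0) hp.2
      (Submodule.zero_mem _) (Submodule.zero_mem _)
    refine (rho_eq_of_act c ?_).symm
    have h1 : velAct p.1 c = velOf hu (graphMap L (slope L (tmCoord p₀.1.1 p.1).2)) := by
      rw [h]
      exact congrArg (fun q => velAct q c) (velOf_tmCoord hp.1 hu).symm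
    rw [h1]
    exact congrArg (fun N => velOf hu (graphMap L N))
      ((arrayEquiv m (Eu (n - m))).symm_apply_apply _).symm

lemma mem_jmChart_dom {p₀ : Fm n m E} {L : Eu n ≃L[ℝ] Eu m × Eu (n - m)} {p : Tm n m E} :
    p ∈ (jmChart p₀ L).dom ↔ p.1 ∈ (chartAt (Eu n) p₀.1.1).source ∧
      IsUnit ((fstL L).comp (tmCoord p₀.1.1 p).2) := Iff.rfl

lemma jmChart_toFun (p₀ : Fm n m E) (L : Eu n ≃L[ℝ] Eu m × Eu (n - m)) (p : Tm n m E) :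
    (jmChart p₀ L).toFun p =
      ((tmCoord p₀.1.1 p).1, arrayEquiv m _ (slope L (tmCoord p₀.1.1 p).2)) := rfl

lemma jmChart_sec {p₀ : Fm n m E} {L : Eu n ≃L[ℝ] Eu m × Eu (n - m)} {y : JmModel n m}
    (hy : y.1 ∈ (extChartAt (𝓡 n) p₀.1.1).target) :
    ((jmChart p₀ L).sec y).1 = velOf hy (graphMap L ((arrayEquiv m _).symm y.2)) :=
  congrArg Subtype.val (dif_pos hy)

/-- The splitting of `ℝⁿ` in which a given regular velocity is the inclusion of the first factor. -/
lemma exists_splitting_tmCoord (hmn : m < n) (p : Fm n m E) :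
    ∃ L : Eu n ≃L[ℝ] Eu m × Eu (n - m), (fstL L).comp (tmCoord p.1.1 p.1).2 = 1 ∧
      (sndL L).comp (tmCoord p.1.1 p.1).2 = 0 := by
  have hk : Module.finrank ℝ (Eu n) =
      Module.finrank ℝ (Eu m) + Module.finrank ℝ (Eu (n - m)) := by
    simp only [finrank_euclideanSpace, Fintype.card_fin]
    omega
  exact exists_splitting hk (injective_tmCoord (mem_chart_source _ _) p.2)

lemma graphMap_slope_of_split {L : Eu n ≃L[ℝ] Eu m × Eu (n - m)} {C : Eu m →L[ℝ] Eu n}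
    (h1 : (fstL L).comp C = 1) : graphMap L (slope L C) = C := by
  refine ContinuousLinearMap.ext fun v => ?_
  rw [graphMap_slope_apply (by rw [h1]; exact isUnit_one), h1, Ring.inverse_one]
  rfl

lemma exists_jmChart_sec (hmn : m < n) (p : Fm n m E) :
    ∃ i : Fm n m E × (Eu n ≃L[ℝ] Eu m × Eu (n - m)), p.1 ∈ (jmChart i.1 i.2).dom ∧
      (jmChart i.1 i.2).sec ((jmChart i.1 i.2).toFun p.1) = p := by
  obtain ⟨L, h1, -⟩ := exists_splitting_tmCoord hmn p
  have he : p.1.1 ∈ (chartAt (Eu n) p.1.1).source := mem_chart_source _ _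
  refine ⟨(p, L), ⟨he, ?_⟩, Subtype.ext ?_⟩
  · rw [h1]
    exact isUnit_one
  · have h2 : graphMap L ((arrayEquiv m _).symm ((jmChart p L).toFun p.1).2) =
        (tmCoord p.1.1 p.1).2 := by
      rw [jmChart_toFun]
      exact (congrArg (graphMap L) ((arrayEquiv m _).symm_apply_apply _)).trans
        (graphMap_slope_of_split h1)
    exact (jmChart_sec (tmCoord_fst_mem he)).trans
      ((congrArg (velOf (tmCoord_fst_mem he)) h2).trans (velOf_tmCoord he _))

end JmChart

/-! ### Charts of the quotients of double velocities -/

section QuotientChart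
variable {n m : ℕ} {E : Type*} [TopologicalSpace E] [ChartedSpace (Eu n) E]
  [IsManifold (𝓡 n) ∞ E]

/-- The bilinear component of a double velocity in the chart of `T_m T_m E` given by the preferred
chart at `e₀`: the part of the derivative in the direction of the fibres of `T_m E`. It is defined
for all double velocities, so as to be a smooth function on an open set, but has an invariant
meaning only for the vertical ones. -/
def bilCoord (e₀ : E) (x : TmTm n m E) : Eu m →L[ℝ] Eu m →L[ℝ] Eu n :=
  (ContinuousLinearMap.snd ℝ (Eu n) (Eu m →L[ℝ] Eu n)).comp
    (extChartAt (TmTmModel n m) (vert e₀ 0 0) x).2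

lemma bilCoord_vertOf {e₀ : E} {u : Eu n} (hu : u ∈ (extChartAt (𝓡 n) e₀).target)
    (C : Eu m →L[ℝ] Eu n) (B : Eu m →L[ℝ] Eu m →L[ℝ] Eu n) :
    bilCoord e₀ (vertOf hu C B) = B := by
  exact congrArg (fun y => (ContinuousLinearMap.snd ℝ (Eu n) (Eu m →L[ℝ] Eu n)).comp y.2)
    (extChartAt_vertOf (vert e₀ 0 0) hu C B)

lemma tmCoord_vertOf {e₀ : E} {u : Eu n} (hu : u ∈ (extChartAt (𝓡 n) e₀).target)
    (C : Eu m →L[ℝ] Eu n) (B : Eu m →L[ℝ] Eu m →L[ℝ] Eu n) :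
    tmCoord e₀ (vertOf hu C B).1 = (u, C) := tmCoord_velOf hu C

lemma contMDiffOn_bilCoord (e₀ : E) :
    ContMDiffOn (TmTmModel n m) 𝓘(ℝ, Eu m →L[ℝ] Eu m →L[ℝ] Eu n) ∞
      (bilCoord e₀ : TmTm n m E → _)
      {x : TmTm n m E | x.1.1 ∈ (chartAt (Eu n) e₀).source} := by
  have h := contMDiffOn_extChartAt (I := TmTmModel n m) (n := ∞) (x := (vert e₀ 0 0 : TmTm n m E))
  have h2 := tmTm_extChartAt_source (vert e₀ 0 0 : TmTm n m E)
  rw [extChartAt_source] at h2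
  rw [h2] at h
  have h3 : ContDiff ℝ ∞ fun y : (Eu n × (Eu m →L[ℝ] Eu n)) ×
      (Eu m →L[ℝ] Eu n × (Eu m →L[ℝ] Eu n)) =>
      (ContinuousLinearMap.snd ℝ (Eu n) (Eu m →L[ℝ] Eu n)).comp y.2 :=
    contDiff_const.clm_comp contDiff_snd
  exact h3.contMDiff.comp_contMDiffOn h

lemma doubleAct_vertOf {e₀ : E} {u : Eu n} (hu : u ∈ (extChartAt (𝓡 n) e₀).target)
    (C : Eu m →L[ℝ] Eu n) (B : Eu m →L[ℝ] Eu m →L[ℝ] Eu n) (g : PrincipalJetGroup m) :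
    doubleAct (vertOf hu C B) g = vertOf hu (C.comp (g.sig : Eu m →L[ℝ] Eu m))
      (B.bilinearComp (g.phi : Eu m →L[ℝ] Eu m) (g.sig : Eu m →L[ℝ] Eu m) +
        (ContinuousLinearMap.compL ℝ (Eu m) (Eu m) (Eu n) C).comp g.dsig) := by
  rw [vertOf, doubleAct_vert, vertOf]
  refine congrArg (vert _ _) ?_
  refine ContinuousLinearMap.ext fun v => ContinuousLinearMap.ext fun w => ?_
  exact (map_add (chartEquiv (extChartAt_symm_mem_source hu)).symm _ _).symm

lemma exists_eq_vertOf {e₀ e : E} (he : e ∈ (chartAt (Eu n) e₀).source)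
    {C : Eu m →L[ℝ] Eu n} (hC : Function.Injective C) {a b : ℝ}
    {B : Eu m →L[ℝ] Eu m →L[ℝ] Eu n} (hB : B ∈ symClass a b (Eu m) (Eu n)) :
    ∃ (u : Eu n) (hu : u ∈ (extChartAt (𝓡 n) e₀).target) (C' : Eu m →L[ℝ] Eu n)
      (B' : Eu m →L[ℝ] Eu m →L[ℝ] Eu n), Function.Injective C' ∧
      B' ∈ symClass a b (Eu m) (Eu n) ∧ vert e C B = vertOf hu C' B' := by
  refine ⟨extChartAt (𝓡 n) e₀ e,
    (extChartAt (𝓡 n) e₀).map_source (by rwa [extChartAt_source]),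
    (chartEquiv he : Eu n →L[ℝ] Eu n).comp C,
    (ContinuousLinearMap.compL ℝ (Eu m) (Eu n) (Eu n)
            (chartEquiv he : Eu n →L[ℝ] Eu n)).comp B,
    (chartEquiv he).injective.comp hC, symClass_compL hB _, ?_⟩
  have hs : vert e C B ∈ (extChartAt (TmTmModel n m) (vert e₀ 0 0 : TmTm n m E)).source := by
    rw [tmTm_extChartAt_source]
    exact he
  exact ((extChartAt (TmTmModel n m) (vert e₀ 0 0)).left_inv hs).symm.trans
    ((congrArg _ (extChartAt_vert' (vert e₀ 0 0) he C B)).trans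
      (vertOf_eq (vert e₀ 0 0) _ _ _).symm)

variable (W : ∀ p : Tm n m E, Submodule ℝ (Eu m →L[ℝ] TangentSpace (TmModel n m) p))
  (G : Subgroup (PrincipalJetGroup m)) (K : Type*) [NormedAddCommGroup K] [NormedSpace ℝ K]

/-- The family `W` of spaces of double velocities and the group `G` are given by the bilinear maps
in a class `symClass a b`, and `K` is identified with the bilinear maps `ℝᵐ × ℝᵐ → ℝⁿ⁻ᵐ` in this
class. -/
structure BilinearType where
  /-- the first parameter of the symmetry class -/
  a : ℝ
  /-- the second parameter of the symmetry class -/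
  b : ℝ
  mem_W : ∀ (e : E) (C : Eu m →L[ℝ] Eu n) (A), A ∈ W (vel e C) ↔
    ∃ B ∈ symClass a b (Eu m) (Eu n), (⟨vel e C, A⟩ : TmTm n m E) = vert e C B
  mem_G : ∀ g, g ∈ G ↔ g.phi = g.sig ∧ g.dsig ∈ symClass a b (Eu m) (Eu m)
  /-- the inclusion of the class into all bilinear maps -/
  incl : K →ₗ[ℝ] Eu m →L[ℝ] Eu m →L[ℝ] Eu (n - m)
  /-- a projection onto the class; it serves to extend coordinates to an open set of double
  velocities outside of the class -/
  proj : (Eu m →L[ℝ] Eu m →L[ℝ] Eu (n - m)) →ₗ[ℝ] K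
  contDiff_incl : ContDiff ℝ ∞ incl
  contDiff_proj : ContDiff ℝ ∞ proj
  proj_incl : ∀ k, proj (incl k) = k
  incl_mem : ∀ k, incl k ∈ symClass a b (Eu m) (Eu (n - m))
  incl_proj : ∀ B ∈ symClass a b (Eu m) (Eu (n - m)), incl (proj B) = B

variable {W G K} (T : BilinearType W G K)

lemma isQuotientMap_mk : Topology.IsQuotientMap (OrbitSpace.mk (S := overRegular W) G) :=
  isQuotientMap_quot_mk

namespace BilinearType

lemma mem_overRegular_vert {e : E} {C : Eu m →L[ℝ] Eu n} (hC : Function.Injective C)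
    {B : Eu m →L[ℝ] Eu m →L[ℝ] Eu n} (hB : B ∈ symClass T.a T.b (Eu m) (Eu n)) :
    vert e C B ∈ overRegular W :=
  ⟨hC, (T.mem_W e C _).2 ⟨B, hB, rfl⟩⟩

lemma exists_eq_vert (x : overRegular W) : ∃ (e : E) (C : Eu m →L[ℝ] Eu n)
    (B : Eu m →L[ℝ] Eu m →L[ℝ] Eu n), Function.Injective C ∧
    B ∈ symClass T.a T.b (Eu m) (Eu n) ∧ x.1 = vert e C B := by
  obtain ⟨⟨p, A⟩, hp, hA⟩ := x
  obtain ⟨e, C, rfl⟩ := exists_eq_vel p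
  obtain ⟨B, hB, h⟩ := (T.mem_W e C A).1 hA
  exact ⟨e, C, B, hp, hB, h⟩

lemma exists_eq_vertOf (x : overRegular W) {e₀ : E}
    (he : x.1.1.1 ∈ (chartAt (Eu n) e₀).source) :
    ∃ (u : Eu n) (hu : u ∈ (extChartAt (𝓡 n) e₀).target) (C : Eu m →L[ℝ] Eu n)
      (B : Eu m →L[ℝ] Eu m →L[ℝ] Eu n), Function.Injective C ∧
      B ∈ symClass T.a T.b (Eu m) (Eu n) ∧ x.1 = vertOf hu C B := by
  obtain ⟨e, C, B, hC, hB, h⟩ := T.exists_eq_vert x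
  rw [h] at he ⊢
  exact DoubleContact.exists_eq_vertOf he hC hB

lemma vertOf_mem {e₀ : E} {u : Eu n} (hu : u ∈ (extChartAt (𝓡 n) e₀).target)
    {C : Eu m →L[ℝ] Eu n} (hC : Function.Injective C)
    {B : Eu m →L[ℝ] Eu m →L[ℝ] Eu n} (hB : B ∈ symClass T.a T.b (Eu m) (Eu n)) :
    vertOf hu C B ∈ overRegular W :=
  T.mem_overRegular_vert ((chartEquiv (extChartAt_symm_mem_source hu)).symm.injective.comp hC)
    (symClass_compL hB _)

lemma symClass_act {g : PrincipalJetGroup m} (hg : g ∈ G) {C : Eu m →L[ℝ] Eu n}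
    {B : Eu m →L[ℝ] Eu m →L[ℝ] Eu n} (hB : B ∈ symClass T.a T.b (Eu m) (Eu n)) :
    B.bilinearComp (g.phi : Eu m →L[ℝ] Eu m) (g.sig : Eu m →L[ℝ] Eu m) +
        (ContinuousLinearMap.compL ℝ (Eu m) (Eu m) (Eu n) C).comp g.dsig ∈
      symClass T.a T.b (Eu m) (Eu n) := by
  obtain ⟨h1, h2⟩ := (T.mem_G g).1 hg
  rw [h1]
  exact Submodule.add_mem _ (symClass_bilinearComp hB _) (symClass_compL h2 _)

/-- The coordinates of a double velocity in the chart of the quotient over a chart of `J^m E`: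
the last component is the bilinear map `quad`. -/
def chartFun (x₀ : overRegular W) (L : Eu n ≃L[ℝ] Eu m × Eu (n - m)) (x : TmTm n m E) :
    JmModel n m × K :=
  ((jmChart ⟨x₀.1.1, x₀.2.1⟩ L).toFun x.1,
    T.proj (quad L (tmCoord x₀.1.1.1 x.1).2 (bilCoord x₀.1.1.1 x)))

lemma chartFun_vertOf {x₀ : overRegular W} (L : Eu n ≃L[ℝ] Eu m × Eu (n - m)) {u : Eu n}
    (hu : u ∈ (extChartAt (𝓡 n) x₀.1.1.1).target) (C : Eu m →L[ℝ] Eu n)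
    (B : Eu m →L[ℝ] Eu m →L[ℝ] Eu n) :
    T.chartFun x₀ L (vertOf hu C B) = ((u, arrayEquiv m _ (slope L C)), T.proj (quad L C B)) := by
  rw [chartFun, jmChart_toFun, tmCoord_vertOf, bilCoord_vertOf]

open Classical in
/-- The section of the quotient given by the normal form with tangential part `D`; it has the
irrelevant value `x₀` outside of the chart. -/
def chartSec (x₀ : overRegular W) (L : Eu n ≃L[ℝ] Eu m × Eu (n - m))
    (D : symClass T.a T.b (Eu m) (Eu m)) (y : JmModel n m × K) : overRegular W :=
  if h : y.1.1 ∈ (extChartAt (𝓡 n) x₀.1.1.1).target then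
    ⟨vertOf h (graphMap L ((arrayEquiv m _).symm y.1.2))
      (normalForm L D ((arrayEquiv m _).symm y.1.2) (T.incl y.2)),
      T.vertOf_mem h (injective_graphMap L _) (normalForm_mem D.2 _ (T.incl_mem _))⟩ else x₀

lemma chartSec_eq {x₀ : overRegular W} {L : Eu n ≃L[ℝ] Eu m × Eu (n - m)}
    {D : symClass T.a T.b (Eu m) (Eu m)} {y : JmModel n m × K}
    (hy : y.1.1 ∈ (extChartAt (𝓡 n) x₀.1.1.1).target) :
    (T.chartSec x₀ L D y).1 = vertOf hy (graphMap L ((arrayEquiv m _).symm y.1.2))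
      (normalForm L D ((arrayEquiv m _).symm y.1.2) (T.incl y.2)) :=
  congrArg Subtype.val (dif_pos hy)

lemma chartSec_chartFun {x₀ : overRegular W} (L : Eu n ≃L[ℝ] Eu m × Eu (n - m))
    (D : symClass T.a T.b (Eu m) (Eu m)) {u : Eu n}
    (hu : u ∈ (extChartAt (𝓡 n) x₀.1.1.1).target) (C : Eu m →L[ℝ] Eu n)
    {B : Eu m →L[ℝ] Eu m →L[ℝ] Eu n} (hB : B ∈ symClass T.a T.b (Eu m) (Eu n)) :
    (T.chartSec x₀ L D (T.chartFun x₀ L (vertOf hu C B))).1 =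
      vertOf hu (graphMap L (slope L C)) (normalForm L D (slope L C) (quad L C B)) := by
  rw [chartFun_vertOf]
  refine (T.chartSec_eq hu).trans ?_
  have h5 := (arrayEquiv m (Eu (n - m))).symm_apply_apply (slope L C)
  dsimp only
  rw [T.incl_proj _ (quad_mem C hB), h5]

lemma contMDiffOn_chartFun (x₀ : overRegular W) (L : Eu n ≃L[ℝ] Eu m × Eu (n - m)) :
    ContMDiffOn (TmTmModel n m) 𝓘(ℝ, JmModel n m × K) ∞ (T.chartFun x₀ L)
      {x | x.1 ∈ (jmChart ⟨x₀.1.1, x₀.2.1⟩ L).dom} := by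
  have hp : ContMDiffOn (TmTmModel n m) (TmModel n m) ∞ (fun x : TmTm n m E => x.1)
      {x | x.1 ∈ (jmChart ⟨x₀.1.1, x₀.2.1⟩ L).dom} := (contMDiff_proj _).contMDiffOn
  have h1 := (jmChart ⟨x₀.1.1, x₀.2.1⟩ L).contMDiffOn_toFun.comp hp fun x hx => hx
  have h2 := (contMDiffOn_tmCoord (m := m) x₀.1.1.1).comp hp fun x hx => hx.1
  have h3 := (contMDiffOn_bilCoord (m := m) x₀.1.1.1).mono
    (fun (x : TmTm n m E) (hx : x.1 ∈ (jmChart ⟨x₀.1.1, x₀.2.1⟩ L).dom) => hx.1)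
  exact h1.prodMk_space (contMDiffOn_proj_quad h2 h3 (fun x hx => hx.2) T.contDiff_proj)

lemma contMDiffOn_chartSec (x₀ : overRegular W) (L : Eu n ≃L[ℝ] Eu m × Eu (n - m))
    (D : symClass T.a T.b (Eu m) (Eu m)) :
    ContMDiffOn 𝓘(ℝ, JmModel n m × K) (TmTmModel n m) ∞
      (fun y => (T.chartSec x₀ L D y).1) {y | y.1 ∈ (jmChart ⟨x₀.1.1, x₀.2.1⟩ L).tgt} := by
  have h1 := contDiff_normalForm_coord (L := L) (U := Eu n) D.1
    (arrayEquiv m (Eu (n - m))).symm T.contDiff_incl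
  refine ((contMDiffOn_extChartAt_symm (I := TmTmModel n m) (n := ∞)
    (vert x₀.1.1.1 0 0)).comp h1.contMDiff.contMDiffOn
      fun y (hy : y.1.1 ∈ (extChartAt (𝓡 n) x₀.1.1.1).target) =>
        mem_tmTm_target (vert x₀.1.1.1 0 0) hy _ _).congr fun y hy => ?_
  exact (T.chartSec_eq hy).trans (vertOf_eq (vert x₀.1.1.1 0 0) hy _ _)

lemma chartFun_doubleAct (x₀ : overRegular W) (L : Eu n ≃L[ℝ] Eu m × Eu (n - m))
    (x : overRegular W) {g : PrincipalJetGroup m} (hg : g ∈ G) :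
    (x.1.1 ∈ (jmChart ⟨x₀.1.1, x₀.2.1⟩ L).dom ↔
      (doubleAct x.1 g).1 ∈ (jmChart ⟨x₀.1.1, x₀.2.1⟩ L).dom) ∧
    (x.1.1 ∈ (jmChart ⟨x₀.1.1, x₀.2.1⟩ L).dom →
      T.chartFun x₀ L x.1 = T.chartFun x₀ L (doubleAct x.1 g)) := by
  obtain ⟨h1, -⟩ := (T.mem_G g).1 hg
  by_cases he : x.1.1.1 ∈ (chartAt (Eu n) x₀.1.1.1).source
  · obtain ⟨u, hu, C, B, -, -, h⟩ := T.exists_eq_vertOf x he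
    have hs : ∀ (C' : Eu m →L[ℝ] Eu n) B',
        (vertOf hu C' B').1.1 ∈ (chartAt (Eu n) x₀.1.1.1).source :=
      fun C' B' => extChartAt_symm_mem_source hu
    rw [h, doubleAct_vertOf]
    simp only [mem_jmChart_dom, tmCoord_vertOf, chartFun_vertOf, hs, true_and, isUnit_fstL_comp]
    refine fun hC => ?_
    rw [slope_comp C _ hC, h1, quad_act hC]
  · have he' : (doubleAct x.1 g).1.1 ∉ (chartAt (Eu n) x₀.1.1.1).source := he
    simp only [mem_jmChart_dom, he, he', false_and, false_imp_iff, and_self]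

lemma mk_chartSec {x₀ : overRegular W} {L : Eu n ≃L[ℝ] Eu m × Eu (n - m)}
    (D : symClass T.a T.b (Eu m) (Eu m)) (x : overRegular W)
    (hx : x.1.1 ∈ (jmChart ⟨x₀.1.1, x₀.2.1⟩ L).dom) :
    OrbitSpace.mk G (T.chartSec x₀ L D (T.chartFun x₀ L x)) = OrbitSpace.mk G x := by
  obtain ⟨u, hu, C, B, hC', hB, h⟩ := T.exists_eq_vertOf x hx.1
  have hC : IsUnit ((fstL L).comp C) := by
    have h2 := hx.2
    rwa [h, tmCoord_vertOf] at h2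
  obtain ⟨c, D', hD', h1, h2⟩ := exists_normalForm_eq hC hB D.2
  refine (Quot.sound ⟨⟨c, c, D'⟩, (T.mem_G _).2 ⟨rfl, hD'⟩, ?_⟩).symm
  have h3 := doubleAct_vertOf hu C B ⟨c, c, D'⟩
  dsimp only at h3
  rw [h, T.chartSec_chartFun L D hu C hB, h1, h2, h3]

/-- The submersion chart of a quotient of double velocities over the chart of `J^m E` given by
a point and a splitting of `ℝⁿ`. The bilinear map `D` only determines the section. -/
def chart (x₀ : overRegular W) (L : Eu n ≃L[ℝ] Eu m × Eu (n - m))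
    (D : symClass T.a T.b (Eu m) (Eu m)) :
    SubmersionChart (TmTmModel n m) (OrbitSpace.mk (S := overRegular W) G)
      (JmModel n m × K) where
  dom := {x | x.1 ∈ (jmChart ⟨x₀.1.1, x₀.2.1⟩ L).dom}
  isOpen_dom := (jmChart ⟨x₀.1.1, x₀.2.1⟩ L).isOpen_dom.preimage (FiberBundle.continuous_proj _ _)
  toFun := T.chartFun x₀ L
  contMDiffOn_toFun := T.contMDiffOn_chartFun x₀ L
  tgt := {y | y.1 ∈ (jmChart ⟨x₀.1.1, x₀.2.1⟩ L).tgt}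
  isOpen_tgt := (jmChart ⟨x₀.1.1, x₀.2.1⟩ L).isOpen_tgt.preimage continuous_fst
  sec := T.chartSec x₀ L D
  contMDiffOn_sec := T.contMDiffOn_chartSec x₀ L D
  sec_mem y hy := by
    have hy' : y.1.1 ∈ (extChartAt (𝓡 n) x₀.1.1.1).target := hy
    rw [T.chartSec_eq hy']
    refine ⟨extChartAt_symm_mem_source hy', ?_⟩
    dsimp only
    rw [tmCoord_vertOf, fstL_comp_graphMap]
    exact isUnit_one
  toFun_sec y hy := by
    have hy' : y.1.1 ∈ (extChartAt (𝓡 n) x₀.1.1.1).target := hy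
    rw [T.chartSec_eq hy', chartFun_vertOf, slope_graphMap, quad_normalForm, T.proj_incl,
      ContinuousLinearEquiv.apply_symm_apply]
  toFun_mem x hx := tmCoord_fst_mem hx.1
  saturated x y := by
    refine invariant_of_quot_mk_eq
      (fun x : overRegular W => x.1.1 ∈ (jmChart ⟨x₀.1.1, x₀.2.1⟩ L).dom)
      (fun x : overRegular W => T.chartFun x₀ L x.1) ?_
    rintro x ⟨_, hy⟩ ⟨g, hg, rfl⟩
    exact T.chartFun_doubleAct x₀ L x hg
  mk_sec x hx := T.mk_chartSec D x hx

/-- The indices of the charts of the quotient. -/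
abbrev Idx : Type _ :=
  overRegular W × (Eu n ≃L[ℝ] Eu m × Eu (n - m)) × symClass T.a T.b (Eu m) (Eu m)

/-- Each vertical double velocity is on the section of some chart: choose the splitting in which
`C` is the inclusion of the first factor, and `D` the first component of `B`. -/
lemma exists_chart_sec (hmn : m < n) (x : overRegular W) :
    ∃ i : T.Idx, x.1 ∈ (T.chart i.1 i.2.1 i.2.2).dom ∧
      (T.chart i.1 i.2.1 i.2.2).sec ((T.chart i.1 i.2.1 i.2.2).toFun x) = x := by
  obtain ⟨L, h1, h2⟩ := exists_splitting_tmCoord hmn ⟨x.1.1, x.2.1⟩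
  have he : x.1.1.1 ∈ (chartAt (Eu n) x.1.1.1).source := mem_chart_source _ _
  obtain ⟨u, hu, C, B, -, hB, h⟩ := T.exists_eq_vertOf x he
  let D : symClass T.a T.b (Eu m) (Eu m) :=
    ⟨(ContinuousLinearMap.compL ℝ (Eu m) (Eu n) (Eu m) (fstL L)).comp B, symClass_compL hB _⟩
  have h3 : tmCoord x.1.1.1 x.1.1 = (u, C) := by
    have := tmCoord_vertOf hu C B
    rwa [← h] at this
  dsimp only at h1 h2
  rw [h3] at h1 h2
  dsimp only at h1 h2
  refine ⟨(x, L, D), ⟨he, ?_⟩, Subtype.ext ?_⟩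
  · dsimp only
    rw [h3, h1]
    exact isUnit_one
  · change (T.chartSec x L D (T.chartFun x L x.1)).1 = x.1
    have h5 := T.chartSec_chartFun L D hu C hB
    rw [graphMap_slope_of_split h1, normalForm_fstL h1 h2, ← h] at h5
    exact h5

end BilinearType
end QuotientChart

/-! ### Orthogonal projections onto images of injective maps -/

section Range
variable {X Y : Type*} [NormedAddCommGroup X] [InnerProductSpace ℝ X] [FiniteDimensional ℝ X]
  [NormedAddCommGroup Y] [InnerProductSpace ℝ Y] [FiniteDimensional ℝ Y]

/-- The orthogonal projection onto the image of a linear map. -/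
def rangeProj (C : X →L[ℝ] Y) : Y →L[ℝ] Y := (LinearMap.range C.toLinearMap).starProjection

lemma rangeProj_comp (C : X →L[ℝ] Y) (a : (X →L[ℝ] X)ˣ) :
    rangeProj (C.comp (a : X →L[ℝ] X)) = rangeProj C := by
  have h : LinearMap.range (C.comp (a : X →L[ℝ] X)).toLinearMap =
      LinearMap.range C.toLinearMap := by
    ext y
    constructor
    · rintro ⟨x, rfl⟩
      exact ⟨a.1 x, rfl⟩
    · rintro ⟨x, rfl⟩
      refine ⟨a.inv x, congrArg C ?_⟩
      exact DFunLike.congr_fun a.val_inv x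
  simp only [rangeProj, h]

lemma exists_comp_of_rangeProj_eq {C C' : X →L[ℝ] Y} (hC : Function.Injective C)
    (hC' : Function.Injective C') (h : rangeProj C = rangeProj C') :
    ∃ a : (X →L[ℝ] X)ˣ, C.comp (a : X →L[ℝ] X) = C' := by
  have hr : LinearMap.range C.toLinearMap = LinearMap.range C'.toLinearMap := by
    have h1 := Submodule.range_starProjection (LinearMap.range C.toLinearMap)
    have h2 := Submodule.range_starProjection (LinearMap.range C'.toLinearMap)
    change (rangeProj C).range = _ at h1
    rw [h] at h1
    exact h1.symm.trans h2
  let e := (LinearEquiv.ofInjective C'.toLinearMap hC').trans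
    ((LinearEquiv.ofEq _ _ hr.symm).trans (LinearEquiv.ofInjective C.toLinearMap hC).symm)
  refine ⟨ContinuousLinearEquiv.toUnit e.toContinuousLinearEquiv,
    ContinuousLinearMap.ext fun v => ?_⟩
  have h3 : LinearEquiv.ofInjective C.toLinearMap hC (e v) =
      LinearEquiv.ofEq _ _ hr.symm (LinearEquiv.ofInjective C'.toLinearMap hC' v) :=
    LinearEquiv.apply_symm_apply _ _
  exact congrArg Subtype.val h3

lemma isUnit_adjoint_comp {C : X →L[ℝ] Y} (hC : Function.Injective C) :
    IsUnit (C.adjoint.comp C) := by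
  have := FiniteDimensional.complete ℝ X
  have h : Function.Injective (C.adjoint.comp C) := C.adjoint_comp_self_injective_iff.2 hC
  rw [ContinuousLinearMap.isUnit_iff_bijective]
  exact ⟨h, (LinearMap.injective_iff_surjective (f := (C.adjoint.comp C).toLinearMap)).1 h⟩

/-- The explicit formula `C (CᵗC)⁻¹ Cᵗ` shows that the projection onto the image depends
continuously on `C`. -/
lemma rangeProj_eq {C : X →L[ℝ] Y} (hC : Function.Injective C) :
    rangeProj C = C.comp ((Ring.inverse (C.adjoint.comp C)).comp C.adjoint) := by
  refine ContinuousLinearMap.ext fun y => ?_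
  have hmem : C (Ring.inverse (C.adjoint.comp C) (C.adjoint y)) ∈
      LinearMap.range C.toLinearMap := ⟨_, rfl⟩
  refine Submodule.eq_starProjection_of_mem_orthogonal hmem ?_
  rw [Submodule.mem_orthogonal]
  rintro _ ⟨x, rfl⟩
  change inner ℝ (C x) (y - C (Ring.inverse (C.adjoint.comp C) (C.adjoint y))) = 0
  have h := apply_inverse_self (isUnit_adjoint_comp hC) (C.adjoint y)
  rw [← ContinuousLinearMap.adjoint_inner_right, map_sub]
  change inner ℝ x (C.adjoint y - (C.adjoint.comp C) (Ring.inverse (C.adjoint.comp C) _)) = 0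
  rw [h, sub_self, inner_zero_right]

lemma continuousOn_rangeProj :
    ContinuousOn (rangeProj : (X →L[ℝ] Y) → Y →L[ℝ] Y) {C | Function.Injective C} := by
  have := FiniteDimensional.complete ℝ X
  have hadj : Continuous fun C : X →L[ℝ] Y => C.adjoint := ContinuousLinearMap.adjoint.continuous
  have hac : Continuous fun C : X →L[ℝ] Y => C.adjoint.comp C := hadj.clm_comp continuous_id
  have hinv : ContinuousOn (fun C : X →L[ℝ] Y => Ring.inverse (C.adjoint.comp C))
      {C | Function.Injective C} := by
    intro C hC
    have h := NormedRing.inverse_continuousAt (isUnit_adjoint_comp hC).unit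
    exact (ContinuousAt.comp (f := fun C : X →L[ℝ] Y => C.adjoint.comp C) h
      hac.continuousAt).continuousWithinAt
  exact (continuousOn_id.clm_comp (hinv.clm_comp hadj.continuousOn)).congr
    fun C hC => rangeProj_eq hC

end Range

/-! ### σ-compact sets -/

section SigmaCompact

lemma isSigmaCompact_of_isOpen {V : Type*} [NormedAddCommGroup V] [NormedSpace ℝ V]
    [FiniteDimensional ℝ V] {s : Set V} (hs : IsOpen s) : IsSigmaCompact s := by
  have := FiniteDimensional.proper_real V
  have := hs.locallyCompactSpace
  rw [isSigmaCompact_iff_sigmaCompactSpace]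
  infer_instance

lemma isSigmaCompact_prod {X Y : Type*} [TopologicalSpace X] [TopologicalSpace Y] {s : Set X}
    {t : Set Y} (hs : IsCompact s) (ht : IsSigmaCompact t) : IsSigmaCompact (s ×ˢ t) := by
  obtain ⟨K, hK, hKt⟩ := ht
  exact ⟨fun i => s ×ˢ K i, fun i => hs.prod (hK i), by rw [← prod_iUnion, hKt]⟩

end SigmaCompact

/-! ### The manifold of contact elements -/

section JmManifold
variable {n m : ℕ} {E : Type*} [TopologicalSpace E] [ChartedSpace (Eu n) E]
  [IsManifold (𝓡 n) ∞ E]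

variable (E) in
/-- The charted space structure on the space of contact elements. -/
@[reducible] def jmChartedSpace (hmn : m < n) : ChartedSpace (JmModel n m) (Jm n m E) :=
  quotientChartedSpace (fun i : Fm n m E × (Eu n ≃L[ℝ] Eu m × Eu (n - m)) => jmChart i.1 i.2)
    isQuotientMap_rho fun p => (exists_jmChart_sec hmn p).imp fun _ h => h.1

/-- The base point of a contact element. -/
def jmBase : Jm n m E → E :=
  Quot.lift (fun p => p.1.1) (by
    rintro p q ⟨a, h⟩
    have h1 : (velAct p.1 a).1 = q.1.1 := congrArg (fun x : Tm n m E => x.1) h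
    exact h1)

lemma continuous_jmBase : Continuous (jmBase : Jm n m E → E) :=
  isQuotientMap_rho.continuous_iff.2
    ((FiberBundle.continuous_proj _ _).comp continuous_subtype_val)

open Classical in
/-- The orthogonal projection onto a contact element, in the coordinates of the preferred chart of
`E` at `e₀`. It has the value zero over points outside of this chart. -/
def jmProjection (e₀ : E) : Jm n m E → Eu n →L[ℝ] Eu n :=
  Quot.lift (fun p => if p.1.1 ∈ (chartAt (Eu n) e₀).source then rangeProj (tmCoord e₀ p.1).2
    else 0) (by
    rintro ⟨p, hp⟩ ⟨_, hq⟩ ⟨a, rfl⟩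
    by_cases he : p.1 ∈ (chartAt (Eu n) e₀).source
    · have he' : (velAct p a).1 ∈ (chartAt (Eu n) e₀).source := he
      simp only [he, he', if_true, tmCoord_velAct he]
      exact (rangeProj_comp _ a).symm
    · have he' : (velAct p a).1 ∉ (chartAt (Eu n) e₀).source := he
      simp only [he, he', if_false])

lemma jmProjection_rho {e₀ : E} {p : Fm n m E} (he : p.1.1 ∈ (chartAt (Eu n) e₀).source) :
    jmProjection e₀ (rho p) = rangeProj (tmCoord e₀ p.1).2 := if_pos he

lemma continuousOn_jmProjection (e₀ : E) :
    ContinuousOn (jmProjection e₀ : Jm n m E → _) (jmBase ⁻¹' (chartAt (Eu n) e₀).source) := by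
  rw [isQuotientMap_rho.continuousOn_isOpen_iff
    ((chartAt (Eu n) e₀).open_source.preimage continuous_jmBase)]
  have h1 := (contMDiffOn_tmCoord (n := n) (m := m) e₀).continuousOn
  have h2 : ContinuousOn (fun p : Fm n m E => (tmCoord e₀ p.1).2)
      {p | p.1.1 ∈ (chartAt (Eu n) e₀).source} :=
    continuous_snd.comp_continuousOn (h1.comp continuous_subtype_val.continuousOn fun p hp => hp)
  exact (continuousOn_rangeProj.comp h2 fun p hp => injective_tmCoord hp p.2).congr
    fun p hp => jmProjection_rho hp

lemma t2Space_jm [T2Space E] : T2Space (Jm n m E) := by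
  refine t2Space_of_separating_on_fibres (Z := Eu n →L[ℝ] Eu n) continuous_jmBase ?_
  rintro ⟨p⟩ ⟨q⟩ hpq hne
  have hpq' : p.1.1 = q.1.1 := hpq
  have hp : p.1.1 ∈ (chartAt (Eu n) p.1.1).source := mem_chart_source _ _
  have hq : q.1.1 ∈ (chartAt (Eu n) p.1.1).source := by rw [← hpq']; exact hp
  refine ⟨jmBase ⁻¹' (chartAt (Eu n) p.1.1).source, jmProjection p.1.1,
    (chartAt (Eu n) p.1.1).open_source.preimage continuous_jmBase, hp, hq,
    continuousOn_jmProjection _, fun h => hne ?_⟩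
  have h1 : rangeProj (tmCoord p.1.1 p.1).2 = rangeProj (tmCoord p.1.1 q.1).2 :=
    (jmProjection_rho hp).symm.trans (h.trans (jmProjection_rho hq))
  obtain ⟨a, ha⟩ := exists_comp_of_rangeProj_eq (injective_tmCoord hp p.2)
    (injective_tmCoord hq q.2) h1
  refine rho_eq_of_act a ?_
  refine tmCoord_injOn hp hq ?_
  rw [tmCoord_velAct hp, ha]
  exact Prod.ext (by rw [tmCoord_fst hp, tmCoord_fst hq, hpq']) rfl

lemma paracompactSpace_jm (hmn : m < n) [T2Space E] [ParacompactSpace E] :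
    ParacompactSpace (Jm n m E) := by
  have := t2Space_jm (n := n) (m := m) (E := E)
  let _ := jmChartedSpace (m := m) E hmn
  have := ChartedSpace.locallyCompactSpace (JmModel n m) (Jm n m E)
  have := ChartedSpace.locallyCompactSpace (Eu n) E
  refine paracompactSpace_of_isSigmaCompact_preimage continuous_jmBase fun e =>
    ⟨(chartAt (Eu n) e).source, (chartAt (Eu n) e).open_source.mem_nhds (mem_chart_source _ _),
    fun K hK hKc => ?_⟩
  have h1 : IsSigmaCompact ((extChartAt (𝓡 n) e '' K) ×ˢ
      {C : Eu m →L[ℝ] Eu n | Function.Injective C}) :=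
    isSigmaCompact_prod (hKc.image_of_continuousOn ((continuousOn_extChartAt e).mono
      (by rw [extChartAt_source]; exact hK)))
      (isSigmaCompact_of_isOpen ContinuousLinearMap.isOpen_injective)
  have hsub : (extChartAt (𝓡 n) e '' K) ×ˢ {C : Eu m →L[ℝ] Eu n | Function.Injective C} ⊆
      (extChartAt (TmModel n m) (vel e 0 : Tm n m E)).target := by
    rintro ⟨_, C⟩ ⟨⟨x, hx, rfl⟩, -⟩
    exact mem_tm_target (vel e 0) ((extChartAt (𝓡 n) e).map_source
      (by rw [extChartAt_source]; exact hK hx)) C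
  have h2 := h1.image_of_continuousOn
    ((continuousOn_extChartAt_symm (I := TmModel n m) (vel e 0 : Tm n m E)).mono hsub)
  -- In a chart, the regular velocities over `K` are the product of `K` with the open set of
  -- injective maps.
  have h3 : IsSigmaCompact {p : Fm n m E | p.1.1 ∈ K} := by
    rw [Subtype.isSigmaCompact_iff]
    convert h2
    ext p
    constructor
    · rintro ⟨q, hq, rfl⟩
      have hq' := hK hq
      refine ⟨tmCoord e q.1, ⟨?_, injective_tmCoord hq' q.2⟩,
        (velOf_eq (vel e 0) (tmCoord_fst_mem hq') _).symm.trans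
        (velOf_tmCoord hq' (tmCoord_fst_mem hq'))⟩
      rw [tmCoord_fst hq']
      exact mem_image_of_mem _ hq
    · rintro ⟨⟨_, C⟩, ⟨⟨x, hx, rfl⟩, hC⟩, rfl⟩
      have hu : extChartAt (𝓡 n) e x ∈ (extChartAt (𝓡 n) e).target :=
        (extChartAt (𝓡 n) e).map_source (by rw [extChartAt_source]; exact hK hx)
      rw [← velOf_eq (vel e 0) hu]
      refine ⟨⟨_, regular_velOf hu hC⟩, ?_, rfl⟩
      change (extChartAt (𝓡 n) e).symm _ ∈ K
      rw [(extChartAt (𝓡 n) e).left_inv (by rw [extChartAt_source]; exact hK hx)]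
      exact hx
  have h4 := h3.image isQuotientMap_rho.continuous
  convert h4
  ext b
  constructor
  · rintro hb
    obtain ⟨p, rfl⟩ := isQuotientMap_rho.surjective b
    exact ⟨p, hb, rfl⟩
  · rintro ⟨p, hp, rfl⟩
    exact hp

end JmManifold

/-! ### Fibres and topology of the quotients -/

section QuotientFibres
variable {n m : ℕ} {E : Type*} [TopologicalSpace E] [ChartedSpace (Eu n) E]
  [IsManifold (𝓡 n) ∞ E]

/-- The relation which defines `J^m E` is an equivalence relation, as `L_m` is a group. -/
lemma exists_velAct_eq_of_rho_eq {p q : Fm n m E} (h : rho p = rho q) :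
    ∃ a : JetGroup m, velAct p.1 a = q.1 := by
  refine (invariant_of_quot_mk_eq (fun x : Fm n m E => ∃ a : JetGroup m, velAct p.1 a = x.1)
    (fun _ => ()) ?_ h ⟨1, rfl⟩).1
  rintro x ⟨_, hy⟩ ⟨b, rfl⟩
  refine ⟨⟨?_, ?_⟩, fun _ => rfl⟩
  · rintro ⟨a, ha⟩
    exact ⟨a * b, congrArg (fun q => velAct q b) ha⟩
  · rintro ⟨a, ha⟩
    refine ⟨a * b⁻¹, ?_⟩
    have h1 : velAct (velAct p.1 a) b⁻¹ = velAct (velAct x.1 b) b⁻¹ := by rw [ha]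
    have h2 : velAct (velAct x.1 b) b⁻¹ = velAct x.1 (b * b⁻¹) := rfl
    rw [mul_inv_cancel] at h2
    exact h1.trans h2

lemma bilCoord_mk {e₀ : E} {p : Tm n m E} (he : p.1 ∈ (chartAt (Eu n) e₀).source)
    (A : Eu m →L[ℝ] Eu n × (Eu m →L[ℝ] Eu n)) :
    bilCoord e₀ (⟨p, A⟩ : TmTm n m E) =
      (ContinuousLinearMap.snd ℝ (Eu n) (Eu m →L[ℝ] Eu n)).comp
        ((tangentCoordChange (TmModel n m) p (vel e₀ 0) p).comp A) := by
  have h : p ∈ (chartAt (ModelProd (Eu n) (Eu m →L[ℝ] Eu n))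
      (vert e₀ 0 0 : TmTm n m E).1).source := by
    rw [← extChartAt_source (TmModel n m), velocity_extChartAt_source]
    exact he
  exact congrArg (fun y => (ContinuousLinearMap.snd ℝ (Eu n) (Eu m →L[ℝ] Eu n)).comp y.2)
    (velocity_extChartAt_apply (vert e₀ 0 0 : TmTm n m E) ⟨p, A⟩ h)

lemma bilCoord_mk_apply {e₀ : E} {p : Tm n m E} (he : p.1 ∈ (chartAt (Eu n) e₀).source)
    (A : Eu m →L[ℝ] TangentSpace (TmModel n m) p) (v : Eu m) :
    bilCoord e₀ (⟨p, A⟩ : TmTm n m E) v =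
      (tangentCoordChange (TmModel n m) p (vel e₀ 0) p (A v)).2 :=
  DFunLike.congr_fun (bilCoord_mk he A) v

lemma bilCoord_add {e₀ : E} {p : Tm n m E} (he : p.1 ∈ (chartAt (Eu n) e₀).source)
    (A A' : Eu m →L[ℝ] TangentSpace (TmModel n m) p) :
    bilCoord e₀ (⟨p, A + A'⟩ : TmTm n m E) =
      bilCoord e₀ (⟨p, A⟩ : TmTm n m E) + bilCoord e₀ (⟨p, A'⟩ : TmTm n m E) := by
  refine ContinuousLinearMap.ext fun v => (bilCoord_mk_apply he _ v).trans ?_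
  exact (congrArg Prod.snd
    (map_add (tangentCoordChange (TmModel n m) p (vel e₀ 0) p) (A v) (A' v))).trans
    (congrArg₂ (fun x y : Eu m →L[ℝ] Eu n => x + y) (bilCoord_mk_apply he A v).symm
      (bilCoord_mk_apply he A' v).symm)

lemma bilCoord_smul {e₀ : E} {p : Tm n m E} (he : p.1 ∈ (chartAt (Eu n) e₀).source) (r : ℝ)
    (A : Eu m →L[ℝ] TangentSpace (TmModel n m) p) :
    bilCoord e₀ (⟨p, r • A⟩ : TmTm n m E) = r • bilCoord e₀ (⟨p, A⟩ : TmTm n m E) := by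
  refine ContinuousLinearMap.ext fun v => (bilCoord_mk_apply he _ v).trans ?_
  exact (congrArg Prod.snd
    (map_smul (tangentCoordChange (TmModel n m) p (vel e₀ 0) p) r (A v))).trans
    (congrArg (fun x : Eu m →L[ℝ] Eu n => r • x) (bilCoord_mk_apply he A v).symm)

variable {W : ∀ p : Tm n m E, Submodule ℝ (Eu m →L[ℝ] TangentSpace (TmModel n m) p)}
  {G : Subgroup (PrincipalJetGroup m)} {K : Type*} [NormedAddCommGroup K] [NormedSpace ℝ K]
  (T : BilinearType W G K)

lemma continuous_proj : Continuous (OrbitSpace.proj : OrbitSpace (overRegular W) G → Jm n m E) := by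
  have h : Continuous fun x : overRegular W => (⟨x.1.1, x.2.1⟩ : Fm n m E) :=
    ((FiberBundle.continuous_proj _ _).comp continuous_subtype_val).subtype_mk _
  exact (isQuotientMap_quot_mk (r := fun x y : overRegular W =>
    ∃ g ∈ G, doubleAct x.1 g = y.1)).continuous_iff.2 (isQuotientMap_rho.continuous.comp h)

namespace BilinearType

/-- The classes of the elements over one regular velocity `p` fill the fibre over `ρ(p)`: the
elements over any other velocity `p · a⁻¹` in `ρ(p)` can be moved to `p` by `(a, a, 0)`. -/
lemma fibreMk_surjective (T : BilinearType W G K) (p : Fm n m E) :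
    Function.Surjective (fibreMk W G p) := by
  rintro ⟨⟨x⟩, hx⟩
  obtain ⟨a, ha⟩ := exists_velAct_eq_of_rho_eq (p := ⟨x.1.1, x.2.1⟩) (q := p) hx
  let g : PrincipalJetGroup m := ⟨a, a, 0⟩
  have hg : g ∈ G := (T.mem_G g).2 ⟨rfl, Submodule.zero_mem _⟩
  have hy : doubleAct x.1 g ∈ overRegular W := by
    obtain ⟨e, C, B, hC, hB, h⟩ := T.exists_eq_vert x
    rw [h, doubleAct_vert]
    have hCa : Function.Injective (C.comp (a : Eu m →L[ℝ] Eu m)) :=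
      Function.Injective.comp (g := C) hC (ContinuousLinearEquiv.ofUnit a).injective
    exact T.mem_overRegular_vert hCa
      (T.symClass_act hg hB)
  have h1 : (doubleAct x.1 g).1 = p.1 := ha
  obtain ⟨p, hp⟩ := p
  dsimp only at h1
  subst h1
  exact ⟨⟨(doubleAct x.1 g).2, hy.2⟩, Subtype.ext (Quot.sound ⟨g, hg, rfl⟩ : Quot.mk _ x = _).symm⟩

/-- The chart of the quotient. -/
def qchart (i : T.Idx) : OpenPartialHomeomorph (OrbitSpace (overRegular W) G) (JmModel n m × K) :=
  (T.chart i.1 i.2.1 i.2.2).chart isQuotientMap_mk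

/-- The chart of `J^m E` below a chart of the quotient. -/
def bchart (i : T.Idx) : OpenPartialHomeomorph (Jm n m E) (JmModel n m) :=
  (jmChart ⟨i.1.1.1, i.1.2.1⟩ i.2.1).chart isQuotientMap_rho

lemma qchart_mk (i : T.Idx) (x : overRegular W)
    (hx : x.1.1 ∈ (jmChart ⟨i.1.1.1, i.1.2.1⟩ i.2.1).dom) :
    T.qchart i (OrbitSpace.mk G x) = T.chartFun i.1 i.2.1 x.1 :=
  (T.chart i.1 i.2.1 i.2.2).chart_apply isQuotientMap_mk hx

lemma mem_bchart_rho (i : T.Idx) (p : Fm n m E) :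
    rho p ∈ (T.bchart i).source ↔ p.1 ∈ (jmChart ⟨i.1.1.1, i.1.2.1⟩ i.2.1).dom :=
  (jmChart ⟨i.1.1.1, i.1.2.1⟩ i.2.1).mem_chart_source isQuotientMap_rho

lemma mem_qchart_source (i : T.Idx) (q : OrbitSpace (overRegular W) G) :
    q ∈ (T.qchart i).source ↔ q.proj ∈ (T.bchart i).source := by
  obtain ⟨x, rfl⟩ := isQuotientMap_mk.surjective q
  exact ((T.chart i.1 i.2.1 i.2.2).mem_chart_source isQuotientMap_mk).trans
    (T.mem_bchart_rho i ⟨x.1.1, x.2.1⟩).symm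

lemma mem_qchart_target (i : T.Idx) (u : JmModel n m) (k : K) (hu : u ∈ (T.bchart i).target) :
    (u, k) ∈ (T.qchart i).target := hu

lemma fst_qchart (i : T.Idx) (q : OrbitSpace (overRegular W) G) (hq : q ∈ (T.qchart i).source) :
    (T.qchart i q).1 = T.bchart i q.proj := by
  obtain ⟨x, rfl⟩ := isQuotientMap_mk.surjective q
  rw [mem_qchart_source] at hq
  have hx := (T.mem_bchart_rho i ⟨x.1.1, x.2.1⟩).1 hq
  rw [T.qchart_mk i x hx]
  exact ((jmChart ⟨i.1.1.1, i.1.2.1⟩ i.2.1).chart_apply (x := ⟨x.1.1, x.2.1⟩)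
    isQuotientMap_rho hx).symm

lemma exists_mem_bchart_source (hmn : m < n) (b : Jm n m E) :
    ∃ i : T.Idx, b ∈ (T.bchart i).source := by
  obtain ⟨p, rfl⟩ := isQuotientMap_rho.surjective b
  obtain ⟨⟨p₀, L⟩, hp, -⟩ := exists_jmChart_sec hmn p
  exact ⟨(⟨⟨p₀.1, 0⟩, p₀.2, Submodule.zero_mem _⟩, L, 0), (T.mem_bchart_rho _ p).2 hp⟩

lemma bijective_qchart_snd {i : T.Idx} {b : Jm n m E} (hb : b ∈ (T.bchart i).source) :
    Function.Bijective fun x : Fibre (OrbitSpace.proj (W := W) (G := G)) b =>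
      (T.qchart i x.1).2 := by
  have hs : ∀ x : Fibre (OrbitSpace.proj (W := W) (G := G)) b, x.1 ∈ (T.qchart i).source :=
    fun x => (T.mem_qchart_source i _).2 (by rw [x.2]; exact hb)
  constructor
  · intro x y h
    refine Subtype.ext ((T.qchart i).injOn (hs x) (hs y) (Prod.ext ?_ h))
    rw [T.fst_qchart i _ (hs x), T.fst_qchart i _ (hs y), x.2, y.2]
  · intro k
    have ht := T.mem_qchart_target i _ k ((T.bchart i).map_source hb)
    have h1 := (T.qchart i).map_target ht
    have h2 := T.fst_qchart i _ h1
    rw [(T.qchart i).right_inv ht] at h2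
    exact ⟨⟨(T.qchart i).symm (T.bchart i b, k),
      (T.bchart i).injOn ((T.mem_qchart_source i _).1 h1) hb h2.symm⟩,
      congrArg Prod.snd ((T.qchart i).right_inv ht)⟩

lemma qchart_fibreMk {i : T.Idx} {p : Fm n m E} (hp : rho p ∈ (T.bchart i).source) (A : W p.1) :
    (T.qchart i (fibreMk W G p A).1).2 =
      T.proj (quad i.2.1 (tmCoord i.1.1.1.1 p.1).2 (bilCoord i.1.1.1.1 ⟨p.1, A.1⟩)) := by
  have h := T.qchart_mk i ⟨⟨p.1, A.1⟩, ⟨p.2, A.2⟩⟩ ((T.mem_bchart_rho i p).1 hp)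
  exact congrArg Prod.snd h

lemma isLinearMap_qchart_fibreMk {i : T.Idx} {p : Fm n m E} (hp : rho p ∈ (T.bchart i).source) :
    IsLinearMap ℝ fun A : W p.1 => (T.qchart i (fibreMk W G p A).1).2 := by
  have he : p.1.1 ∈ (chartAt (Eu n) i.1.1.1.1).source := ((T.mem_bchart_rho i p).1 hp).1
  constructor
  · intro A A'
    rw [T.qchart_fibreMk hp A, T.qchart_fibreMk hp A']
    refine (T.qchart_fibreMk hp (A + A')).trans ?_
    have h := bilCoord_add he A.1 A'.1
    refine (congrArg (fun B => T.proj (quad i.2.1 (tmCoord i.1.1.1.1 p.1).2 B)) h).trans ?_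
    exact map_quad_add _ _ _ _ _
  · intro r A
    rw [T.qchart_fibreMk hp A]
    refine (T.qchart_fibreMk hp (r • A)).trans ?_
    have h := bilCoord_smul he r A.1
    refine (congrArg (fun B => T.proj (quad i.2.1 (tmCoord i.1.1.1.1 p.1).2 B)) h).trans ?_
    exact map_quad_smul _ _ _ _ _

/-- A bijection of a fibre of the quotient onto the model fibre, given by some chart. -/
def fibreCoord (hmn : m < n) (b : Jm n m E) : Fibre (OrbitSpace.proj (W := W) (G := G)) b ≃ K :=
  Equiv.ofBijective _ (T.bijective_qchart_snd (T.exists_mem_bchart_source hmn b).choose_spec)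

/-- The addition of the fibres of the quotient, transported from the model fibre by some chart. It
does not depend on the chart by `isLinearMap_qchart_snd`. -/
@[reducible] def fibreAddCommGroup (hmn : m < n) (b : Jm n m E) :
    AddCommGroup (Fibre (OrbitSpace.proj (W := W) (G := G)) b) :=
  (T.fibreCoord hmn b).addCommGroup

/-- The vector space structure of the fibres of the quotient, given by the same chart. -/
@[reducible] def fibreModule (hmn : m < n) (b : Jm n m E) :
    letI := T.fibreAddCommGroup hmn b
    Module ℝ (Fibre (OrbitSpace.proj (W := W) (G := G)) b) :=
  letI := T.fibreAddCommGroup hmn b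
  (T.fibreCoord hmn b).module ℝ

lemma isLinearMap_fibreMk (hmn : m < n) (p : Fm n m E) :
    letI := T.fibreAddCommGroup hmn (rho p)
    letI := T.fibreModule hmn (rho p)
    IsLinearMap ℝ (fibreMk W G p) := by
  let _ := T.fibreAddCommGroup hmn (rho p)
  let _ := T.fibreModule hmn (rho p)
  have h := T.isLinearMap_qchart_fibreMk (T.exists_mem_bchart_source hmn (rho p)).choose_spec
  let e : Fibre (OrbitSpace.proj (W := W) (G := G)) (rho p) ≃ₗ[ℝ] K :=
    (T.fibreCoord hmn (rho p)).linearEquiv ℝ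
  constructor
  · intro A A'
    apply e.injective
    rw [map_add]
    exact h.map_add A A'
  · intro r A
    apply e.injective
    rw [map_smul]
    exact h.map_smul r A

/-- All charts are linear on the fibres, since each fibre is the linear image of `W p` for a fixed
velocity `p`, and `quad` is linear. -/
lemma isLinearMap_qchart_snd (hmn : m < n) {i : T.Idx} {b : Jm n m E}
    (hb : b ∈ (T.bchart i).source) :
    letI := T.fibreAddCommGroup hmn b
    letI := T.fibreModule hmn b
    IsLinearMap ℝ fun x : Fibre (OrbitSpace.proj (W := W) (G := G)) b => (T.qchart i x.1).2 := by
  obtain ⟨p, rfl⟩ := isQuotientMap_rho.surjective b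
  let _ := T.fibreAddCommGroup hmn (rho p)
  let _ := T.fibreModule hmn (rho p)
  have h := T.isLinearMap_fibreMk hmn p
  have h' := T.isLinearMap_qchart_fibreMk hb
  constructor
  · intro x y
    obtain ⟨A, rfl⟩ := T.fibreMk_surjective p x
    obtain ⟨A', rfl⟩ := T.fibreMk_surjective p y
    rw [← h.map_add]
    exact h'.map_add A A'
  · intro r x
    obtain ⟨A, rfl⟩ := T.fibreMk_surjective p x
    rw [← h.map_smul]
    exact h'.map_smul r A

lemma t2Space_quotient (T : BilinearType W G K) (hmn : m < n) [T2Space E] :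
    T2Space (OrbitSpace (overRegular W) G) := by
  have := t2Space_jm (n := n) (m := m) (E := E)
  refine t2Space_of_separating_on_fibres (Z := JmModel n m × K) continuous_proj ?_
  intro x y hxy hne
  obtain ⟨i, hi⟩ := T.exists_mem_bchart_source hmn x.proj
  have hx := (T.mem_qchart_source i x).2 hi
  have hy := (T.mem_qchart_source i y).2 (by rw [← hxy]; exact hi)
  exact ⟨(T.qchart i).source, T.qchart i, (T.qchart i).open_source, hx, hy,
    (T.qchart i).continuousOn, fun h => hne ((T.qchart i).injOn hx hy h)⟩

/-- The charted space structure on the quotient. -/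
@[reducible] def chartedSpace (hmn : m < n) :
    ChartedSpace (JmModel n m × K) (OrbitSpace (overRegular W) G) :=
  quotientChartedSpace (fun i : T.Idx => T.chart i.1 i.2.1 i.2.2) isQuotientMap_mk
    fun x => (T.exists_chart_sec hmn x).imp fun _ h => h.1

lemma paracompactSpace_quotient (T : BilinearType W G K) (hmn : m < n)
    [FiniteDimensional ℝ K] [T2Space E] [ParacompactSpace E] :
    ParacompactSpace (OrbitSpace (overRegular W) G) := by
  have := t2Space_jm (n := n) (m := m) (E := E)
  have := paracompactSpace_jm (E := E) hmn
  have := T.t2Space_quotient hmn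
  let _ := jmChartedSpace (m := m) E hmn
  let _ := T.chartedSpace hmn
  have := FiniteDimensional.proper_real K
  have := ChartedSpace.locallyCompactSpace (JmModel n m) (Jm n m E)
  have := ChartedSpace.locallyCompactSpace (JmModel n m × K) (OrbitSpace (overRegular W) G)
  refine paracompactSpace_of_isSigmaCompact_preimage (B := Jm n m E) continuous_proj fun b => ?_
  obtain ⟨i, hi⟩ := T.exists_mem_bchart_source hmn b
  refine ⟨(T.bchart i).source, (T.bchart i).open_source.mem_nhds hi, fun C hC hCc => ?_⟩
  -- In a chart, the preimage of `C` is the product of `C` with the model fibre `K`.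
  have h1 : IsSigmaCompact ((T.bchart i '' C) ×ˢ (univ : Set K)) :=
    isSigmaCompact_prod (hCc.image_of_continuousOn ((T.bchart i).continuousOn.mono hC))
      isSigmaCompact_univ
  have hsub : (T.bchart i '' C) ×ˢ (univ : Set K) ⊆ (T.qchart i).target := by
    rintro ⟨_, k⟩ ⟨⟨x, hx, rfl⟩, -⟩
    exact T.mem_qchart_target i _ k ((T.bchart i).map_source (hC hx))
  have h2 := h1.image_of_continuousOn ((T.qchart i).symm.continuousOn.mono hsub)
  convert h2
  ext q
  constructor
  · intro hq
    have hq' := (T.mem_qchart_source i q).2 (hC hq)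
    exact ⟨T.qchart i q, ⟨⟨q.proj, hq, (T.fst_qchart i q hq').symm⟩, mem_univ _⟩,
      (T.qchart i).left_inv hq'⟩
  · rintro ⟨⟨u, k⟩, hu, rfl⟩
    have ht := hsub hu
    obtain ⟨⟨x, hx, hxu⟩, -⟩ := hu
    dsimp only at hxu
    have h3 := (T.qchart i).map_target ht
    have h4 := T.fst_qchart i _ h3
    rw [(T.qchart i).right_inv ht] at h4
    have h5 := (T.bchart i).injOn (hC hx) ((T.mem_qchart_source i _).1 h3) (hxu.trans h4)
    change OrbitSpace.proj _ ∈ C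
    rw [← h5]
    exact hx

end BilinearType

end QuotientFibres

/-! ### Smooth structure and vector bundle structure of the quotients -/

/-- A charted space modelled on the normed space `V × K` is also modelled on `ModelProd V K`, the
product of model spaces; the notions of smoothness agree. -/
lemma contMDiffOn_from_prod {V K Q F H N : Type*} [NormedAddCommGroup V] [NormedSpace ℝ V]
    [NormedAddCommGroup K] [NormedSpace ℝ K] [TopologicalSpace Q] [c : ChartedSpace (V × K) Q]
    [NormedAddCommGroup F] [NormedSpace ℝ F] [TopologicalSpace H] {I : ModelWithCorners ℝ F H}
    [TopologicalSpace N] [ChartedSpace H N] {f : Q → N} {s : Set Q}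
    (h : ContMDiffOn 𝓘(ℝ, V × K) I ∞ f s) :
    letI : ChartedSpace (ModelProd V K) Q := c
    ContMDiffOn (𝓘(ℝ, V).prod 𝓘(ℝ, K)) I ∞ f s := by
  rw [← modelWithCornersSelf_prod]
  exact h

/-- The counterpart of `contMDiffOn_from_prod` for maps into a charted space modelled on `V × K`. -/
lemma contMDiffOn_to_prod {V K Q F H N : Type*} [NormedAddCommGroup V] [NormedSpace ℝ V]
    [NormedAddCommGroup K] [NormedSpace ℝ K] [TopologicalSpace Q] [c : ChartedSpace (V × K) Q]
    [NormedAddCommGroup F] [NormedSpace ℝ F] [TopologicalSpace H] {I : ModelWithCorners ℝ F H}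
    [TopologicalSpace N] [ChartedSpace H N] {f : N → Q} {s : Set N}
    (h : ContMDiffOn I 𝓘(ℝ, V × K) ∞ f s) :
    letI : ChartedSpace (ModelProd V K) Q := c
    ContMDiffOn I (𝓘(ℝ, V).prod 𝓘(ℝ, K)) ∞ f s := by
  rw [← modelWithCornersSelf_prod]
  exact h

section QuotientManifold
variable {n m : ℕ} {E : Type*} [TopologicalSpace E] [ChartedSpace (Eu n) E]
  [IsManifold (𝓡 n) ∞ E]
  {W : ∀ p : Tm n m E, Submodule ℝ (Eu m →L[ℝ] TangentSpace (TmModel n m) p)}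
  {G : Subgroup (PrincipalJetGroup m)} {K : Type*} [NormedAddCommGroup K] [NormedSpace ℝ K]
  (T : BilinearType W G K)

lemma jmChart_mem_maximalAtlas (hmn : m < n) (p : Fm n m E) (L : Eu n ≃L[ℝ] Eu m × Eu (n - m)) :
    letI := jmChartedSpace (m := m) E hmn
    (jmChart p L).chart isQuotientMap_rho ∈
      IsManifold.maximalAtlas 𝓘(ℝ, JmModel n m) ∞ (Jm n m E) :=
  chart_mem_maximalAtlas (fun i : Fm n m E × (Eu n ≃L[ℝ] Eu m × Eu (n - m)) => jmChart i.1 i.2)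
    isQuotientMap_rho (fun p => (exists_jmChart_sec hmn p).imp fun _ h => h.1) (p, L)

lemma isManifold_jm (hmn : m < n) :
    letI := jmChartedSpace (m := m) E hmn
    IsManifold 𝓘(ℝ, JmModel n m) ∞ (Jm n m E) :=
  quotient_isManifold _ _ _

lemma isQuotientSubmersion_rho (hmn : m < n) :
    letI := jmChartedSpace (m := m) E hmn
    IsQuotientSubmersion (S := {p : Tm n m E | Regular p}) (TmModel n m) 𝓘(ℝ, JmModel n m)
      (rho : Fm n m E → Jm n m E) :=
  quotient_isQuotientSubmersion _ _ _ fun p => exists_jmChart_sec hmn p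

namespace BilinearType

lemma isManifold_quotient (hmn : m < n) :
    letI := T.chartedSpace hmn
    IsManifold 𝓘(ℝ, JmModel n m × K) ∞ (OrbitSpace (overRegular W) G) :=
  quotient_isManifold _ _ _

lemma qchart_mem_maximalAtlas (hmn : m < n) (i : T.Idx) :
    letI := T.chartedSpace hmn
    T.qchart i ∈ IsManifold.maximalAtlas 𝓘(ℝ, JmModel n m × K) ∞ (OrbitSpace (overRegular W) G) :=
  chart_mem_maximalAtlas (fun i : T.Idx => T.chart i.1 i.2.1 i.2.2)
    isQuotientMap_mk (fun x => (T.exists_chart_sec hmn x).imp fun _ h => h.1) i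

lemma isQuotientSubmersion_mk (hmn : m < n) :
    letI := T.chartedSpace hmn
    IsQuotientSubmersion (TmTmModel n m) 𝓘(ℝ, JmModel n m × K)
      (OrbitSpace.mk (S := overRegular W) G) :=
  quotient_isQuotientSubmersion _ _ _ fun x => T.exists_chart_sec hmn x

/-- The bundle chart given by a chart of the quotient and the chart of `J^m E` below it. -/
def bundleChart (hmn : m < n) (i : T.Idx) :
    letI := jmChartedSpace (m := m) E hmn
    letI : ChartedSpace (ModelProd (JmModel n m) K) (OrbitSpace (overRegular W) G) :=
      T.chartedSpace hmn
    letI := T.fibreAddCommGroup hmn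
    letI := T.fibreModule hmn
    BundleChart (JmModel n m) K (OrbitSpace.proj (W := W) (G := G)) :=
  letI := jmChartedSpace (m := m) E hmn
  letI : ChartedSpace (ModelProd (JmModel n m) K) (OrbitSpace (overRegular W) G) :=
    T.chartedSpace hmn
  letI := T.chartedSpace hmn
  letI := T.fibreAddCommGroup hmn
  letI := T.fibreModule hmn
  { base := T.bchart i
    contMDiffOn_base := contMDiffOn_of_mem_maximalAtlas (jmChart_mem_maximalAtlas hmn _ _)
    contMDiffOn_base_symm := contMDiffOn_symm_of_mem_maximalAtlas (jmChart_mem_maximalAtlas hmn _ _)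
    total := T.qchart i
    contMDiffOn_total := contMDiffOn_from_prod
      (contMDiffOn_of_mem_maximalAtlas (T.qchart_mem_maximalAtlas hmn i))
    contMDiffOn_total_symm := contMDiffOn_to_prod
      (contMDiffOn_symm_of_mem_maximalAtlas (T.qchart_mem_maximalAtlas hmn i))
    mem_source := T.mem_qchart_source i
    mem_target := T.mem_qchart_target i
    fst_total := T.fst_qchart i
    linear := fun _ hb => T.isLinearMap_qchart_snd hmn hb }

/-- The quotient of the double velocities of a symmetry class by the corresponding subgroup of
`P_m` is a manifold and a vector bundle over `J^m E`. -/
theorem isVectorBundleQuotient (T : BilinearType W G K) (hmn : m < n) [FiniteDimensional ℝ K]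
    [T2Space E] [ParacompactSpace E] :
    letI := jmChartedSpace (m := m) E hmn
    IsVectorBundleQuotient W G K := by
  let _ := jmChartedSpace (m := m) E hmn
  let _ : ChartedSpace (ModelProd (JmModel n m) K) (OrbitSpace (overRegular W) G) :=
    T.chartedSpace hmn
  refine ⟨T.chartedSpace hmn, ?_, T.t2Space_quotient hmn, T.paracompactSpace_quotient hmn, ?_,
    T.fibreAddCommGroup hmn, T.fibreModule hmn, T.isLinearMap_fibreMk hmn, ?_⟩
  · rw [← modelWithCornersSelf_prod]
    exact T.isManifold_quotient hmn
  · rw [← modelWithCornersSelf_prod]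
    exact T.isQuotientSubmersion_mk hmn
  · let _ := T.fibreAddCommGroup hmn
    let _ := T.fibreModule hmn
    exact isVectorBundleTotalSpace_of_charts (T.bundleChart hmn)
      fun b => T.exists_mem_bchart_source hmn b

end BilinearType
end QuotientManifold

/-! ### Bilinear maps as arrays -/

section Arrays

lemma contDiff_of_linearMap {V W : Type*} [NormedAddCommGroup V] [NormedSpace ℝ V]
    [FiniteDimensional ℝ V] [NormedAddCommGroup W] [NormedSpace ℝ W] (f : V →ₗ[ℝ] W) :
    ContDiff ℝ ∞ f :=
  (LinearMap.toContinuousLinearMap f).contDiff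

lemma arrayEquiv_apply {m : ℕ} {F : Type*} [NormedAddCommGroup F] [NormedSpace ℝ F]
    [FiniteDimensional ℝ F] (C : Eu m →L[ℝ] F) (i : Fin m) :
    arrayEquiv m F C i = C (EuclideanSpace.single i 1) := by
  have h : arrayEquiv m F C i = C ((EuclideanSpace.basisFun (Fin m) ℝ) i) := rfl
  rw [h, EuclideanSpace.basisFun_apply]

variable (m : ℕ) (F : Type*) [NormedAddCommGroup F] [NormedSpace ℝ F] [FiniteDimensional ℝ F]

/-- Bilinear maps `ℝᵐ × ℝᵐ → F` are arrays of elements of `F`. -/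
def bilArrayEquiv : (Eu m →L[ℝ] Eu m →L[ℝ] F) ≃ₗ[ℝ] (Fin m → Fin m → F) :=
  (arrayEquiv m (Eu m →L[ℝ] F)).toLinearEquiv.trans
    (LinearEquiv.piCongrRight fun _ => (arrayEquiv m F).toLinearEquiv)

variable {m F}

lemma bilArrayEquiv_apply (B : Eu m →L[ℝ] Eu m →L[ℝ] F) (i j : Fin m) :
    bilArrayEquiv m F B i j = B (EuclideanSpace.single i 1) (EuclideanSpace.single j 1) := by
  have h : bilArrayEquiv m F B i j = arrayEquiv m F (arrayEquiv m (Eu m →L[ℝ] F) B i) j := rfl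
  rw [h, arrayEquiv_apply, arrayEquiv_apply]

lemma mem_symClass_iff {a b : ℝ} {B : Eu m →L[ℝ] Eu m →L[ℝ] F} :
    B ∈ symClass a b (Eu m) F ↔
      ∀ i j, a • bilArrayEquiv m F B i j = b • bilArrayEquiv m F B j i := by
  constructor
  · intro h i j
    rw [bilArrayEquiv_apply, bilArrayEquiv_apply]
    exact h _ _
  · intro h
    have h1 : a • B = b • B.flip := by
      apply (bilArrayEquiv m F).injective
      refine funext fun i => funext fun j => ?_
      have h2 := h i j
      rw [bilArrayEquiv_apply, bilArrayEquiv_apply] at h2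
      rw [bilArrayEquiv_apply, bilArrayEquiv_apply]
      exact h2
    intro v w
    exact DFunLike.congr_fun (DFunLike.congr_fun h1 v) w

instance finiteDimensional_bilinear : FiniteDimensional ℝ (Eu m →L[ℝ] Eu m →L[ℝ] F) :=
  (bilArrayEquiv m F).symm.finiteDimensional

end Arrays

/-! ### The three symmetry classes -/

section Types
variable {n m : ℕ} {E : Type*} [TopologicalSpace E] [ChartedSpace (Eu n) E]
  [IsManifold (𝓡 n) ∞ E]
  {W : ∀ p : Tm n m E, Submodule ℝ (Eu m →L[ℝ] TangentSpace (TmModel n m) p)}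
  {G : Subgroup (PrincipalJetGroup m)} {K : Type*} [NormedAddCommGroup K] [NormedSpace ℝ K]

/-- A `BilinearType` from an identification `ι` of the model fibre with the arrays in a symmetry
class. The projection onto the class is any left inverse of the inclusion. -/
def BilinearType.ofArrays (a b : ℝ)
    (mem_W : ∀ (e : E) (C : Eu m →L[ℝ] Eu n) (A), A ∈ W (vel e C) ↔
      ∃ B ∈ symClass a b (Eu m) (Eu n), (⟨vel e C, A⟩ : TmTm n m E) = vert e C B)
    (mem_G : ∀ g, g ∈ G ↔ g.phi = g.sig ∧ g.dsig ∈ symClass a b (Eu m) (Eu m))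
    [FiniteDimensional ℝ K] (ι : K →ₗ[ℝ] Arr n m) (hι : Function.Injective ι)
    (hr : ∀ A : Arr n m, (∃ k, ι k = A) ↔ ∀ i j, a • A i j = b • A j i) : BilinearType W G K :=
  have hinj : LinearMap.ker ((bilArrayEquiv m (Eu (n - m))).symm.toLinearMap ∘ₗ ι) = ⊥ :=
    LinearMap.ker_eq_bot.2 ((bilArrayEquiv m (Eu (n - m))).symm.injective.comp hι)
  have hex := LinearMap.exists_leftInverse_of_injective _ hinj
  { a := a
    b := b
    mem_W := mem_W
    mem_G := mem_G
    incl := (bilArrayEquiv m (Eu (n - m))).symm.toLinearMap ∘ₗ ι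
    proj := hex.choose
    contDiff_incl := contDiff_of_linearMap _
    contDiff_proj := contDiff_of_linearMap _
    proj_incl := fun k => LinearMap.congr_fun hex.choose_spec k
    incl_mem := fun k => by
      rw [mem_symClass_iff]
      have h : bilArrayEquiv m (Eu (n - m))
          (((bilArrayEquiv m (Eu (n - m))).symm.toLinearMap ∘ₗ ι) k) = ι k :=
        (bilArrayEquiv m (Eu (n - m))).apply_symm_apply _
      rw [h]
      exact (hr _).1 ⟨k, rfl⟩
    incl_proj := fun B hB => by
      obtain ⟨k, hk⟩ := (hr _).2 (mem_symClass_iff.1 hB)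
      have h : B = ((bilArrayEquiv m (Eu (n - m))).symm.toLinearMap ∘ₗ ι) k := by
        rw [← (bilArrayEquiv m (Eu (n - m))).symm_apply_apply B, ← hk]
        rfl
      rw [h]
      exact congrArg _ (LinearMap.congr_fun hex.choose_spec k) }

/-- The description of vertical double velocities by `vert` agrees with that by vertical lifts. -/
lemma eq_vert_iff {e : E} {C : Eu m →L[ℝ] Eu n}
    {A : Eu m →L[ℝ] TangentSpace (TmModel n m) (vel e C)} {B : Eu m →L[ℝ] Eu m →L[ℝ] Eu n} :
    (⟨vel e C, A⟩ : TmTm n m E) = vert e C B ↔ ∀ v, A v = vertLift (vel e C) (B v) := by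
  constructor
  · intro h v
    cases h
    exact (vertLift_apply _ _).symm
  · intro h
    refine congrArg (TotalSpace.mk (vel e C)) (ContinuousLinearMap.ext fun v => ?_)
    exact (h v).trans (vertLift_apply _ _)

/-- All bilinear maps, as the class with `0 • B v w = 0 • B w v`, with the semiholonomic
subgroup. -/
def semiholonomicType : BilinearType (fun p : Tm n m E => vertFibre p)
    (PrincipalJetGroup.semiholonomic m) (Arr n m) :=
  .ofArrays 0 0
    (fun e C A => (vertFibre_iff e C A).trans
      ⟨fun ⟨B, h⟩ => ⟨B, fun v w => by simp, h⟩, fun ⟨B, _, h⟩ => ⟨B, h⟩⟩)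
    (fun g => ⟨fun h => ⟨h, fun v w => by simp⟩, fun h => h.1⟩)
    LinearMap.id Function.injective_id (fun A => ⟨fun _ i j => by simp, fun _ => ⟨A, rfl⟩⟩)

/-- Symmetric bilinear maps, with the holonomic subgroup. -/
def holonomicType : BilinearType (fun p : Tm n m E => vertFibreSym p)
    (PrincipalJetGroup.holonomic m) (ArrSym n m) :=
  .ofArrays 1 1
    (fun e C A => by
      constructor
      · rintro ⟨B, h1, h2⟩
        exact ⟨B, fun v w => congrArg _ (h1 v w), eq_vert_iff.2 h2⟩
      · rintro ⟨B, h1, h2⟩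
        refine ⟨B, fun v w => ?_, eq_vert_iff.1 h2⟩
        have h := h1 v w
        rw [one_smul, one_smul] at h
        exact h)
    (fun g => by
      change PrincipalJetGroup.exchange g = g ↔ _
      rw [PrincipalJetGroup.ext_iff]
      constructor
      · rintro ⟨h1, -, h2⟩
        exact ⟨h1.symm, fun v w => congrArg _ (DFunLike.congr_fun (DFunLike.congr_fun h2 v) w).symm⟩
      · rintro ⟨h1, h2⟩
        exact ⟨h1.symm, h1, ContinuousLinearMap.ext fun v => ContinuousLinearMap.ext fun w => by
          have h := h2 w v
          rw [one_smul, one_smul] at h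
          exact h⟩)
    (ArrSym n m).subtype Subtype.val_injective (fun A => by
      constructor
      · rintro ⟨k, rfl⟩ i j
        exact congrArg _ (k.2 i j)
      · intro h
        exact ⟨⟨A, fun i j => by simpa using h i j⟩, rfl⟩)

/-- Skew-symmetric bilinear maps, with the curvature subgroup. -/
def curvatureType : BilinearType (fun p : Tm n m E => vertFibreAlt p)
    (PrincipalJetGroup.curvature m) (ArrAlt n m) :=
  .ofArrays 1 (-1)
    (fun e C A => by
      constructor
      · rintro ⟨B, h1, h2⟩
        exact ⟨B, fun v w => by rw [one_smul, neg_one_smul]; exact h1 v w, eq_vert_iff.2 h2⟩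
      · rintro ⟨B, h1, h2⟩
        refine ⟨B, fun v w => ?_, eq_vert_iff.1 h2⟩
        have h := h1 v w
        rw [one_smul, neg_one_smul] at h
        exact h)
    (fun g => by
      refine and_congr Iff.rfl (forall_congr' fun v => forall_congr' fun w => ?_)
      rw [one_smul, neg_one_smul, eq_neg_iff_add_eq_zero])
    (ArrAlt n m).subtype Subtype.val_injective (fun A => by
      constructor
      · rintro ⟨k, rfl⟩ i j
        rw [one_smul, neg_one_smul]
        exact k.2 i j
      · intro h
        exact ⟨⟨A, fun i j => by simpa using h i j⟩, rfl⟩)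

end Types

end DoubleContact

open DoubleContact
theorem mainTheorem2 (n m : ℕ) (hmn : m < n) (E : Type*) [TopologicalSpace E]
    [ChartedSpace (Eu n) E] [IsManifold (𝓡 n) ∞ E] [T2Space E] [ParacompactSpace E] :
    ∃ _ : ChartedSpace (JmModel n m) (Jm n m E),
      IsManifold 𝓘(ℝ, JmModel n m) ∞ (Jm n m E) ∧
      T2Space (Jm n m E) ∧
      ParacompactSpace (Jm n m E) ∧
      IsQuotientSubmersion (S := {p : Tm n m E | Regular p}) (TmModel n m) 𝓘(ℝ, JmModel n m)
        (rho : Fm n m E → Jm n m E) ∧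
      IsVectorBundleQuotient (fun p : Tm n m E => vertFibre p)
        (PrincipalJetGroup.semiholonomic m) (Arr n m) ∧
      IsVectorBundleQuotient (fun p : Tm n m E => vertFibreSym p)
        (PrincipalJetGroup.holonomic m) (ArrSym n m) ∧
      IsVectorBundleQuotient (fun p : Tm n m E => vertFibreAlt p)
        (PrincipalJetGroup.curvature m) (ArrAlt n m) := by
  refine ⟨jmChartedSpace E hmn, isManifold_jm hmn, t2Space_jm, paracompactSpace_jm hmn,
    isQuotientSubmersion_rho hmn, semiholonomicType.isVectorBundleQuotient hmn,
    holonomicType.isVectorBundleQuotient hmn, curvatureType.isVectorBundleQuotient hmn⟩
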